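/- **Setting.** Let $s\ge 3$, $d_1,\dots,d_s\ge 1$, $D=\sum_j d_j$, $d_{\max}=\max_j d_j$, $d_{\min}=\min_j d_j$, let $\alpha\ge 1$ be an integer with $d_{\max}+d_{\min}>D-2\alpha$, and let $\mathbb X=\mathbb X_1\times\cdots\times\mathbb X_s$ with $\mathbb X_j\subset\mathbb R^{d_j}$ compact, with null boundary and such that every $f\in W_2^\alpha(\mathbb X_j)$ has an extension $F\in W_2^\alpha(\mathbb R^{d_j})$ with $\|F\|_{W_2^\alpha(\mathbb R^{d_j})}\le c\|f\|_{W_2^\alpha(\mathbb X_j)}$. Here $W_2^\alpha$ is the Sobolev space of functions with weak derivatives (in the interior of the domain) of order at most $\alpha$ in $\mathbb L_2$, with $\|f\|_{W_2^\alpha}^2=\sum_{|\beta|\le\alpha}\|\mathcal D^\beta f\|_{\mathbb L_2}^2$. For each $j$ let $\mathcal K_j$ be a continuous positive semidefinite kernel on $\mathbb X_j$ with $\mathcal K_j(x,y)=\sum_{k\ge1}\kappa_{j,k}\phi_{j,k}(x)\phi_{j,k}(y)$, where $\kappa_{j,1}\ge\kappa_{j,2}\ge\cdots\ge0$ and $(\phi_{j,k})_k$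 is an orthonormal basis of $\mathbb L_2(\mathbb X_j)$, and suppose that its reproducing kernel Hilbert space $\{f\in\mathbb L_2(\mathbb X_j):\sum_k\kappa_{j,k}^{-1}\langle f,\phi_{j,k}\rangle^2<\infty\}$ is $W_2^\alpha(\mathbb X_j)$. Let $\lambda^*:\mathbb X\to\mathbb R_+$ satisfy $\lambda^*\in\mathbb L_2(\mathbb X)$, $\|\lambda^*\|_{W_2^\alpha(\mathbb X)}\le L$ and $\|\lambda^*\|_\infty\le L$, let $N^{(1)},\dots,N^{(n)}$ be (not necessarily independent or Poisson) point processes on $\mathbb X$, each a random finite subset with intensity function $\lambda^*$, and let $\emptyset\ne H_1\subseteq\{1,\dots,n\}$. Put $$m=\Bigl\lceil(\|\lambda^*\|_{W_2^\alpha(\mathbb X)}^2\,n)^{1/(2\alpha+d_{\max})}\Bigr\rceil ,$$ and define tensors $b^*,\widehat b\in\mathbb R^{m^{d_1}\times\cdots\times m^{d_s}}$ by $$b^*_{\mu_1,\dots,\mu_s}=\int_{\mathbb X}\lambda^*(x)\prod_j\phi_{j,\mu_j}(x_j)\,dx,\qquad \widehat b_{\mu_1,\dots,\mu_s}=\frac1{|H_1|}\sum_{i\in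 H_1}\sum_{u\in N^{(i)}}\prod_j\phi_{j,\mu_j}(u_j).$$ Let $\mathcal M_j$ be the mode-$j$ matricization and let $\sigma_{j,1}\ge\sigma_{j,2}\ge\cdots\ge0$ be the singular values of $\lambda^*$ viewed as a function $\lambda^*(x_j,x_{-j})$ in $\mathbb L_2(\mathbb X_j)\otimes\mathbb L_2(\prod_{i\ne j}\mathbb X_i)$. For integers $1\le R_j\le m^{d_j}$ let $U_j$ and $\widehat U^{(0)}_j$ in $\mathbb R^{m^{d_j}\times R_j}$ consist of the leading $R_j$ left singular vectors (in any singular value decomposition) of $\mathcal M_j(b^*)$ and of $\mathcal M_j(\widehat b)$. **Fundamental deviation bound.** Suppose that, for given $a_1,a_2>0$, for all deterministic matrices with orthonormal columns $W_{1,j}\in\mathbb R^{m^{d_j}\times r_{1,j}}$ and $W_{2,j}\in\mathbb R^{m^{D-d_j}\times r_{2,j}}$ ($1\le j\le s$), with probability at least $1-m^{-5}$, $$\bigl\|W_{1,j}^\top\mathcal M_j(\widehat b-b^*)W_{2,j}\bigr\|_{\rm op}\le a_1\sqrt{\frac{\|\lambda^*\|_\infty(r_{1,j}+r_{2,j})\log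 m}{n}}+a_2\frac{m^{D/2}\log m}{n}\quad\text{for all }j .$$ **Claim.** There is a constant $C>0$ depending only on $s,(d_j)_j,\alpha,a_1,a_2,L$, and a constant $C_{\rm gap}>0$ depending only on these and on the $\mathbb X_j$, $\mathcal K_j$ and eigenpairs $(\kappa_{j,k},\phi_{j,k})$, such that the following holds. If $$\min_{j}\{\sigma_{j,R_j}-\sigma_{j,R_j+1}\}\ge C_{\rm gap}\max\Bigl\{\|\lambda^*\|_{W_2^\alpha(\mathbb X)}m^{-\alpha},\ \sqrt{\frac{m^{\max(D-d_{\min},\,d_{\max})}\log m}{n}}\Bigr\},$$ then with probability at least $1-3m^{-5}$, for all $j=1,\dots,s$, $$\bigl\|\sin\Theta(\widehat U_j^{(0)},U_j)\bigr\|_{\rm op}\le\frac{C}{\sigma_{j,R_j}-\sigma_{j,R_j+1}}\sqrt{\frac{(m^{D-d_j}+m^{d_j})\log m}{n}},$$ where $\sin\Theta(\widehat U,U)$ is the diagonal matrix of the sines of the principal angles, whose cosines are the singular values of $\widehat U^\top U$. -/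

import Mathlib

open MeasureTheory Filter Topology Matrix
open scoped ENNReal Matrix.Norms.L2Operator

noncomputable section

namespace PointProcessHOSVD

/-! ### Sobolev spaces `W₂^α` through weak derivatives

`e : ι → V` is the family of coordinate vectors of `V = ℝᴰ`, a multi-index is `β : ι → ℕ`. -/

section Sobolev

variable {ι V : Type*} [Fintype ι] [DecidableEq ι] [NormedAddCommGroup V] [NormedSpace ℝ V]
  [MeasureSpace V]

/-- The classical derivative `D^β φ`: each direction `e i` is used `β i` times. It is only
applied to smooth functions, for which the order of differentiation does not matter. -/
def multiDeriv (e : ι → V) (β : ι → ℕ) (φ : V → ℝ) : V → ℝ :=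
  ((Finset.univ : Finset ι).toList.flatMap fun i => List.replicate (β i) (e i)).foldr
    (fun v g => fun x => fderiv ℝ g x v) φ

/-- `g` is a weak `β`-derivative of `f` on the open set `O`. -/
def IsWeakDeriv (e : ι → V) (O : Set V) (β : ι → ℕ) (f g : V → ℝ) : Prop :=
  ∀ φ : V → ℝ, ContDiff ℝ ((⊤ : ℕ∞) : WithTop ℕ∞) φ → HasCompactSupport φ → tsupport φ ⊆ O →
    ∫ x in O, f x * multiDeriv e β φ x = (-1 : ℝ) ^ (∑ i, β i) * ∫ x in O, g x * φ x

/-- `f ∈ W₂^α(O)` for an open set `O`. -/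
def MemSobolev (e : ι → V) (α : ℕ) (O : Set V) (f : V → ℝ) : Prop :=
  MemLp f 2 (volume.restrict O) ∧
    ∀ β : ι → ℕ, ∑ i, β i ≤ α →
      ∃ g : V → ℝ, MemLp g 2 (volume.restrict O) ∧ IsWeakDeriv e O β f g

open Classical in
/-- The weak `β`-derivative of `f` on `O` (unique almost everywhere on `O` when it exists). -/
def weakDeriv (e : ι → V) (O : Set V) (β : ι → ℕ) (f : V → ℝ) : V → ℝ :=
  if h : ∃ g : V → ℝ, MemLp g 2 (volume.restrict O) ∧ IsWeakDeriv e O β f g then h.choose else 0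

/-- `‖f‖_{W₂^α(O)}`, with `‖f‖² = ∑_{|β| ≤ α} ‖D^β f‖²_{L₂(O)}`. -/
def sobolevNorm (e : ι → V) (α : ℕ) (O : Set V) (f : V → ℝ) : ℝ :=
  √(∑ k ∈ Finset.range (α + 1), ∑ β ∈ Finset.piAntidiag (Finset.univ : Finset ι) k,
      (eLpNorm (weakDeriv e O β f) 2 (volume.restrict O)).toReal ^ 2)

end Sobolev

/-- The coordinate vectors of `ℝⁿ`. -/
def stdVec (n : ℕ) (i : Fin n) : Fin n → ℝ := Pi.single i 1

/-- The coordinate vectors of `ℝ^{d 0} × ⋯ × ℝ^{d (s-1)} = ℝᴰ`. -/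
def prodVec {s : ℕ} (d : Fin s → ℕ) (p : Σ j, Fin (d j)) : ∀ j, Fin (d j) → ℝ :=
  Pi.single p.1 (Pi.single p.2 1)

/-- `X ⊂ ℝⁿ` is a compact domain on which the Sobolev space of order `α` is the usual one: the
boundary is a null set and functions in `W₂^α(X)` extend to `W₂^α(ℝⁿ)` with control of the norm. -/
structure IsSobolevDomain {n : ℕ} (α : ℕ) (X : Set (Fin n → ℝ)) : Prop where
  isCompact : IsCompact X
  frontier_null : volume (frontier X) = 0
  extension : ∃ c : ℝ, ∀ f : (Fin n → ℝ) → ℝ, MemSobolev (stdVec n) α (interior X) f →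
    ∃ F : (Fin n → ℝ) → ℝ, MemSobolev (stdVec n) α Set.univ F ∧
      (∀ᵐ x ∂(volume.restrict X), F x = f x) ∧
      sobolevNorm (stdVec n) α Set.univ F ≤ c * sobolevNorm (stdVec n) α (interior X) f

/-! ### Kernels and reproducing kernel Hilbert spaces -/

section Kernel

variable {V : Type*} [TopologicalSpace V] [MeasureSpace V]

/-- `K` is a continuous positive semidefinite kernel on `X` with eigenvalues `eig` in
non-increasing order and eigenfunctions `ψ` forming an orthonormal basis of `L₂(X)`:
`K(x, y) = ∑ₖ eig k * ψ k x * ψ k y`. -/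
structure IsMercerKernel (X : Set V) (K : V → V → ℝ) (eig : ℕ → ℝ) (ψ : ℕ → V → ℝ) : Prop where
  continuousOn : ContinuousOn (fun p : V × V => K p.1 p.2) (X ×ˢ X)
  symm : ∀ x ∈ X, ∀ y ∈ X, K x y = K y x
  posSemidef : ∀ t : Finset V, (t : Set V) ⊆ X → ∀ c : V → ℝ,
    0 ≤ ∑ x ∈ t, ∑ y ∈ t, c x * c y * K x y
  eig_nonneg : ∀ k, 0 ≤ eig k
  eig_antitone : Antitone eig
  memLp : ∀ k, MemLp (ψ k) 2 (volume.restrict X)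
  orthonormal : ∀ k l, ∫ x in X, ψ k x * ψ l x = if k = l then 1 else 0
  complete : ∀ f : V → ℝ, MemLp f 2 (volume.restrict X) → (∀ k, ∫ x in X, f x * ψ k x = 0) →
    ∀ᵐ x ∂(volume.restrict X), f x = 0
  hasSum : ∀ x ∈ X, ∀ y ∈ X, HasSum (fun k => eig k * ψ k x * ψ k y) (K x y)

/-- `f` belongs to the reproducing kernel Hilbert space `H(K)`, that is, `f ∈ L₂(X)` and
`∑ₖ (eig k)⁻¹ ⟨f, ψ k⟩² < ∞`, where a term with `eig k = 0` is finite only if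
`⟨f, ψ k⟩ = 0`. -/
def MemRKHS (X : Set V) (eig : ℕ → ℝ) (ψ : ℕ → V → ℝ) (f : V → ℝ) : Prop :=
  MemLp f 2 (volume.restrict X) ∧
    (∀ k, eig k = 0 → ∫ x in X, f x * ψ k x = 0) ∧
    Summable fun k => (eig k)⁻¹ * (∫ x in X, f x * ψ k x) ^ 2

end Kernel

/-- The kernel `K` on `X ⊂ ℝⁿ`, with eigenpairs `(eig, ψ)`, generates the RKHS `W₂^α(X)`. -/
structure GeneratesSobolev {n : ℕ} (α : ℕ) (X : Set (Fin n → ℝ))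
    (K : (Fin n → ℝ) → (Fin n → ℝ) → ℝ) (eig : ℕ → ℝ) (ψ : ℕ → (Fin n → ℝ) → ℝ) : Prop where
  isMercerKernel : IsMercerKernel X K eig ψ
  memRKHS_iff : ∀ f : (Fin n → ℝ) → ℝ, MemLp f 2 (volume.restrict X) →
    (MemRKHS X eig ψ f ↔ MemSobolev (stdVec n) α (interior X) f)

/-! ### Functions of `s` block variables -/

section Functions

variable {s : ℕ} {d : Fin s → ℕ}

/-- The product domain `X = X 0 × ⋯ × X (s-1)`. -/
def prodDomain (X : ∀ j, Set (Fin (d j) → ℝ)) : Set (∀ j, Fin (d j) → ℝ) := Set.pi Set.univ X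

/-- `‖f‖_{W₂^α(X)}` on the product domain. -/
def sobNorm (α : ℕ) (X : ∀ j, Set (Fin (d j) → ℝ)) (f : (∀ j, Fin (d j) → ℝ) → ℝ) : ℝ :=
  sobolevNorm (prodVec d) α (interior (prodDomain X)) f

/-- `‖f‖_∞` on the product domain. -/
def supNorm (X : ∀ j, Set (Fin (d j) → ℝ)) (f : (∀ j, Fin (d j) → ℝ) → ℝ) : ℝ :=
  (eLpNorm f ∞ (volume.restrict (prodDomain X))).toReal

/-- `f` is a nonnegative function in `L₂(X)` with `‖f‖_{W₂^α(X)} < ∞` and `‖f‖_∞ < ∞`. -/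
structure IsSmoothIntensity (α : ℕ) (X : ∀ j, Set (Fin (d j) → ℝ))
    (f : (∀ j, Fin (d j) → ℝ) → ℝ) : Prop where
  nonneg : ∀ x ∈ prodDomain X, 0 ≤ f x
  memLp_two : MemLp f 2 (volume.restrict (prodDomain X))
  memSobolev : MemSobolev (prodVec d) α (interior (prodDomain X)) f
  memLp_top : MemLp f ∞ (volume.restrict (prodDomain X))

/-- `f(x_j, x_{-j}) = ∑ₖ σ k * Φ k (x_j) * Ψ k (x_{-j})` is a singular value decomposition of
the reshaping of `f` at mode `j`. The singular values are indexed from `0`, that is, `σ k` is the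
`(k+1)`-st singular value `σ_{j,k+1}(f)`. -/
structure IsFunctionSVD (X : ∀ j, Set (Fin (d j) → ℝ)) (f : (∀ j, Fin (d j) → ℝ) → ℝ)
    (j : Fin s) (σ : ℕ → ℝ) (Φ : ℕ → (Fin (d j) → ℝ) → ℝ)
    (Ψ : ℕ → (∀ i : {i // i ≠ j}, Fin (d i) → ℝ) → ℝ) : Prop where
  nonneg : ∀ k, 0 ≤ σ k
  antitone : Antitone σ
  memLp_left : ∀ k, MemLp (Φ k) 2 (volume.restrict (X j))
  orthonormal_left : ∀ k l, ∫ x in X j, Φ k x * Φ l x = if k = l then 1 else 0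
  memLp_right : ∀ k, MemLp (Ψ k) 2
    (volume.restrict (Set.pi Set.univ fun i : {i // i ≠ j} => X i))
  orthonormal_right : ∀ k l,
    ∫ y in Set.pi Set.univ fun i : {i // i ≠ j} => X i, Ψ k y * Ψ l y = if k = l then 1 else 0
  expansion : Tendsto (fun N : ℕ => eLpNorm
      (fun x => f x - ∑ k ∈ Finset.range N, σ k * Φ k (x j) * Ψ k (fun i => x i.1)) 2
      (volume.restrict (prodDomain X))) atTop (𝓝 0)

end Functions

/-! ### Tensors and matrices -/

section Tensors

variable {s : ℕ} {p : Fin s → ℕ}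

/-- An `s`-th order real tensor of size `p 0 × ⋯ × p (s-1)`. -/
abbrev Tensor (p : Fin s → ℕ) : Type := (∀ j, Fin (p j)) → ℝ

/-- The mode-`j` matricization; its columns are indexed by the multi-indices of the other modes. -/
def matricize (B : Tensor p) (j : Fin s) :
    Matrix (Fin (p j)) (∀ i : {i // i ≠ j}, Fin (p i)) ℝ :=
  Matrix.of fun a c => B ((Equiv.piSplitAt j fun i => Fin (p i)).symm (a, c))

/-- `M = U Σ Vᵀ` is a full singular value decomposition: `U`, `V` are orthogonal and `Σ` is
rectangular diagonal with entries `σ 0 ≥ σ 1 ≥ ⋯ ≥ 0`. -/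
structure IsSVD {a : ℕ} {q : Type*} [Fintype q] [DecidableEq q] (M : Matrix (Fin a) q ℝ)
    (U : Matrix (Fin a) (Fin a) ℝ) (σ : ℕ → ℝ) (V : Matrix q (Fin (Fintype.card q)) ℝ) : Prop where
  left_orth : Uᵀ * U = 1
  right_orth : Vᵀ * V = 1
  nonneg : ∀ k, 0 ≤ σ k
  antitone : Antitone σ
  eq : M = U *
    (Matrix.of fun (i : Fin a) (k : Fin (Fintype.card q)) => if i.val = k.val then σ i else 0) * Vᵀ

/-- `W` is a value of `SVD_(R)(M)`: its `R` columns are leading left singular vectors of `M`. -/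
def IsTruncSVD {a R : ℕ} {q : Type*} [Fintype q] [DecidableEq q] (M : Matrix (Fin a) q ℝ)
    (W : Matrix (Fin a) (Fin R) ℝ) : Prop :=
  ∃ (h : R ≤ a) (U : Matrix (Fin a) (Fin a) ℝ) (σ : ℕ → ℝ)
    (V : Matrix q (Fin (Fintype.card q)) ℝ),
    IsSVD M U σ V ∧ ∀ i k, W i k = U i (Fin.castLE h k)

/-- The diagonal matrix `sin Θ(W, U)` of the sines of the principal angles, whose cosines are the
singular values of `Wᵀ U`. -/
def sinTheta {a R : ℕ} (W U : Matrix (Fin a) (Fin R) ℝ) : Matrix (Fin R) (Fin R) ℝ :=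
  Matrix.diagonal fun k : Fin R =>
    Real.sin (Real.arccos ((Matrix.toEuclideanLin (Wᵀ * U)).singularValues k))

end Tensors

/-! ### Point processes and coefficient tensors -/

section PointProcess

variable {s : ℕ} {d : Fin s → ℕ} {Ω : Type*} [MeasurableSpace Ω]

/-- `N` is a point process on the compact product domain (a random finite set of points of it) with
intensity function `f`: for every measurable set `S`, the number `N(S)` of points in `S` is a
random variable with mean `∫_S f`. -/
structure IsPointProcess (P : Measure Ω) (X : ∀ j, Set (Fin (d j) → ℝ))
    (f : (∀ j, Fin (d j) → ℝ) → ℝ) (N : Ω → Finset (∀ j, Fin (d j) → ℝ)) : Prop where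
  subset : ∀ ω, ((N ω : Finset _) : Set (∀ j, Fin (d j) → ℝ)) ⊆ prodDomain X
  measurable : ∀ S : Set (∀ j, Fin (d j) → ℝ), MeasurableSet S →
    Measurable fun ω => ∑ u ∈ N ω, S.indicator (fun _ => (1 : ℝ≥0∞)) u
  intensity : ∀ S : Set (∀ j, Fin (d j) → ℝ), MeasurableSet S →
    ∫⁻ ω, ∑ u ∈ N ω, S.indicator (fun _ => (1 : ℝ≥0∞)) u ∂P
      = ∫⁻ x in S ∩ prodDomain X, ENNReal.ofReal (f x)

/-- The coefficient tensor `b*` of `f` in the first `m ^ d j` basis functions of each block `j`. -/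
def coeffTensor (m : ℕ) (X : ∀ j, Set (Fin (d j) → ℝ)) (φ : ∀ j, ℕ → (Fin (d j) → ℝ) → ℝ)
    (f : (∀ j, Fin (d j) → ℝ) → ℝ) : Tensor fun j => m ^ d j :=
  fun μ => ∫ x in prodDomain X, f x * ∏ j, φ j (μ j) (x j)

/-- The empirical coefficient tensor computed from the processes with index in `H`, for given
realisations `N i` of the processes. -/
def empTensor (m : ℕ) {n : ℕ} (φ : ∀ j, ℕ → (Fin (d j) → ℝ) → ℝ)
    (N : Fin n → Finset (∀ j, Fin (d j) → ℝ)) (H : Finset (Fin n)) : Tensor fun j => m ^ d j :=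
  fun μ => (H.card : ℝ)⁻¹ * ∑ i ∈ H, ∑ u ∈ N i, ∏ j, φ j (μ j) (u j)

/-- The fundamental deviation bound for a random coefficient tensor `B` around `b`, in which `lam`
stands for the sup norm of the intensity: for all deterministic matrices `W₁ j`, `W₂ j` with
orthonormal columns, with probability at least `1 - m⁻⁵`, the norms of
`(W₁ j)ᵀ ⬝ M_j(B - b) ⬝ W₂ j` are bounded simultaneously in `j`. -/
def FundamentalBound (P : Measure Ω) (m n : ℕ) (d : Fin s → ℕ) (a₁ a₂ lam : ℝ)
    (B : Ω → Tensor fun j => m ^ d j) (b : Tensor fun j => m ^ d j) : Prop :=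
  ∀ (r₁ r₂ : Fin s → ℕ) (W₁ : ∀ j, Matrix (Fin (m ^ d j)) (Fin (r₁ j)) ℝ)
    (W₂ : ∀ j, Matrix (∀ i : {i // i ≠ j}, Fin (m ^ d i)) (Fin (r₂ j)) ℝ),
    (∀ j, (W₁ j)ᵀ * W₁ j = 1) → (∀ j, (W₂ j)ᵀ * W₂ j = 1) →
    P {ω | ¬ ∀ j, ‖(W₁ j)ᵀ * matricize (B ω - b) j * W₂ j‖ ≤
        a₁ * √(lam * ((r₁ j : ℝ) + r₂ j) * Real.log m / n) +
          a₂ * ((m : ℝ) ^ ((∑ k, d k : ℕ) / 2 : ℝ) * Real.log m / n)}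
      ≤ ENNReal.ofReal (1 / (m : ℝ) ^ 5)

end PointProcess

end PointProcessHOSVD

end

/-! The left singular subspaces of `M = M_j(b*)` and `M' = M_j(b̂)` are compared by Wedin's theorem,
whose error is `E = ‖M' - M‖` and whose natural gap is the difference between the `R`-th singular
value of `M` and the `(R+1)`-st of `M'`. The gap condition concerns the function `λ*` instead, so
both values must be related to those of `λ*`.

`M` is the compression of the integral operator with kernel `λ*` to spans of product eigenfunctions.
Compression does not raise singular values, so the `(R+1)`-st value of `M'` is at most `σ_{R+1} + E`
(`IsTensorExpansion.singularValue_perturbed_le`). Conversely the `R`-th value of `M` is at least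
`σ_R - ε`, with `ε` the size of the truncated part (`IsTensorExpansion.le_singularValue_add`). When
`4E` and `4ε` are at most the gap of `λ*`, half of that gap survives and Wedin applies. When `4E`
exceeds the gap, the claim is the trivial bound by one (`norm_sinTheta_mul_le`). The truncation
error thus enters only through the gap condition, which keeps the final constant independent of the
kernels and domains.

The truncation bound `ε ≤ C ‖λ*‖ m^(-α)` is the analytic part. A discarded coefficient has a large
index in some block `j`; pairing `λ*` with basis functions of the other blocks leaves Sobolev
functions of `x_j` whose squared norms sum to at most `‖λ*‖²`, by Bessel
(`sum_sobolev_blockMarginal_le`). In one block, the open mapping theorem makes the RKHS and Sobolev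
norms comparable, so a coefficient tail is controlled by an eigenvalue (`exists_sum_coeff_sq_le`),
and it remains to show `eig (m ^ n) ≤ C m^(-2α)`.

For this decay (`exists_eig_mul_le`), the span of the first `M + 1` eigenfunctions contains, by
counting dimensions, a nonzero `w` orthogonal to all trigonometric functions of frequency below `p`.
Its squared Sobolev norm is at most a constant times `(eig M)⁻¹ ‖w‖²`. Extended to the whole space
and cut off, it has Fourier coefficients decaying at order `α`, so `‖w‖⁴ ≤ C p^(-2α) (eig M)⁻¹
‖w‖⁴`.

The probabilistic input is the fundamental bound with square orthogonal matrices, which controls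
`E`. The choice of `m` and the dimension condition absorb its second term into the first
(`fluctuation_le`). -/

open MeasureTheory Filter Topology Matrix
open scoped ENNReal Matrix.Norms.L2Operator

noncomputable section

namespace PointProcessHOSVD

/-! ### Rectangular diagonal matrices -/

section RectDiag

/-- The rectangular diagonal matrix with diagonal entries `τ 0, τ 1, …`. -/
def rectDiag (a b : ℕ) (τ : ℕ → ℝ) : Matrix (Fin a) (Fin b) ℝ :=
  Matrix.of fun i k => if i.val = k.val then τ i else 0

theorem rectDiag_apply {a b : ℕ} (τ : ℕ → ℝ) (i : Fin a) (k : Fin b) :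
    rectDiag a b τ i k = if i.val = k.val then τ i else 0 := rfl

theorem rectDiag_transpose (a b : ℕ) (τ : ℕ → ℝ) : (rectDiag a b τ)ᵀ = rectDiag b a τ := by
  ext i k
  simp only [transpose_apply, rectDiag_apply]
  by_cases h : k.val = i.val
  · simp [h]
  · simp [h, Ne.symm h]

theorem rectDiag_mul (a b c : ℕ) (τ υ : ℕ → ℝ) :
    rectDiag a b τ * rectDiag b c υ = rectDiag a c fun k => if k < b then τ k * υ k else 0 := by
  ext i k
  simp only [mul_apply, rectDiag_apply]
  by_cases h : i.val < b
  · rw [Finset.sum_eq_single (⟨i.val, h⟩ : Fin b)]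
    · simp [h]
    · intro l _ hl
      rw [if_neg, zero_mul]
      exact fun h' => hl (Fin.ext h'.symm)
    · simp
  · rw [Finset.sum_eq_zero]
    · simp [h]
    · intro l _
      rw [if_neg, zero_mul]
      have := l.isLt
      omega

theorem rectDiag_congr {a b : ℕ} {τ υ : ℕ → ℝ} (h : ∀ k, k < a → k < b → τ k = υ k) :
    rectDiag a b τ = rectDiag a b υ := by
  ext i k
  simp only [rectDiag_apply]
  by_cases hik : i.val = k.val
  · simp [hik, h k.val (hik ▸ i.isLt) k.isLt]
  · simp [hik]

theorem rectDiag_one (a : ℕ) : rectDiag a a (fun _ => 1) = 1 := by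
  ext i k
  simp [rectDiag_apply, one_apply, Fin.ext_iff]

/-- The C*-identity turns the square of the operator norm into the norm of a square diagonal matrix,
which is a maximum of squared entries. -/
theorem norm_rectDiag_le {a b : ℕ} {τ : ℕ → ℝ} {c : ℝ} (hc : 0 ≤ c) (h : ∀ k, |τ k| ≤ c) :
    ‖rectDiag a b τ‖ ≤ c := by
  have h1 : (rectDiag a b τ)ᴴ * rectDiag a b τ
      = diagonal fun k : Fin b => if k.val < a then τ k * τ k else 0 := by
    rw [conjTranspose_eq_transpose_of_trivial, rectDiag_transpose, rectDiag_mul]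
    ext i k
    simp [rectDiag_apply, diagonal_apply, Fin.ext_iff]
  have h2 := l2_opNorm_conjTranspose_mul_self (rectDiag a b τ)
  rw [h1, l2_opNorm_diagonal] at h2
  have h3 : ‖fun k : Fin b => if k.val < a then τ k * τ k else 0‖ ≤ c * c := by
    refine (pi_norm_le_iff_of_nonneg (by positivity)).2 fun k => ?_
    split_ifs
    · rw [norm_mul, Real.norm_eq_abs]
      exact mul_le_mul (h k) (h k) (abs_nonneg _) hc
    · simpa using mul_nonneg hc hc
  rw [h2] at h3
  exact abs_le_of_sq_le_sq' (by nlinarith) hc |>.2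

/-- The diagonal projection onto the first `R` coordinates. -/
def headProj (a R : ℕ) : Matrix (Fin a) (Fin a) ℝ := rectDiag a a fun k => if k < R then 1 else 0

/-- The diagonal projection onto the coordinates from the `R`-th on. -/
def tailProj (a R : ℕ) : Matrix (Fin a) (Fin a) ℝ := rectDiag a a fun k => if k < R then 0 else 1

theorem norm_headProj_le (a R : ℕ) : ‖headProj a R‖ ≤ 1 :=
  norm_rectDiag_le zero_le_one fun k => by split_ifs <;> simp

theorem norm_tailProj_le (a R : ℕ) : ‖tailProj a R‖ ≤ 1 :=
  norm_rectDiag_le zero_le_one fun k => by split_ifs <;> simp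

theorem norm_le_one_of_transpose_mul_self {p a : Type*} [Fintype p] [DecidableEq p] [Fintype a]
    [DecidableEq a] {U : Matrix p a ℝ} (h : Uᵀ * U = 1) : ‖U‖ ≤ 1 := by
  have h2 := l2_opNorm_conjTranspose_mul_self U
  rw [conjTranspose_eq_transpose_of_trivial, h, ← diagonal_one, l2_opNorm_diagonal] at h2
  have h3 : ‖fun _ : a => (1 : ℝ)‖ ≤ 1 := by
    refine (pi_norm_le_iff_of_nonneg zero_le_one).2 fun k => by simp
  rw [h2] at h3
  exact abs_le_of_sq_le_sq' (by nlinarith) zero_le_one |>.2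

theorem norm_transpose {p a : Type*} [Fintype p] [DecidableEq p] [Fintype a]
    [DecidableEq a] (U : Matrix p a ℝ) : ‖Uᵀ‖ = ‖U‖ := by
  rw [← conjTranspose_eq_transpose_of_trivial, l2_opNorm_conjTranspose]

end RectDiag

/-! ### Perturbation of singular subspaces -/

section Wedin

variable {p q : Type*} [Fintype p] [DecidableEq p] [Fintype q] [DecidableEq q] {a b : ℕ}

/-- Half of Wedin's theorem: the angle between the left singular subspaces is controlled by the
angle between the right ones. -/
theorem norm_left_angle_mul_le {M M' : Matrix p q ℝ} {U U' : Matrix p (Fin a) ℝ}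
    {V V' : Matrix q (Fin b) ℝ} {σ σ' : ℕ → ℝ} (hU' : U'ᵀ * U' = 1)
    (hV : Vᵀ * V = 1) (hM : M = U * rectDiag a b σ * Vᵀ) (hM' : M' = U' * rectDiag a b σ' * V'ᵀ)
    (hσ : Antitone σ) (hσ' : Antitone σ') (hσ'0 : ∀ k, 0 ≤ σ' k) {R : ℕ} (hRb : R ≤ b)
    (hpos : 0 < σ (R - 1)) :
    ‖tailProj a R * (U'ᵀ * U) * headProj a R‖ * σ (R - 1)
      ≤ σ' R * ‖tailProj b R * (V'ᵀ * V) * headProj b R‖ + ‖M' - M‖ := by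
  set A := tailProj a R * (U'ᵀ * U) * headProj a R with hA
  set B := tailProj b R * (V'ᵀ * V) * headProj b R with hB
  -- Both sides come from `U'ᵀ M V = U'ᵀ M' V - U'ᵀ (M' - M) V`: on the left `M V = U Σ`, on the
  -- right `U'ᵀ M' = Σ' V'ᵀ`, and the coordinate projections pass through the diagonal factors.
  have key : A * rectDiag a b σ
      = (tailProj a R * rectDiag a b σ') * B
        - tailProj a R * (U'ᵀ * (M' - M) * V) * headProj b R := by
    have e1 : headProj a R * rectDiag a b σ = rectDiag a b σ * headProj b R := by
      rw [headProj, headProj, rectDiag_mul, rectDiag_mul]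
      refine rectDiag_congr fun k h1 h2 => by simp [h1, h2]
    have e2 : tailProj a R * rectDiag a b σ' * tailProj b R = tailProj a R * rectDiag a b σ' := by
      rw [tailProj, tailProj, rectDiag_mul, rectDiag_mul]
      refine rectDiag_congr fun k h1 h2 => by by_cases hk : k < R <;> simp [h1, h2, hk]
    have e3 : U * rectDiag a b σ = M * V := by
      rw [hM, Matrix.mul_assoc _ Vᵀ, hV, Matrix.mul_one]
    have e4 : U'ᵀ * M' = rectDiag a b σ' * V'ᵀ := by
      rw [hM', ← Matrix.mul_assoc, ← Matrix.mul_assoc, hU', Matrix.one_mul]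
    have l1 : A * rectDiag a b σ = tailProj a R * (U'ᵀ * (M * V)) * headProj b R := by
      rw [hA, Matrix.mul_assoc _ (headProj a R), e1, ← e3]
      simp only [Matrix.mul_assoc]
    have l2 : tailProj a R * rectDiag a b σ' * B
        = tailProj a R * (U'ᵀ * M' * V) * headProj b R := by
      rw [hB, e4]
      simp only [← Matrix.mul_assoc]
      rw [e2]
    rw [l1, l2, Matrix.mul_sub]
    simp only [Matrix.mul_sub, Matrix.sub_mul, Matrix.mul_assoc]
    abel
  -- Inverse of `Σ` on the first `R` coordinates. Indices start at zero, so `σ (R - 1)` is the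
  -- smallest singular value inverted.
  set T := rectDiag b a fun k => if k < R then (σ k)⁻¹ else 0 with hT
  have hle : ∀ k, k < R → σ (R - 1) ≤ σ k := fun k hk => hσ (by omega)
  have hAT : A = A * rectDiag a b σ * T := by
    have : headProj a R * rectDiag a b σ * T = headProj a R := by
      rw [hT, headProj, rectDiag_mul, rectDiag_mul]
      refine rectDiag_congr fun k h1 _ => ?_
      by_cases hk : k < R
      · have : σ k ≠ 0 := (hpos.trans_le (hle k hk)).ne'
        simp [hk, h1, hk.trans_le hRb, this]
      · simp [hk]
    rw [hA]
    nth_rewrite 1 [← this]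
    simp only [Matrix.mul_assoc]
  have hTn : ‖T‖ ≤ (σ (R - 1))⁻¹ := by
    refine norm_rectDiag_le (by positivity) fun k => ?_
    split_ifs with hk
    · rw [abs_of_pos (inv_pos.2 (hpos.trans_le (hle k hk)))]
      exact inv_anti₀ hpos (hle k hk)
    · simpa using hpos.le
  -- The tail projection removes the indices below `R`, so the largest remaining singular value is
  -- `σ' R`.
  have hS : ‖tailProj a R * rectDiag a b σ'‖ ≤ σ' R := by
    rw [tailProj, rectDiag_mul]
    refine norm_rectDiag_le (hσ'0 R) fun k => ?_
    by_cases hk : k < R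
    · simpa [hk] using hσ'0 R
    · by_cases hka : k < a
      · simpa [hk, hka, abs_of_nonneg (hσ'0 k)] using hσ' (not_lt.1 hk)
      · simpa [hka] using hσ'0 R
  have hE : ‖tailProj a R * (U'ᵀ * (M' - M) * V) * headProj b R‖ ≤ ‖M' - M‖ := by
    have n1 : ‖U'ᵀ‖ ≤ 1 := by rw [norm_transpose]; exact norm_le_one_of_transpose_mul_self hU'
    have n2 : ‖V‖ ≤ 1 := norm_le_one_of_transpose_mul_self hV
    have n3 := norm_tailProj_le a R
    have n4 := norm_headProj_le b R
    calc _ ≤ ‖tailProj a R‖ * (‖U'ᵀ‖ * ‖M' - M‖ * ‖V‖) * ‖headProj b R‖ := by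
            refine (l2_opNorm_mul _ _).trans (mul_le_mul_of_nonneg_right ?_ (norm_nonneg _))
            refine (l2_opNorm_mul _ _).trans (mul_le_mul_of_nonneg_left ?_ (norm_nonneg _))
            refine (l2_opNorm_mul _ _).trans (mul_le_mul_of_nonneg_right ?_ (norm_nonneg _))
            exact l2_opNorm_mul _ _
      _ ≤ 1 * (1 * ‖M' - M‖ * 1) * 1 := by gcongr
      _ = _ := by ring
  have h1 : ‖A‖ ≤ (σ' R * ‖B‖ + ‖M' - M‖) * (σ (R - 1))⁻¹ := by
    calc ‖A‖ = ‖A * rectDiag a b σ * T‖ := by rw [← hAT]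
      _ ≤ ‖A * rectDiag a b σ‖ * ‖T‖ := l2_opNorm_mul _ _
      _ ≤ (σ' R * ‖B‖ + ‖M' - M‖) * (σ (R - 1))⁻¹ := by
        refine mul_le_mul ?_ hTn (norm_nonneg _)
          (add_nonneg (mul_nonneg (hσ'0 R) (norm_nonneg _)) (norm_nonneg _))
        rw [key]
        refine (norm_sub_le _ _).trans (add_le_add ?_ hE)
        exact (l2_opNorm_mul _ _).trans (mul_le_mul_of_nonneg_right hS (norm_nonneg _))
  calc ‖A‖ * σ (R - 1) ≤ (σ' R * ‖B‖ + ‖M' - M‖) * (σ (R - 1))⁻¹ * σ (R - 1) := by gcongr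
    _ = _ := by field_simp

/-- Wedin's theorem for the left singular subspaces. -/
theorem norm_left_angle_mul_gap_le {M M' : Matrix p q ℝ} {U U' : Matrix p (Fin a) ℝ}
    {V V' : Matrix q (Fin b) ℝ} {σ σ' : ℕ → ℝ} (hU : Uᵀ * U = 1) (hU' : U'ᵀ * U' = 1)
    (hV : Vᵀ * V = 1) (hV' : V'ᵀ * V' = 1) (hM : M = U * rectDiag a b σ * Vᵀ)
    (hM' : M' = U' * rectDiag a b σ' * V'ᵀ)
    (hσ : Antitone σ) (hσ' : Antitone σ') (hσ'0 : ∀ k, 0 ≤ σ' k) {R : ℕ} (hRa : R ≤ a)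
    (hRb : R ≤ b) (hgap : 0 < σ (R - 1) - σ' R) :
    ‖tailProj a R * (U'ᵀ * U) * headProj a R‖ * (σ (R - 1) - σ' R) ≤ ‖M' - M‖ := by
  have hpos : 0 < σ (R - 1) := by linarith [hσ'0 R]
  have h1 := norm_left_angle_mul_le hU' hV hM hM' hσ hσ' hσ'0 hRb hpos
  have hMt : Mᵀ = V * rectDiag b a σ * Uᵀ := by
    rw [hM, transpose_mul, transpose_mul, rectDiag_transpose, transpose_transpose, Matrix.mul_assoc]
  have hMt' : M'ᵀ = V' * rectDiag b a σ' * U'ᵀ := by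
    rw [hM', transpose_mul, transpose_mul, rectDiag_transpose, transpose_transpose,
      Matrix.mul_assoc]
  -- The same inequality for the transposes exchanges the roles of the left and right angles.
  have h2 := norm_left_angle_mul_le hV' hU hMt hMt' hσ hσ' hσ'0 hRa hpos
  rw [← transpose_sub, norm_transpose] at h2
  have h0 := hσ'0 R
  set x := ‖tailProj a R * (U'ᵀ * U) * headProj a R‖
  set y := ‖tailProj b R * (V'ᵀ * V) * headProj b R‖
  -- The larger of the two angles satisfies the claimed bound: its own inequality has the other
  -- angle on the right, which may be replaced by it. If that is `y`, the bound passes to `x ≤ y`.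
  rcases le_total y x with h | h
  · nlinarith
  · have : y * (σ (R - 1) - σ' R) ≤ ‖M' - M‖ := by nlinarith
    nlinarith

end Wedin

/-! ### Sines of principal angles -/

section SinTheta

theorem norm_toLp_mulVec_sq {p q : Type*} [Fintype p] [Fintype q] [DecidableEq q]
    (A : Matrix p q ℝ) (x : q → ℝ) :
    ‖WithLp.toLp 2 (A *ᵥ x)‖ ^ 2 = x ⬝ᵥ ((Aᵀ * A) *ᵥ x) := by
  rw [EuclideanSpace.real_norm_sq_eq, ← mulVec_mulVec, dotProduct_mulVec, vecMul_transpose]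
  simp [dotProduct, sq]

theorem norm_toLp_mulVec_of_orthonormal {p q : Type*} [Fintype p] [Fintype q] [DecidableEq q]
    {A : Matrix p q ℝ} (hA : Aᵀ * A = 1) (x : q → ℝ) :
    ‖WithLp.toLp 2 (A *ᵥ x)‖ = ‖WithLp.toLp 2 x‖ := by
  have h : ‖WithLp.toLp 2 (A *ᵥ x)‖ ^ 2 = ‖WithLp.toLp 2 x‖ ^ 2 := by
    rw [norm_toLp_mulVec_sq, hA, one_mulVec, EuclideanSpace.real_norm_sq_eq]
    simp [dotProduct, sq]
  exact (sq_eq_sq₀ (norm_nonneg _) (norm_nonneg _)).1 h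

theorem norm_toLp_mulVec_le {p q : Type*} [Fintype p] [DecidableEq p] [Fintype q] [DecidableEq q]
    (A : Matrix p q ℝ) (x : q → ℝ) :
    ‖WithLp.toLp 2 (A *ᵥ x)‖ ≤ ‖A‖ * ‖WithLp.toLp 2 x‖ :=
  l2_opNorm_mulVec A (WithLp.toLp 2 x)

/-- The selection of the first `R` columns. -/
theorem leading_eq_mul_rectDiag {p : Type*} [Fintype p] {a R : ℕ} (U : Matrix p (Fin a) ℝ)
    (W : Matrix p (Fin R) ℝ) (h : R ≤ a) (hW : ∀ i k, W i k = U i (Fin.castLE h k)) :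
    W = U * rectDiag a R fun _ => 1 := by
  ext i k
  rw [mul_apply, Finset.sum_eq_single (Fin.castLE h k), hW]
  · simp [rectDiag_apply]
  · intro l _ hl
    rw [rectDiag_apply, if_neg, mul_zero]
    exact fun h' => hl (Fin.ext h')
  · simp

/-- In the first `R` columns of the orthogonal matrix `Y = U'ᵀ U`, the top block `G` carries the
cosines and the bottom block is `A`. Since the columns are orthonormal, `GᵀG + AᵀA = 1` on the first
`R` coordinates. At an eigenvector of `GᵀG` this reads `sin² = 1 - cos² ≤ ‖A‖²`. -/
theorem norm_sinTheta_le {a R : ℕ} (hRa : R ≤ a) {U U' : Matrix (Fin a) (Fin a) ℝ}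
    (hU : Uᵀ * U = 1) (hU' : U'ᵀ * U' = 1) :
    ‖sinTheta (U' * rectDiag a R fun _ => 1) (U * rectDiag a R fun _ => 1)‖
      ≤ ‖tailProj a R * (U'ᵀ * U) * headProj a R‖ := by
  set J := rectDiag a R fun _ => 1 with hJ
  set Y := U'ᵀ * U with hY
  set A := tailProj a R * Y * headProj a R with hA
  have hYY : Yᵀ * Y = 1 := by
    have : U' * U'ᵀ = 1 := mul_eq_one_comm.1 hU'
    rw [hY, transpose_mul, transpose_transpose, Matrix.mul_assoc, ← Matrix.mul_assoc U', this,
      Matrix.one_mul, hU]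
  have hJJ : Jᵀ * J = 1 := by
    rw [hJ, rectDiag_transpose, rectDiag_mul, ← rectDiag_one]
    exact rectDiag_congr fun k hk _ => by simp [hk.trans_le hRa]
  have hhead : J * Jᵀ = headProj a R := by
    rw [hJ, rectDiag_transpose, rectDiag_mul, headProj]
    simp
  have hsplit : headProj a R + (tailProj a R)ᵀ * tailProj a R = 1 := by
    rw [headProj, tailProj, rectDiag_transpose, rectDiag_mul]
    ext i k
    simp only [Matrix.add_apply, rectDiag_apply, one_apply, Fin.ext_iff]
    by_cases h1 : i.val = k.val <;> by_cases h2 : k.val < R <;> simp [h1, h2]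
  have hhJ : headProj a R * J = J := by
    rw [← hhead, Matrix.mul_assoc, hJJ, Matrix.mul_one]
  have hG : (U' * J)ᵀ * (U * J) = Jᵀ * Y * J := by
    rw [transpose_mul, hY]; simp only [Matrix.mul_assoc]
  have hAJ : A * J = tailProj a R * Y * J := by
    rw [hA, Matrix.mul_assoc, hhJ]
  -- Orthonormality of the first `R` columns of `Y`, split into the rows below `R` and the rows from
  -- `R` on.
  have hpyth : (Jᵀ * Y * J)ᵀ * (Jᵀ * Y * J) + (A * J)ᵀ * (A * J) = 1 := by
    rw [hAJ]
    have : (Jᵀ * Y * J)ᵀ * (Jᵀ * Y * J) + (tailProj a R * Y * J)ᵀ * (tailProj a R * Y * J)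
        = Jᵀ * (Yᵀ * ((J * Jᵀ + (tailProj a R)ᵀ * tailProj a R) * Y)) * J := by
      simp only [transpose_mul, transpose_transpose, Matrix.mul_assoc, Matrix.add_mul,
        Matrix.mul_add]
    rw [this, hhead, hsplit, Matrix.one_mul, hYY, Matrix.mul_one, hJJ]
  rw [sinTheta, l2_opNorm_diagonal, hG]
  refine (pi_norm_le_iff_of_nonneg (norm_nonneg _)).2 fun k => ?_
  set G := Matrix.toEuclideanLin (Jᵀ * Y * J)
  have hk : k.val < Module.finrank ℝ (EuclideanSpace ℝ (Fin R)) := by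
    simp
  obtain ⟨x, hx⟩ := (G.hasEigenvalue_adjoint_comp_self_sq_singularValues hk).exists_hasEigenvector
  have hx0 : 0 < ‖x‖ := norm_pos_iff.2 hx.2
  have hGx : ‖G x‖ ^ 2 = G.singularValues k ^ 2 * ‖x‖ ^ 2 := by
    have h1 := hx.apply_eq_smul
    have h2 : inner ℝ (LinearMap.adjoint G (G x)) x = inner ℝ (G x) (G x) :=
      LinearMap.adjoint_inner_left _ _ _
    rw [LinearMap.comp_apply] at h1
    rw [h1, inner_smul_left, real_inner_self_eq_norm_sq, real_inner_self_eq_norm_sq] at h2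
    simpa using h2.symm
  have hGx' : ‖G x‖ ^ 2 = x.ofLp ⬝ᵥ (((Jᵀ * Y * J)ᵀ * (Jᵀ * Y * J)) *ᵥ x.ofLp) :=
    norm_toLp_mulVec_sq (Jᵀ * Y * J) x.ofLp
  have hAx := norm_toLp_mulVec_sq (A * J) x.ofLp
  have hxx : x.ofLp ⬝ᵥ x.ofLp = ‖x‖ ^ 2 := by
    rw [EuclideanSpace.real_norm_sq_eq]; simp [dotProduct, sq]
  have hsum : ‖G x‖ ^ 2 + ‖WithLp.toLp 2 ((A * J) *ᵥ x.ofLp)‖ ^ 2 = ‖x‖ ^ 2 := by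
    rw [hGx', hAx, ← dotProduct_add, ← add_mulVec, hpyth, one_mulVec, hxx]
  have hAJn : ‖WithLp.toLp 2 ((A * J) *ᵥ x.ofLp)‖ ≤ ‖A‖ * ‖x‖ := by
    refine (norm_toLp_mulVec_le _ _).trans ?_
    refine mul_le_mul_of_nonneg_right ?_ (norm_nonneg _)
    calc ‖A * J‖ ≤ ‖A‖ * ‖J‖ := l2_opNorm_mul _ _
      _ ≤ ‖A‖ * 1 := by
        gcongr
        exact norm_le_one_of_transpose_mul_self hJJ
      _ = ‖A‖ := mul_one _
  have hfin : 1 - G.singularValues k ^ 2 ≤ ‖A‖ ^ 2 := by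
    have h3 : (1 - G.singularValues k ^ 2) * ‖x‖ ^ 2 ≤ ‖A‖ ^ 2 * ‖x‖ ^ 2 := by
      rw [← mul_pow]
      have := pow_le_pow_left₀ (norm_nonneg _) hAJn 2
      nlinarith
    exact le_of_mul_le_mul_right h3 (by positivity)
  rw [Real.sin_arccos, Real.norm_eq_abs, abs_of_nonneg (Real.sqrt_nonneg _)]
  exact Real.sqrt_le_iff.2 ⟨norm_nonneg _, hfin⟩

theorem norm_sinTheta_le_one {a R : ℕ} (W U : Matrix (Fin a) (Fin R) ℝ) : ‖sinTheta W U‖ ≤ 1 := by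
  rw [sinTheta, l2_opNorm_diagonal]
  exact (pi_norm_le_iff_of_nonneg zero_le_one).2 fun k => Real.abs_sin_le_one _

/-- The singular values of an SVD beyond the dimensions may be taken to be zero. -/
theorem IsSVD.exists_normalized {a : ℕ} {q : Type*} [Fintype q] [DecidableEq q]
    {M : Matrix (Fin a) q ℝ} {U : Matrix (Fin a) (Fin a) ℝ} {σ : ℕ → ℝ}
    {V : Matrix q (Fin (Fintype.card q)) ℝ} (h : IsSVD M U σ V) :
    ∃ τ : ℕ → ℝ, (∀ k, 0 ≤ τ k) ∧ Antitone τ ∧ (∀ k, min a (Fintype.card q) ≤ k → τ k = 0) ∧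
      M = U * rectDiag a (Fintype.card q) τ * Vᵀ := by
  refine ⟨fun k => if k < min a (Fintype.card q) then σ k else 0, fun k => ?_, fun k l hkl => ?_,
    fun k hk => if_neg (not_lt.2 hk), ?_⟩
  · dsimp only
    split_ifs
    exacts [h.nonneg k, le_rfl]
  · dsimp only
    split_ifs with h1 h2
    · exact h.antitone hkl
    · exact absurd (hkl.trans_lt h1) h2
    · exact h.nonneg k
    · exact le_rfl
  · rw [h.eq]
    congr 2
    exact rectDiag_congr fun k h1 h2 => by simp [h1, h2]

end SinTheta

/-! ### Weyl's inequalities for compressions of an operator given by a singular value expansion -/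

section Weyl

variable {H₁ H₂ H : Type*} [NormedAddCommGroup H₁] [InnerProductSpace ℝ H₁]
  [NormedAddCommGroup H₂] [InnerProductSpace ℝ H₂] [NormedAddCommGroup H] [InnerProductSpace ℝ H]

/-- `f = ∑ₖ σ k • Φ k ⊗ Ψ k` with orthonormal `Φ`, `Ψ`, where `T` stands for the tensor product. -/
structure IsTensorExpansion (T : H₁ →ₗ[ℝ] H₂ →ₗ[ℝ] H) (f : H) (σ : ℕ → ℝ) (Φ : ℕ → H₁)
    (Ψ : ℕ → H₂) : Prop where
  inner_tensor : ∀ u v u' v', inner ℝ (T u v) (T u' v') = inner ℝ u u' * inner ℝ v v'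
  nonneg : ∀ k, 0 ≤ σ k
  antitone : Antitone σ
  left : Orthonormal ℝ Φ
  right : Orthonormal ℝ Ψ
  tendsto : Tendsto (fun N => ∑ k ∈ Finset.range N, σ k • T (Φ k) (Ψ k)) atTop (𝓝 f)

variable {T : H₁ →ₗ[ℝ] H₂ →ₗ[ℝ] H} {f : H} {σ : ℕ → ℝ} {Φ : ℕ → H₁} {Ψ : ℕ → H₂}

theorem IsTensorExpansion.tendsto_inner (h : IsTensorExpansion T f σ Φ Ψ) (u : H₁) (v : H₂) :
    Tendsto (fun N => ∑ k ∈ Finset.range N, σ k * (inner ℝ (Φ k) u * inner ℝ (Ψ k) v)) atTop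
      (𝓝 (inner ℝ f (T u v))) := by
  have := (h.tendsto.inner (tendsto_const_nhds (x := T u v)) : Tendsto _ _ (𝓝 (inner ℝ _ _)))
  refine this.congr fun N => ?_
  rw [sum_inner]
  refine Finset.sum_congr rfl fun k _ => ?_
  rw [real_inner_smul_left, h.inner_tensor]

/-- Cauchy–Schwarz for sums, followed by Bessel's inequality for each of the two families. -/
theorem sum_abs_inner_mul_le_of_orthonormal {ι : Type*} {e : ι → H₁} (he : Orthonormal ℝ e)
    {g : ι → H₂} (hg : Orthonormal ℝ g) (s : Finset ι) (u : H₁) (v : H₂) :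
    ∑ k ∈ s, |inner ℝ (e k) u| * |inner ℝ (g k) v| ≤ ‖u‖ * ‖v‖ := by
  have h1 : ∑ k ∈ s, |inner ℝ (e k) u| ^ 2 ≤ ‖u‖ ^ 2 := by
    simpa using he.sum_inner_products_le u (s := s)
  have h2 : ∑ k ∈ s, |inner ℝ (g k) v| ^ 2 ≤ ‖v‖ ^ 2 := by
    simpa using hg.sum_inner_products_le v (s := s)
  have h3 := Finset.sum_mul_sq_le_sq_mul_sq s (fun k => |inner ℝ (e k) u|)
    fun k => |inner ℝ (g k) v|
  refine abs_le_of_sq_le_sq' ?_ (by positivity) |>.2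
  rw [mul_pow]
  exact h3.trans (mul_le_mul h1 h2 (by positivity) (by positivity))

/-- Orthogonality to the first `R` right singular vectors kills the terms with `k < R`; all others
have weight at most `σ R`. -/
theorem IsTensorExpansion.abs_inner_le (h : IsTensorExpansion T f σ Φ Ψ) {R : ℕ} (u : H₁) {v : H₂}
    (hv : ∀ k < R, inner ℝ (Ψ k) v = 0) : |inner ℝ f (T u v)| ≤ σ R * (‖u‖ * ‖v‖) := by
  refine le_of_tendsto (h.tendsto_inner u v).abs (Eventually.of_forall fun N => ?_)
  refine (Finset.abs_sum_le_sum_abs _ _).trans ?_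
  calc _ ≤ ∑ k ∈ Finset.range N, σ R * (|inner ℝ (Φ k) u| * |inner ℝ (Ψ k) v|) := by
        refine Finset.sum_le_sum fun k _ => ?_
        rw [abs_mul, abs_mul, abs_of_nonneg (h.nonneg k)]
        by_cases hk : k < R
        · simp [hv k hk]
        · exact mul_le_mul_of_nonneg_right (h.antitone (not_lt.1 hk)) (by positivity)
    _ ≤ _ := by
        rw [← Finset.mul_sum]
        exact mul_le_mul_of_nonneg_left
          (sum_abs_inner_mul_le_of_orthonormal h.left h.right _ u v) (h.nonneg R)

variable {p q : Type*} [Fintype p] [Fintype q]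

/-- The matrix of coefficients of `f` in the orthonormal families `e`, `g`. -/
def tensorMatrix (T : H₁ →ₗ[ℝ] H₂ →ₗ[ℝ] H) (f : H) (e : p → H₁) (g : q → H₂) : Matrix p q ℝ :=
  Matrix.of fun i k => inner ℝ f (T (e i) (g k))

theorem dotProduct_tensorMatrix_mulVec (e : p → H₁) (g : q → H₂) (x : p → ℝ) (y : q → ℝ) :
    x ⬝ᵥ (tensorMatrix T f e g *ᵥ y) = inner ℝ f (T (∑ i, x i • e i) (∑ k, y k • g k)) := by
  simp only [dotProduct, mulVec, tensorMatrix, of_apply, map_sum, LinearMap.sum_apply, map_smul,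
    LinearMap.smul_apply, inner_sum, real_inner_smul_right, Finset.mul_sum]
  rw [Finset.sum_comm]
  refine Finset.sum_congr rfl fun i _ => Finset.sum_congr rfl fun k _ => ?_
  ring

theorem norm_sum_smul_of_orthonormal {e : p → H₁} (he : Orthonormal ℝ e) (x : p → ℝ) :
    ‖∑ i, x i • e i‖ = ‖WithLp.toLp 2 x‖ := by
  have : ‖∑ i, x i • e i‖ ^ 2 = ‖WithLp.toLp 2 x‖ ^ 2 := by
    rw [← real_inner_self_eq_norm_sq, he.inner_sum, EuclideanSpace.real_norm_sq_eq]
    simp [sq]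
  exact (sq_eq_sq₀ (norm_nonneg _) (norm_nonneg _)).1 this

theorem norm_toLp_inner_le_of_orthonormal {e : p → H₁} (he : Orthonormal ℝ e) (u : H₁) :
    ‖WithLp.toLp 2 fun i => inner ℝ (e i) u‖ ≤ ‖u‖ := by
  refine abs_le_of_sq_le_sq' ?_ (norm_nonneg _) |>.2
  rw [EuclideanSpace.real_norm_sq_eq]
  simpa using he.sum_inner_products_le u (s := Finset.univ)

theorem abs_dotProduct_le (x y : p → ℝ) :
    |x ⬝ᵥ y| ≤ ‖WithLp.toLp 2 x‖ * ‖WithLp.toLp 2 y‖ := by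
  have := abs_real_inner_le_norm (WithLp.toLp 2 y : EuclideanSpace ℝ p) (WithLp.toLp 2 x)
  rwa [EuclideanSpace.inner_eq_star_dotProduct, star_trivial, mul_comm] at this

theorem exists_ne_zero_mulVec_eq_zero {R : ℕ} (A : Matrix (Fin R) (Fin (R + 1)) ℝ) :
    ∃ w ≠ 0, A *ᵥ w = 0 := by
  have : LinearMap.ker A.mulVecLin ≠ ⊥ :=
    LinearMap.ker_ne_bot_of_finrank_lt (by simp)
  obtain ⟨w, hw, hw0⟩ := (Submodule.ne_bot_iff _).1 this
  exact ⟨w, hw0, by simpa using hw⟩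

/-- The bilinear bound is tested with the left vector whose coefficients are `z = M y` itself; this
gives `‖z‖² ≤ σ R ‖z‖ ‖y‖`, and a factor `‖z‖` cancels. -/
theorem IsTensorExpansion.norm_tensorMatrix_mulVec_le (h : IsTensorExpansion T f σ Φ Ψ)
    {e : p → H₁} (he : Orthonormal ℝ e) {g : q → H₂} (hg : Orthonormal ℝ g) {R : ℕ} {y : q → ℝ}
    (hy : ∀ k < R, inner ℝ (Ψ k) (∑ l, y l • g l) = 0) :
    ‖WithLp.toLp 2 (tensorMatrix T f e g *ᵥ y)‖ ≤ σ R * ‖WithLp.toLp 2 y‖ := by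
  set z := tensorMatrix T f e g *ᵥ y
  have h1 := (le_abs_self _).trans (h.abs_inner_le (∑ i, z i • e i) hy)
  rw [← dotProduct_tensorMatrix_mulVec, norm_sum_smul_of_orthonormal he,
    norm_sum_smul_of_orthonormal hg] at h1
  have h2 : z ⬝ᵥ z = ‖WithLp.toLp 2 z‖ ^ 2 := by
    rw [EuclideanSpace.real_norm_sq_eq]; simp [dotProduct, sq]
  change z ⬝ᵥ z ≤ _ at h1
  rw [h2] at h1
  rcases (norm_nonneg (WithLp.toLp 2 z)).eq_or_lt with h0 | h0
  · rw [← h0]; exact mul_nonneg (h.nonneg R) (norm_nonneg _)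
  · refine le_of_mul_le_mul_left ?_ h0
    linarith

/-- The singular values of a perturbed compression do not exceed those of the operator by more than
the size of the perturbation. -/
theorem IsTensorExpansion.singularValue_perturbed_le [DecidableEq p] [DecidableEq q]
    (h : IsTensorExpansion T f σ Φ Ψ)
    {e : p → H₁} (he : Orthonormal ℝ e) {g : q → H₂} (hg : Orthonormal ℝ g) {a b : ℕ}
    {M' : Matrix p q ℝ} {U' : Matrix p (Fin a) ℝ} {V' : Matrix q (Fin b) ℝ} {τ : ℕ → ℝ}
    (hU' : U'ᵀ * U' = 1) (hV' : V'ᵀ * V' = 1) (hM' : M' = U' * rectDiag a b τ * V'ᵀ)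
    (hτ : Antitone τ) {R : ℕ} (hRa : R < a) (hRb : R < b) :
    τ R ≤ σ R + ‖M' - tensorMatrix T f e g‖ := by
  set M := tensorMatrix T f e g
  rcases le_or_gt (τ R) 0 with h0 | hpos
  · exact h0.trans (add_nonneg (h.nonneg R) (norm_nonneg _))
  set J := rectDiag b (R + 1) fun _ => 1 with hJ
  have hJJ : Jᵀ * J = 1 := by
    rw [hJ, rectDiag_transpose, rectDiag_mul, ← rectDiag_one]
    exact rectDiag_congr fun k hk _ => by simp [show k < b by omega]
  have hVJ : (V' * J)ᵀ * (V' * J) = 1 := by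
    rw [transpose_mul, Matrix.mul_assoc, ← Matrix.mul_assoc V'ᵀ, hV', Matrix.one_mul, hJJ]
  -- The leading `R + 1` right singular vectors of `M'` span a space in which the `R` conditions of
  -- orthogonality to `Ψ 0, …, Ψ (R - 1)` have a nonzero solution. There `M'` expands by at least `τ
  -- R`, while `M` expands by at most `σ R`.
  obtain ⟨w, hw0, hw⟩ := exists_ne_zero_mulVec_eq_zero
    ((Matrix.of fun (k : Fin R) (l : q) => inner ℝ (Ψ k) (g l)) * (V' * J))
  set y := (V' * J) *ᵥ w with hy
  have hyw : ‖WithLp.toLp 2 y‖ = ‖WithLp.toLp 2 w‖ := norm_toLp_mulVec_of_orthonormal hVJ w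
  have hyΨ : ∀ k < R, inner ℝ (Ψ k) (∑ l, y l • g l) = 0 := by
    intro k hk
    rw [← mulVec_mulVec] at hw
    have := congrFun hw ⟨k, hk⟩
    simp only [mulVec, dotProduct, of_apply, Pi.zero_apply] at this
    rw [inner_sum, ← this]
    refine Finset.sum_congr rfl fun l _ => ?_
    rw [real_inner_smul_right, mul_comm]
    rfl
  have h1 := h.norm_tensorMatrix_mulVec_le he hg hyΨ
  have hw' : 0 < ‖WithLp.toLp 2 w‖ := norm_pos_iff.2 (by simpa using hw0)
  set S := rectDiag a (R + 1) τ with hS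
  have hM'y : M' *ᵥ y = U' *ᵥ (S *ᵥ w) := by
    rw [hy, hM', mulVec_mulVec, mulVec_mulVec]
    congr 1
    rw [Matrix.mul_assoc _ V'ᵀ, ← Matrix.mul_assoc V'ᵀ, hV', Matrix.one_mul, Matrix.mul_assoc,
      hJ, rectDiag_mul]
    congr 1
    exact rectDiag_congr fun k _ hk => by simp [show k < b by omega]
  have h2 : τ R * ‖WithLp.toLp 2 w‖ ≤ ‖WithLp.toLp 2 (M' *ᵥ y)‖ := by
    rw [hM'y, norm_toLp_mulVec_of_orthonormal hU']
    -- A left inverse of `S` of norm at most `(τ R)⁻¹`, so that `S` expands every vector by at least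
    -- `τ R`.
    set Q := rectDiag (R + 1) a fun k => if k < R + 1 then (τ k)⁻¹ else 0 with hQ
    have hle : ∀ k, k < R + 1 → τ R ≤ τ k := fun k hk => hτ (by omega)
    have hQS : Q * S = 1 := by
      rw [hQ, hS, rectDiag_mul, ← rectDiag_one]
      refine rectDiag_congr fun k hk _ => ?_
      have : τ k ≠ 0 := (hpos.trans_le (hle k hk)).ne'
      simp [hk, show k < a by omega, this]
    have hQn : ‖Q‖ ≤ (τ R)⁻¹ := by
      refine norm_rectDiag_le (by positivity) fun k => ?_
      split_ifs with hk
      · rw [abs_of_pos (inv_pos.2 (hpos.trans_le (hle k hk)))]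
        exact inv_anti₀ hpos (hle k hk)
      · simpa using hpos.le
    have h3 : ‖WithLp.toLp 2 w‖ ≤ (τ R)⁻¹ * ‖WithLp.toLp 2 (S *ᵥ w)‖ := by
      have := norm_toLp_mulVec_le Q (S *ᵥ w)
      rw [mulVec_mulVec, hQS, one_mulVec] at this
      exact this.trans (mul_le_mul_of_nonneg_right hQn (norm_nonneg _))
    calc _ ≤ τ R * ((τ R)⁻¹ * ‖WithLp.toLp 2 (S *ᵥ w)‖) := by gcongr
      _ = _ := by field_simp
  have h3 : ‖WithLp.toLp 2 (M' *ᵥ y)‖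
      ≤ ‖WithLp.toLp 2 (M *ᵥ y)‖ + ‖M' - M‖ * ‖WithLp.toLp 2 y‖ := by
    have : M' *ᵥ y = M *ᵥ y + (M' - M) *ᵥ y := by rw [sub_mulVec]; abel
    rw [this, WithLp.toLp_add]
    exact (norm_add_le _ _).trans (add_le_add le_rfl (norm_toLp_mulVec_le _ _))
  refine le_of_mul_le_mul_right ?_ hw'
  rw [hyw] at h1 h3
  linarith

/-- The left test vector is the image of the right one under the operator with kernel `f`, so their
pairing against `f` is the squared norm of that image. -/
theorem IsTensorExpansion.inner_partial (h : IsTensorExpansion T f σ Φ Ψ) (R : ℕ) (w : ℕ → ℝ) :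
    inner ℝ f (T (∑ k ∈ Finset.range R, (σ k * w k) • Φ k) (∑ k ∈ Finset.range R, w k • Ψ k))
      = ∑ k ∈ Finset.range R, (σ k * w k) ^ 2 := by
  refine tendsto_nhds_unique (h.tendsto_inner _ _) ?_
  -- The partial sums are constant as soon as `N ≥ R`, by orthonormality.
  refine tendsto_const_nhds.congr' ?_
  filter_upwards [eventually_ge_atTop R] with N hN
  have hL : ∀ (w : ℕ → ℝ) k, inner ℝ (Φ k) (∑ k ∈ Finset.range R, w k • Φ k)
      = if k < R then w k else 0 := by
    intro w k
    simp [inner_sum, real_inner_smul_right, orthonormal_iff_ite.1 h.left]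
  have hR : ∀ (w : ℕ → ℝ) k, inner ℝ (Ψ k) (∑ k ∈ Finset.range R, w k • Ψ k)
      = if k < R then w k else 0 := by
    intro w k
    simp [inner_sum, real_inner_smul_right, orthonormal_iff_ite.1 h.right]
  symm
  rw [← Finset.sum_subset (Finset.range_mono hN)]
  · refine Finset.sum_congr rfl fun k hk => ?_
    rw [hL, hR, if_pos (Finset.mem_range.1 hk), if_pos (Finset.mem_range.1 hk)]
    ring
  · intro k _ hk
    rw [hL, if_neg (by simpa using hk)]
    simp

/-- The singular values of the operator do not exceed those of a compression by more than the size
of the part that is cut off. -/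
theorem IsTensorExpansion.le_singularValue_add [DecidableEq p] [DecidableEq q]
    (h : IsTensorExpansion T f σ Φ Ψ)
    {e : p → H₁} (he : Orthonormal ℝ e) {g : q → H₂} (hg : Orthonormal ℝ g) {a b : ℕ}
    {U : Matrix p (Fin a) ℝ} {V : Matrix q (Fin b) ℝ} {τ : ℕ → ℝ}
    (hU : Uᵀ * U = 1) (hV : Vᵀ * V = 1) (hM : tensorMatrix T f e g = U * rectDiag a b τ * Vᵀ)
    (hτ : Antitone τ) (hτ0 : ∀ k, 0 ≤ τ k) {ε : ℝ} (hε : 0 ≤ ε)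
    (happrox : ∀ u v, |inner ℝ f (T u v)
      - inner ℝ f (T (∑ i, inner ℝ (e i) u • e i) (∑ l, inner ℝ (g l) v • g l))|
        ≤ ε * (‖u‖ * ‖v‖)) (R : ℕ) :
    σ R ≤ τ R + ε := by
  set M := tensorMatrix T f e g
  -- `R + 1` coefficients and `R` conditions: a nonzero `v` in the span of `Ψ 0, …, Ψ R` is chosen
  -- whose compressed coordinates `c` are orthogonal to the first `R` columns of `V`. The operator
  -- expands `v` by at least `σ R`, and the compressed matrix sends `c` to a vector of norm at most
  -- `τ R ‖v‖`.
  obtain ⟨w₀, hw0, hw⟩ := exists_ne_zero_mulVec_eq_zero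
    (rectDiag R b (fun _ => 1) * Vᵀ * Matrix.of fun (l : q) (k : Fin (R + 1)) =>
      inner ℝ (g l) (Ψ k))
  set w : ℕ → ℝ := fun k => if hk : k < R + 1 then w₀ ⟨k, hk⟩ else 0 with hwdef
  have hww : ∀ k : Fin (R + 1), w k = w₀ k := fun k => dif_pos k.isLt
  set u := ∑ k ∈ Finset.range (R + 1), (σ k * w k) • Φ k with hu
  set v := ∑ k ∈ Finset.range (R + 1), w k • Ψ k with hv
  set c : q → ℝ := fun l => inner ℝ (g l) v with hc
  have hnorm : ‖u‖ ^ 2 = ∑ k ∈ Finset.range (R + 1), (σ k * w k) ^ 2 := by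
    rw [← real_inner_self_eq_norm_sq, hu, h.left.inner_sum]
    simp [sq]
  have hnorm' : ‖v‖ ^ 2 = ∑ k ∈ Finset.range (R + 1), w k ^ 2 := by
    rw [← real_inner_self_eq_norm_sq, hv, h.right.inner_sum]
    simp [sq]
  have hinner : inner ℝ f (T u v) = ‖u‖ ^ 2 := by
    rw [h.inner_partial, ← hnorm]
  have hvpos : 0 < ‖v‖ := by
    obtain ⟨k, hk⟩ := Function.ne_iff.1 hw0
    have : 0 < ‖v‖ ^ 2 := by
      rw [hnorm']
      refine Finset.sum_pos' (fun _ _ => sq_nonneg _) ⟨k, Finset.mem_range.2 k.isLt, ?_⟩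
      rw [hww]
      exact pow_pos (abs_pos.2 hk) 2 |>.trans_eq (sq_abs _)
    exact (norm_nonneg v).lt_of_ne' fun h0 => by simp [h0] at this
  have huv : σ R * ‖v‖ ≤ ‖u‖ := by
    refine abs_le_of_sq_le_sq' ?_ (norm_nonneg _) |>.2
    rw [mul_pow, hnorm', hnorm, Finset.mul_sum]
    refine Finset.sum_le_sum fun k hk => ?_
    rw [mul_pow]
    have : σ R ≤ σ k := h.antitone (by simpa [Nat.lt_succ_iff] using hk)
    gcongr
    exact h.nonneg R
  have hcv : ‖WithLp.toLp 2 c‖ ≤ ‖v‖ := norm_toLp_inner_le_of_orthonormal hg v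
  have hVc : rectDiag R b (fun _ => 1) *ᵥ (Vᵀ *ᵥ c) = 0 := by
    rw [mulVec_mulVec, ← hw]
    conv_rhs => rw [← mulVec_mulVec]
    refine congrArg _ (funext fun l => ?_)
    simp only [hc, hv, mulVec, dotProduct, of_apply, inner_sum, real_inner_smul_right]
    rw [Finset.sum_range]
    refine Finset.sum_congr rfl fun k _ => ?_
    rw [hww, mul_comm]
  have hMc : ‖WithLp.toLp 2 (M *ᵥ c)‖ ≤ τ R * ‖v‖ := by
    have h1 : Vᵀ *ᵥ c = tailProj b R *ᵥ (Vᵀ *ᵥ c) := by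
      have h2 : headProj b R *ᵥ (Vᵀ *ᵥ c) = 0 := by
        have h3 : headProj b R = rectDiag b R (fun _ => 1) * rectDiag R b (fun _ => 1) := by
          rw [rectDiag_mul, headProj]; simp
        rw [h3, ← mulVec_mulVec, hVc, mulVec_zero]
      have h3 : headProj b R + tailProj b R = 1 := by
        rw [headProj, tailProj, ← rectDiag_one]
        ext i k
        simp only [Matrix.add_apply, rectDiag_apply]
        by_cases h1 : i.val = k.val <;> by_cases h2 : k.val < R <;> simp [h1, h2]
      calc Vᵀ *ᵥ c = (headProj b R + tailProj b R) *ᵥ (Vᵀ *ᵥ c) := by rw [h3, one_mulVec]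
        _ = _ := by rw [add_mulVec, h2, zero_add]
    have h2 : M *ᵥ c = U *ᵥ ((rectDiag a b τ * tailProj b R) *ᵥ (Vᵀ *ᵥ c)) := by
      rw [← mulVec_mulVec, ← h1, mulVec_mulVec, mulVec_mulVec, hM]
    rw [h2, norm_toLp_mulVec_of_orthonormal hU]
    refine (norm_toLp_mulVec_le _ _).trans (mul_le_mul ?_ ?_ (norm_nonneg _) (hτ0 R))
    · rw [tailProj, rectDiag_mul]
      refine norm_rectDiag_le (hτ0 R) fun k => ?_
      by_cases hk : k < R
      · simpa [hk] using hτ0 R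
      · by_cases hkb : k < b
        · simpa [hk, hkb, abs_of_nonneg (hτ0 k)] using hτ (not_lt.1 hk)
        · simpa [hkb] using hτ0 R
    · refine (norm_toLp_mulVec_le _ _).trans ?_
      have : ‖Vᵀ‖ ≤ 1 := by rw [norm_transpose]; exact norm_le_one_of_transpose_mul_self hV
      calc _ ≤ 1 * ‖WithLp.toLp 2 c‖ := by gcongr
        _ ≤ ‖v‖ := by rwa [one_mul]
  -- Here `‖u‖² = ⟨f, u ⊗ v⟩`. Passing to the projections of `u` and `v` costs `ε ‖u‖ ‖v‖`, and the
  -- projected pairing is a matrix product bounded by Cauchy–Schwarz and `hMc`.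
  have hfin : ‖u‖ ^ 2 ≤ ‖u‖ * ((τ R + ε) * ‖v‖) := by
    have h1 := (abs_le.1 (happrox u v)).2
    rw [hinner, ← dotProduct_tensorMatrix_mulVec] at h1
    have h2 := (le_abs_self _).trans (abs_dotProduct_le (fun i => inner ℝ (e i) u) (M *ᵥ c))
    have h3 := mul_le_mul (norm_toLp_inner_le_of_orthonormal he u) hMc (norm_nonneg _) (norm_nonneg _)
    change _ - (fun i => inner ℝ (e i) u) ⬝ᵥ (M *ᵥ c) ≤ _ at h1
    nlinarith
  have hfin' : ‖u‖ ≤ (τ R + ε) * ‖v‖ := by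
    rcases (norm_nonneg u).eq_or_lt with h0 | h0
    · rw [← h0]; exact mul_nonneg (add_nonneg (hτ0 R) hε) (norm_nonneg _)
    · refine le_of_mul_le_mul_left ?_ h0
      rw [← sq]; exact hfin
  exact le_of_mul_le_mul_right (huv.trans hfin') hvpos

end Weyl

/-! ### `L₂` inner products and partial pairings -/

section LTwo

variable {𝕜 : Type*} [RCLike 𝕜] {X Y : Type*} [MeasurableSpace X] [MeasurableSpace Y]
  {μ : Measure X} {ν : Measure Y}

theorem inner_toLp {f g : X → 𝕜} (hf : MemLp f 2 μ) (hg : MemLp g 2 μ) :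
    inner 𝕜 (hf.toLp f) (hg.toLp g) = ∫ x, g x * (starRingEnd 𝕜) (f x) ∂μ := by
  rw [L2.inner_def]
  refine integral_congr_ae ?_
  filter_upwards [hf.coeFn_toLp, hg.coeFn_toLp] with x h1 h2
  rw [h1, h2, RCLike.inner_apply]

theorem real_inner_toLp {f g : X → ℝ} (hf : MemLp f 2 μ) (hg : MemLp g 2 μ) :
    inner ℝ (hf.toLp f) (hg.toLp g) = ∫ x, f x * g x ∂μ := by
  rw [inner_toLp]
  exact integral_congr_ae (Eventually.of_forall fun x => by simp [mul_comm])

theorem norm_toLp_sq {f : X → ℝ} (hf : MemLp f 2 μ) : ‖hf.toLp f‖ ^ 2 = ∫ x, f x ^ 2 ∂μ := by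
  rw [← real_inner_self_eq_norm_sq, real_inner_toLp]
  simp only [sq]

theorem integral_sq_eq {f : X → ℝ} (hf : MemLp f 2 μ) :
    ∫ x, f x ^ 2 ∂μ = (eLpNorm f 2 μ).toReal ^ 2 := by
  rw [← norm_toLp_sq hf, Lp.norm_toLp]

theorem orthonormal_toLp {ι : Type*} [DecidableEq ι] {e : ι → X → 𝕜} (he : ∀ i, MemLp (e i) 2 μ)
    (h : ∀ i k, ∫ x, e k x * (starRingEnd 𝕜) (e i x) ∂μ = if i = k then 1 else 0) :
    Orthonormal 𝕜 fun i => (he i).toLp (e i) := by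
  rw [orthonormal_iff_ite]
  intro i k
  rw [inner_toLp, h]

theorem real_orthonormal_toLp {ι : Type*} [DecidableEq ι] {e : ι → X → ℝ}
    (he : ∀ i, MemLp (e i) 2 μ)
    (h : ∀ i k, ∫ x, e i x * e k x ∂μ = if i = k then 1 else 0) :
    Orthonormal ℝ fun i => (he i).toLp (e i) := by
  rw [orthonormal_iff_ite]
  intro i k
  rw [real_inner_toLp, h]

theorem memLp_ofLp_mul {f g : X → 𝕜} (hf : MemLp f 2 μ) (hg : MemLp g 2 μ) :
    Integrable (fun x => f x * g x) μ :=
  hf.integrable_mul hg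

/-- A complete orthonormal family of functions as a Hilbert basis of `L₂`. -/
def hilbertBasisOfComplete {ι : Type*} [DecidableEq ι] (e : ι → X → 𝕜) (he : ∀ i, MemLp (e i) 2 μ)
    (h : ∀ i k, ∫ x, e k x * (starRingEnd 𝕜) (e i x) ∂μ = if i = k then 1 else 0)
    (hc : ∀ g : X → 𝕜, MemLp g 2 μ → (∀ i, ∫ x, g x * (starRingEnd 𝕜) (e i x) ∂μ = 0) →
      g =ᵐ[μ] 0) : HilbertBasis ι 𝕜 (Lp 𝕜 2 μ) :=
  HilbertBasis.mkOfOrthogonalEqBot (orthonormal_toLp he h) <| by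
    rw [Submodule.eq_bot_iff]
    intro g hg
    have h1 : ∀ i, ∫ x, g x * (starRingEnd 𝕜) (e i x) ∂μ = 0 := by
      intro i
      have h2 := (Submodule.mem_orthogonal _ _).1 hg _ (Submodule.subset_span ⟨i, rfl⟩)
      rw [← h2, ← inner_toLp (he i) (Lp.memLp g), Lp.toLp_coeFn]
    exact (Lp.eq_zero_iff_ae_eq_zero).2 (hc g (Lp.memLp g) h1)

theorem hilbertBasisOfComplete_apply {ι : Type*} [DecidableEq ι] (e : ι → X → 𝕜)
    (he : ∀ i, MemLp (e i) 2 μ)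
    (h : ∀ i k, ∫ x, e k x * (starRingEnd 𝕜) (e i x) ∂μ = if i = k then 1 else 0)
    (hc : ∀ g : X → 𝕜, MemLp g 2 μ → (∀ i, ∫ x, g x * (starRingEnd 𝕜) (e i x) ∂μ = 0) →
      g =ᵐ[μ] 0) (i : ι) : hilbertBasisOfComplete e he h hc i = (he i).toLp (e i) := by
  rw [hilbertBasisOfComplete, HilbertBasis.coe_mkOfOrthogonalEqBot]

variable [SFinite μ] [SFinite ν]

theorem memLp_two_prod_right_ae {F : X × Y → 𝕜} (hF : MemLp F 2 (μ.prod ν)) :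
    ∀ᵐ x ∂μ, MemLp (fun y => F (x, y)) 2 ν := by
  have h1 := ((memLp_two_iff_integrable_sq_norm hF.1).1 hF).prod_right_ae
  filter_upwards [h1, hF.1.prodMk_left] with x hx hm
  exact (memLp_two_iff_integrable_sq_norm hm).2 hx

/-- The partial pairing of a function of two variables with a function of the second one. -/
def marginal (ν : Measure Y) (F : X × Y → 𝕜) (v : Y → 𝕜) (x : X) : 𝕜 := ∫ y, F (x, y) * v y ∂ν

omit [SFinite μ] in
theorem aestronglyMeasurable_marginal {F : X × Y → 𝕜} (hF : MemLp F 2 (μ.prod ν)) {v : Y → 𝕜}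
    (hv : MemLp v 2 ν) : AEStronglyMeasurable (marginal ν F v) μ :=
  AEStronglyMeasurable.integral_prod_right' (f := fun p : X × Y => F p * v p.2)
    (hF.1.mul hv.1.comp_snd)

omit [MeasurableSpace X] [SFinite ν] in
theorem norm_marginal_sq_le {F : X × Y → 𝕜} {v : Y → 𝕜} (hv : MemLp v 2 ν) {x : X}
    (hx : MemLp (fun y => F (x, y)) 2 ν) :
    ‖marginal ν F v x‖ ^ 2 ≤ ‖hv.star.toLp (star v)‖ ^ 2 * ∫ y, ‖F (x, y)‖ ^ 2 ∂ν := by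
  have h1 : marginal ν F v x = inner 𝕜 (hv.star.toLp (star v)) (hx.toLp _) := by
    rw [inner_toLp]
    simp [marginal]
  have h2 : ∫ y, ‖F (x, y)‖ ^ 2 ∂ν = ‖hx.toLp _‖ ^ 2 := by
    have := inner_self_eq_norm_sq (𝕜 := 𝕜) (hx.toLp _)
    rw [← this, inner_toLp]
    simp only [RCLike.mul_conj]
    rw [← RCLike.ofReal_re (K := 𝕜) (∫ y, ‖F (x, y)‖ ^ 2 ∂ν), ← integral_ofReal]
    simp
  rw [h1, h2, ← mul_pow]
  exact pow_le_pow_left₀ (norm_nonneg _) (norm_inner_le_norm _ _) 2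

/-- Cauchy–Schwarz in each fibre bounds the square of the pairing by the squared `L₂` norm of the
fibre, which is integrable by Fubini. -/
theorem memLp_marginal {F : X × Y → 𝕜} (hF : MemLp F 2 (μ.prod ν)) {v : Y → 𝕜}
    (hv : MemLp v 2 ν) : MemLp (marginal ν F v) 2 μ := by
  have hm := aestronglyMeasurable_marginal hF hv
  rw [memLp_two_iff_integrable_sq_norm hm]
  have h1 := ((memLp_two_iff_integrable_sq_norm hF.1).1 hF).integral_prod_left
  refine (h1.const_mul (‖hv.star.toLp (star v)‖ ^ 2)).mono' (hm.norm.pow 2) ?_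
  filter_upwards [memLp_two_prod_right_ae hF] with x hx
  rw [Real.norm_eq_abs, abs_of_nonneg (sq_nonneg _)]
  exact norm_marginal_sq_le hv hx

omit [SFinite μ] [SFinite ν] in
theorem memLp_two_mul_prod {u : X → 𝕜} (hu : MemLp u 2 μ) {v : Y → 𝕜} (hv : MemLp v 2 ν) :
    MemLp (fun p : X × Y => u p.1 * v p.2) 2 (μ.prod ν) := by
  have hm : AEStronglyMeasurable (fun p : X × Y => u p.1 * v p.2) (μ.prod ν) :=
    hu.1.comp_fst.mul hv.1.comp_snd
  rw [memLp_two_iff_integrable_sq_norm hm]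
  have := ((memLp_two_iff_integrable_sq_norm hu.1).1 hu).mul_prod
    ((memLp_two_iff_integrable_sq_norm hv.1).1 hv)
  refine this.congr (Eventually.of_forall fun p => ?_)
  simp [mul_pow]

theorem integral_marginal_mul {F : X × Y → 𝕜} (hF : MemLp F 2 (μ.prod ν)) {v : Y → 𝕜}
    (hv : MemLp v 2 ν) {u : X → 𝕜} (hu : MemLp u 2 μ) :
    ∫ x, marginal ν F v x * u x ∂μ = ∫ p, F p * (u p.1 * v p.2) ∂(μ.prod ν) := by
  have huv : MemLp (fun p : X × Y => u p.1 * v p.2) 2 (μ.prod ν) := memLp_two_mul_prod hu hv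
  have hi : Integrable (fun p : X × Y => F p * (u p.1 * v p.2)) (μ.prod ν) := hF.integrable_mul huv
  rw [integral_prod _ hi]
  refine integral_congr_ae (Eventually.of_forall fun x => ?_)
  simp only [marginal]
  rw [← integral_mul_const]
  refine integral_congr_ae (Eventually.of_forall fun y => ?_)
  simp only []
  ring

/-- Bessel's inequality for partial pairings with an orthonormal family. -/
theorem sum_integral_marginal_sq_le {F : X × Y → ℝ} (hF : MemLp F 2 (μ.prod ν)) {ι : Type*}
    [DecidableEq ι] {v : ι → Y → ℝ} (hv : ∀ i, MemLp (v i) 2 ν)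
    (hon : ∀ i k, ∫ y, v i y * v k y ∂ν = if i = k then 1 else 0) (s : Finset ι) :
    ∑ i ∈ s, ∫ x, marginal ν F (v i) x ^ 2 ∂μ ≤ ∫ p, F p ^ 2 ∂(μ.prod ν) := by
  rw [← integral_finsetSum _ fun i _ => (memLp_marginal hF (hv i)).integrable_sq,
    integral_prod _ hF.integrable_sq]
  refine integral_mono_ae (integrable_finsetSum _ fun i _ => (memLp_marginal hF (hv i)).integrable_sq)
    hF.integrable_sq.integral_prod_left ?_
  -- Almost every fibre is square integrable, and Bessel's inequality is applied there before
  -- integrating over `x`.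
  filter_upwards [memLp_two_prod_right_ae hF] with x hx
  have h1 := (real_orthonormal_toLp hv hon).sum_inner_products_le (hx.toLp _) (s := s)
  rw [norm_toLp_sq] at h1
  refine le_trans (le_of_eq ?_) h1
  refine Finset.sum_congr rfl fun i _ => ?_
  rw [real_inner_toLp, Real.norm_eq_abs, sq_abs, marginal]
  congr 1
  exact integral_congr_ae (Eventually.of_forall fun y => mul_comm _ _)

end LTwo

/-! ### Splitting off one coordinate of a finite product -/

section Split

variable {ι : Type*} [Fintype ι] [DecidableEq ι] {Y : ι → Type*} [∀ i, MeasurableSpace (Y i)]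

/-- The measurable equivalence splitting off the coordinate `j`. -/
def splitAt (j : ι) : (∀ i, Y i) ≃ᵐ Y j × (∀ i : {i // i ≠ j}, Y i) where
  toEquiv := Equiv.piSplitAt j Y
  measurable_toFun := by
    refine (measurable_pi_apply j).prodMk (measurable_pi_lambda _ fun i => measurable_pi_apply _)
  measurable_invFun := by
    refine measurable_pi_lambda _ fun i => ?_
    by_cases h : i = j
    · subst h
      simpa [Equiv.piSplitAt] using measurable_fst
    · simp only [Equiv.piSplitAt, h, Equiv.coe_fn_symm_mk, dite_false]
      exact (measurable_pi_apply _).comp measurable_snd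

omit [Fintype ι] in
theorem splitAt_apply (j : ι) (x : ∀ i, Y i) : splitAt j x = (x j, fun i : {i // i ≠ j} => x i.1) := rfl

omit [Fintype ι] in
theorem splitAt_symm_self (j : ι) (p : Y j × (∀ i : {i // i ≠ j}, Y i)) :
    (splitAt j).symm p j = p.1 :=
  congrArg Prod.fst ((splitAt j).apply_symm_apply p)

omit [Fintype ι] in
theorem splitAt_symm_ne (j : ι) (p : Y j × (∀ i : {i // i ≠ j}, Y i)) (i : {i // i ≠ j}) :
    (splitAt j).symm p i.1 = p.2 i :=
  congrFun (congrArg Prod.snd ((splitAt j).apply_symm_apply p)) i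

/-- It suffices to compare the two measures on rectangles, which determine a product measure. -/
theorem measurePreserving_splitAt (μ : ∀ i, Measure (Y i)) [∀ i, SigmaFinite (μ i)] (j : ι) :
    MeasurePreserving (splitAt j) (Measure.pi μ)
      ((μ j).prod (Measure.pi fun i : {i // i ≠ j} => μ i)) := by
  have : MeasurePreserving (splitAt (Y := Y) j).symm
      ((μ j).prod (Measure.pi fun i : {i // i ≠ j} => μ i)) (Measure.pi μ) := by
    refine ⟨(splitAt j).symm.measurable, (Measure.pi_eq fun s hs => ?_).symm⟩
    rw [(splitAt j).symm.map_apply]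
    have : (splitAt j).symm ⁻¹' Set.pi Set.univ s
        = s j ×ˢ Set.pi Set.univ fun i : {i // i ≠ j} => s i := by
      ext p
      simp only [Set.mem_preimage, Set.mem_pi, Set.mem_univ, forall_true_left, Set.mem_prod]
      constructor
      · intro h
        refine ⟨by simpa [splitAt_symm_self] using h j, fun i => ?_⟩
        simpa [splitAt_symm_ne] using h i.1
      · rintro ⟨h1, h2⟩ i
        by_cases h : i = j
        · subst h; rwa [splitAt_symm_self]
        · exact (splitAt_symm_ne j p ⟨i, h⟩).symm ▸ h2 ⟨i, h⟩
    rw [this, Measure.prod_prod, Measure.pi_pi,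
      Fintype.prod_eq_mul_prod_subtype_ne (fun i => μ i (s i)) j]
  exact this.symm

theorem integral_splitAt {E : Type*} [NormedAddCommGroup E] [NormedSpace ℝ E]
    (μ : ∀ i, Measure (Y i)) [∀ i, SigmaFinite (μ i)] (j : ι)
    (F : Y j × (∀ i : {i // i ≠ j}, Y i) → E) :
    ∫ x, F (splitAt j x) ∂(Measure.pi μ)
      = ∫ p, F p ∂((μ j).prod (Measure.pi fun i : {i // i ≠ j} => μ i)) :=
  (measurePreserving_splitAt μ j).integral_comp' F

theorem memLp_comp_splitAt_symm {E : Type*} [NormedAddCommGroup E] {μ : ∀ i, Measure (Y i)}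
    [∀ i, SigmaFinite (μ i)] (j : ι) {f : (∀ i, Y i) → E} (hf : MemLp f 2 (Measure.pi μ)) :
    MemLp (fun p => f ((splitAt j).symm p)) 2
      ((μ j).prod (Measure.pi fun i : {i // i ≠ j} => μ i)) :=
  hf.comp_measurePreserving (measurePreserving_splitAt μ j).symm

end Split

/-! ### Products of complete systems -/

section ProductSystem

variable {𝕜 : Type*} [RCLike 𝕜] {ι : Type*} [Fintype ι] {Y : ι → Type*}
  [∀ i, MeasurableSpace (Y i)] {μ : ∀ i, Measure (Y i)} [∀ i, IsFiniteMeasure (μ i)]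

omit [∀ i, IsFiniteMeasure (μ i)] in
theorem memLp_two_prod_apply [∀ i, SigmaFinite (μ i)] {w : ∀ i, Y i → 𝕜}
    (hw : ∀ i, MemLp (w i) 2 (μ i)) :
    MemLp (fun x : ∀ i, Y i => ∏ i, w i (x i)) 2 (Measure.pi μ) := by
  have hm : AEStronglyMeasurable (fun x : ∀ i, Y i => ∏ i, w i (x i)) (Measure.pi μ) := by
    refine Finset.aestronglyMeasurable_fun_prod _ fun i _ => ?_
    exact (hw i).1.comp_quasiMeasurePreserving (Measure.quasiMeasurePreserving_eval _ i)
  rw [memLp_two_iff_integrable_sq_norm hm]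
  have := Integrable.fintype_prod_dep (μ := μ)
    fun i => (memLp_two_iff_integrable_sq_norm (hw i).1).1 (hw i)
  refine this.congr (Eventually.of_forall fun x => ?_)
  simp [norm_prod, Finset.prod_pow]

/-- Products of complete systems are complete. -/
theorem ae_eq_zero_of_integral_mul_prod_eq_zero [DecidableEq ι] {κ : ι → Type*}
    {ψ : ∀ i, κ i → Y i → 𝕜} (hψ : ∀ i k, MemLp (ψ i k) 2 (μ i))
    (hc : ∀ i (g : Y i → 𝕜), MemLp g 2 (μ i) → (∀ k, ∫ t, g t * ψ i k t ∂(μ i) = 0) →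
      g =ᵐ[μ i] 0)
    {h : (∀ i, Y i) → 𝕜} (hh : MemLp h 2 (Measure.pi μ))
    (h0 : ∀ k : ∀ i, κ i, ∫ x, h x * ∏ i, ψ i (k i) (x i) ∂(Measure.pi μ) = 0) :
    h =ᵐ[Measure.pi μ] 0 := by
  -- Basis functions are exchanged for arbitrary square integrable factors one coordinate at a time;
  -- `S` is the set of coordinates already freed.
  have hprod : ∀ (S : Finset ι) (w : ∀ i, Y i → 𝕜), (∀ i, MemLp (w i) 2 (μ i)) →
      (∀ i ∉ S, ∃ k, w i = ψ i k) → ∫ x, h x * ∏ i, w i (x i) ∂(Measure.pi μ) = 0 := by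
    intro S
    induction S using Finset.induction_on with
    | empty =>
      intro w _ hw
      choose k hk using fun i => hw i (Finset.notMem_empty i)
      simpa only [hk] using h0 k
    | insert j S hj ih =>
      intro w hwm hw
      set G := fun p => h ((splitAt j).symm p)
      have hGm := memLp_comp_splitAt_symm j hh
      set v : (∀ i : {i // i ≠ j}, Y i) → 𝕜 := fun y => ∏ i, w i.1 (y i) with hv
      have hvm : MemLp v 2 (Measure.pi fun i : {i // i ≠ j} => μ i) :=
        memLp_two_prod_apply (w := fun i : {i // i ≠ j} => w i.1) fun i => hwm i.1
      have key : ∀ u : Y j → 𝕜, MemLp u 2 (μ j) →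
          ∫ x, h x * ∏ i, Function.update w j u i (x i) ∂(Measure.pi μ)
            = ∫ t, marginal (Measure.pi fun i : {i // i ≠ j} => μ i) G v t * u t ∂(μ j) := by
        intro u hu
        rw [integral_marginal_mul hGm hvm hu, ← integral_splitAt]
        refine integral_congr_ae (Eventually.of_forall fun x => ?_)
        simp only [MeasurableEquiv.symm_apply_apply]
        rw [Fintype.prod_eq_mul_prod_subtype_ne _ j, splitAt_apply, Function.update_self]
        congr 2
        refine Finset.prod_congr rfl fun i _ => ?_
        rw [Function.update_of_ne i.2]
      -- With the other factors fixed, the partial pairing of `h` is orthogonal to every `ψ j k` by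
      -- induction, so it vanishes by completeness in the coordinate `j`.
      have hg0 : marginal (Measure.pi fun i : {i // i ≠ j} => μ i) G v =ᵐ[μ j] 0 := by
        refine hc j _ (memLp_marginal hGm hvm) fun k => ?_
        rw [← key _ (hψ j k)]
        refine ih _ (fun i => ?_) fun i hi => ?_
        · by_cases hij : i = j
          · subst hij; simpa using hψ i k
          · simpa [hij] using hwm i
        · by_cases hij : i = j
          · subst hij; exact ⟨k, by simp⟩
          · simpa [hij] using hw i (by simp [hij, hi])
      have := key (w j) (hwm j)
      rw [Function.update_eq_self] at this
      rw [this]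
      refine integral_eq_zero_of_ae ?_
      filter_upwards [hg0] with t ht
      simp [ht]
  have hint : Integrable h (Measure.pi μ) := hh.integrable one_le_two
  -- Finiteness of the measures makes indicator functions admissible factors, so `h` integrates to
  -- zero over rectangles, and then over all measurable sets by the π-λ theorem.
  have hrect : ∀ s : ∀ i, Set (Y i), (∀ i, MeasurableSet (s i)) →
      ∫ x in Set.pi Set.univ s, h x ∂(Measure.pi μ) = 0 := by
    intro s hs
    have := hprod Finset.univ (fun i => (s i).indicator fun _ => 1)
      (fun i => memLp_indicator_const 2 (hs i) 1 (Or.inr (measure_ne_top _ _)))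
      (fun i hi => absurd (Finset.mem_univ i) hi)
    rw [← this, ← integral_indicator (MeasurableSet.univ_pi hs)]
    refine integral_congr_ae (Eventually.of_forall fun x => ?_)
    by_cases hx : x ∈ Set.pi Set.univ s
    · have : ∀ i, x i ∈ s i := fun i => hx i trivial
      simp [hx, this]
    · have : ∃ i, x i ∉ s i := by simpa [Set.mem_pi] using hx
      obtain ⟨i, hi⟩ := this
      have h1 : ∏ i, (s i).indicator (fun _ => (1 : 𝕜)) (x i) = 0 :=
        Finset.prod_eq_zero (Finset.mem_univ i) (by simp [hi])
      simp only [Set.indicator_of_notMem hx, h1, mul_zero]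
  have hall : ∀ s : Set (∀ i, Y i), MeasurableSet s → ∫ x in s, h x ∂(Measure.pi μ) = 0 := by
    intro s hs
    refine MeasurableSpace.induction_on_inter
      (C := fun s _ => ∫ x in s, h x ∂(Measure.pi μ) = 0) generateFrom_pi.symm isPiSystem_pi
      (by simp) ?_ (fun t ht h1 => ?_) (fun t hd ht h1 => ?_) s hs
    · rintro _ ⟨s, hs, rfl⟩
      exact hrect s fun i => hs i trivial
    · have h2 := integral_add_compl ht hint
      have h3 := hrect (fun _ => Set.univ) fun _ => MeasurableSet.univ
      rw [Set.pi_univ, setIntegral_univ] at h3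
      rwa [h1, h3, zero_add] at h2
    · have h2 := hasSum_integral_iUnion ht hd hint.integrableOn
      simp only [h1] at h2
      exact h2.unique hasSum_zero
  exact hint.ae_eq_zero_of_forall_setIntegral_eq_zero fun s hs _ => hall s hs

/-- Orthogonality of products. -/
theorem integral_prod_mul_prod [DecidableEq ι] {κ : ι → Type*} [∀ i, DecidableEq (κ i)]
    {ψ χ : ∀ i, κ i → Y i → 𝕜}
    (hon : ∀ i k l, ∫ t, ψ i k t * χ i l t ∂(μ i) = if k = l then 1 else 0) (k l : ∀ i, κ i) :
    ∫ x, (∏ i, ψ i (k i) (x i)) * ∏ i, χ i (l i) (x i) ∂(Measure.pi μ)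
      = if k = l then 1 else 0 := by
  simp_rw [← Finset.prod_mul_distrib]
  rw [integral_fintype_prod_eq_prod (fun i t => ψ i (k i) t * χ i (l i) t)]
  simp_rw [hon]
  by_cases h : k = l
  · simp [h]
  · obtain ⟨i, hi⟩ := Function.ne_iff.1 h
    rw [if_neg h, Finset.prod_eq_zero (Finset.mem_univ i)]
    simp [hi]

end ProductSystem

/-! ### Iterated directional derivatives of test functions -/

section IteratedDerivatives

variable {V : Type*} [NormedAddCommGroup V] [NormedSpace ℝ V]

/-- The iterated derivative along a list of directions. -/
def listDeriv (l : List V) (φ : V → ℝ) : V → ℝ := l.foldr (fun v g => fun x => fderiv ℝ g x v) φ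

theorem listDeriv_cons (v : V) (l : List V) (φ : V → ℝ) :
    listDeriv (v :: l) φ = fun x => fderiv ℝ (listDeriv l φ) x v := rfl

/-- Smooth functions with compact support in `O`. -/
structure IsTestFunction (O : Set V) (φ : V → ℝ) : Prop where
  contDiff : ContDiff ℝ ((⊤ : ℕ∞) : WithTop ℕ∞) φ
  compact : HasCompactSupport φ
  subset : tsupport φ ⊆ O

theorem contDiff_fderiv_apply {φ : V → ℝ} (hφ : ContDiff ℝ ((⊤ : ℕ∞) : WithTop ℕ∞) φ) (v : V) :
    ContDiff ℝ ((⊤ : ℕ∞) : WithTop ℕ∞) fun x => fderiv ℝ φ x v :=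
  (hφ.fderiv_right (m := ((⊤ : ℕ∞) : WithTop ℕ∞)) (by simp)).clm_apply contDiff_const

theorem contDiff_listDeriv (l : List V) {φ : V → ℝ}
    (hφ : ContDiff ℝ ((⊤ : ℕ∞) : WithTop ℕ∞) φ) :
    ContDiff ℝ ((⊤ : ℕ∞) : WithTop ℕ∞) (listDeriv l φ) := by
  induction l with
  | nil => exact hφ
  | cons v l ih => exact contDiff_fderiv_apply ih v

theorem IsTestFunction.fderiv_apply {O : Set V} {φ : V → ℝ} (h : IsTestFunction O φ) (v : V) :
    IsTestFunction O fun x => fderiv ℝ φ x v :=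
  ⟨contDiff_fderiv_apply h.contDiff v, h.compact.fderiv_apply ℝ v,
    (tsupport_fderiv_apply_subset ℝ v).trans h.subset⟩

theorem IsTestFunction.listDeriv {O : Set V} {φ : V → ℝ} (h : IsTestFunction O φ) (l : List V) :
    IsTestFunction O (listDeriv l φ) := by
  induction l with
  | nil => exact h
  | cons v l ih => exact ih.fderiv_apply v

theorem IsTestFunction.mul_left {O : Set V} {φ χ : V → ℝ} (h : IsTestFunction O φ)
    (hχ : ContDiff ℝ ((⊤ : ℕ∞) : WithTop ℕ∞) χ) : IsTestFunction O fun x => φ x * χ x :=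
  ⟨h.contDiff.mul hχ, h.compact.mul_right, (tsupport_mul_subset_left).trans h.subset⟩

theorem fderiv_fderiv_apply_comm {φ : V → ℝ} (hφ : ContDiff ℝ ((⊤ : ℕ∞) : WithTop ℕ∞) φ)
    (v w x : V) : fderiv ℝ (fun y => fderiv ℝ φ y v) x w = fderiv ℝ (fun y => fderiv ℝ φ y w) x v := by
  have hd : DifferentiableAt ℝ (fderiv ℝ φ) x :=
    ((hφ.fderiv_right (m := ((⊤ : ℕ∞) : WithTop ℕ∞)) (by simp)).differentiable (by simp)) x
  have h1 : ∀ v w, fderiv ℝ (fun y => fderiv ℝ φ y v) x w = fderiv ℝ (fderiv ℝ φ) x w v := by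
    intro v w
    rw [fderiv_clm_apply hd (differentiableAt_const v)]
    simp
  rw [h1, h1]
  exact (hφ.contDiffAt.isSymmSndFDerivAt (by
    rw [minSmoothness_of_isRCLikeNormedField]; exact WithTop.coe_le_coe.2 le_top)).eq w v

/-- Mixed derivatives of smooth functions commute. This frees the arguments from the arbitrary order
in which `Finset.toList` enumerates the directions in `multiDeriv`. -/
theorem listDeriv_perm {l l' : List V} (h : l.Perm l') {φ : V → ℝ}
    (hφ : ContDiff ℝ ((⊤ : ℕ∞) : WithTop ℕ∞) φ) : listDeriv l φ = listDeriv l' φ := by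
  induction h with
  | nil => rfl
  | cons v _ ih => rw [listDeriv_cons, listDeriv_cons, ih]
  | swap v w l =>
    ext x
    simp only [listDeriv_cons]
    exact fderiv_fderiv_apply_comm (contDiff_listDeriv l hφ) v w x
  | trans _ _ h1 h2 => exact h1.trans h2

/-- Iterated derivatives of a product of functions of complementary variables. -/
theorem listDeriv_map_mul {V₁ V₂ : Type*} [NormedAddCommGroup V₁] [NormedSpace ℝ V₁]
    [NormedAddCommGroup V₂] [NormedSpace ℝ V₂] {p₁ : V →L[ℝ] V₁} {p₂ : V →L[ℝ] V₂} {e : V₁ → V}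
    (h₁ : ∀ v, p₁ (e v) = v) (h₂ : ∀ v, p₂ (e v) = 0) (l : List V₁) {φ : V₁ → ℝ} {χ : V₂ → ℝ}
    (hφ : ContDiff ℝ ((⊤ : ℕ∞) : WithTop ℕ∞) φ) (hχ : ContDiff ℝ ((⊤ : ℕ∞) : WithTop ℕ∞) χ) :
    listDeriv (l.map e) (fun x => φ (p₁ x) * χ (p₂ x))
      = fun x => listDeriv l φ (p₁ x) * χ (p₂ x) := by
  induction l with
  | nil => rfl
  | cons v l ih =>
    rw [List.map_cons, listDeriv_cons, ih, listDeriv_cons]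
    ext x
    have hl : DifferentiableAt ℝ (listDeriv l φ) (p₁ x) :=
      (contDiff_listDeriv l hφ).differentiable (by simp) _
    have hχ' : DifferentiableAt ℝ χ (p₂ x) := hχ.differentiable (by simp) _
    have h3 := (hl.hasFDerivAt.comp x p₁.hasFDerivAt).mul (hχ'.hasFDerivAt.comp x p₂.hasFDerivAt)
    have h4 : fderiv ℝ (fun x => listDeriv l φ (p₁ x) * χ (p₂ x)) x = _ := h3.fderiv
    rw [h4]
    simp [h₁, h₂, mul_comm]

variable {ι : Type*} [Fintype ι] [DecidableEq ι]

/-- The list of directions of a multi-index. -/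
def dirList (e : ι → V) (β : ι → ℕ) : List V :=
  (Finset.univ : Finset ι).toList.flatMap fun i => List.replicate (β i) (e i)

omit [DecidableEq ι] in
theorem multiDeriv_eq_listDeriv (e : ι → V) (β : ι → ℕ) (φ : V → ℝ) :
    multiDeriv e β φ = listDeriv (dirList e β) φ := rfl

omit [NormedAddCommGroup V] [NormedSpace ℝ V] [DecidableEq ι] in
theorem coe_dirList (e : ι → V) (β : ι → ℕ) :
    (dirList e β : Multiset V) = ∑ i, Multiset.replicate (β i) (e i) := by
  rw [dirList, ← Multiset.coe_bind]
  simp only [Finset.coe_toList, Multiset.coe_replicate]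
  rfl

omit [NormedAddCommGroup V] [NormedSpace ℝ V] in
theorem dirList_single_perm (e : ι → V) (i : ι) (a : ℕ) :
    (dirList e (Pi.single i a)).Perm (List.replicate a (e i)) := by
  rw [← Multiset.coe_eq_coe, coe_dirList, Finset.sum_eq_single i]
  · rw [Pi.single_eq_same, Multiset.coe_replicate]
  · intro k _ hk
    simp [hk]
  · simp

omit [NormedAddCommGroup V] [NormedSpace ℝ V] [DecidableEq ι] in
theorem dirList_zero (e : ι → V) : dirList e 0 = [] := by
  rw [← Multiset.coe_eq_zero, coe_dirList]
  simp

end IteratedDerivatives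

/-! ### Weak derivatives -/

section WeakDerivatives

variable {ι V : Type*} [Fintype ι] [NormedAddCommGroup V] [NormedSpace ℝ V]
  [MeasureSpace V] [BorelSpace V] [IsLocallyFiniteMeasure (volume : Measure V)]

omit [NormedSpace ℝ V] in
theorem memLp_of_continuous_hasCompactSupport {O : Set V} {φ : V → ℝ} (h1 : Continuous φ)
    (h2 : HasCompactSupport φ) : MemLp φ 2 (volume.restrict O) :=
  (h1.memLp_of_hasCompactSupport h2).restrict O

theorem IsTestFunction.memLp {O O' : Set V} {φ : V → ℝ} (h : IsTestFunction O φ) :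
    MemLp φ 2 (volume.restrict O') :=
  memLp_of_continuous_hasCompactSupport h.contDiff.continuous h.compact

omit [MeasureSpace V] [BorelSpace V] [IsLocallyFiniteMeasure (volume : Measure V)] in
theorem IsTestFunction.multiDeriv {O : Set V} {φ : V → ℝ} (h : IsTestFunction O φ) (e : ι → V)
    (β : ι → ℕ) : IsTestFunction O (multiDeriv e β φ) :=
  h.listDeriv _

/-- A square integrable function orthogonal to all test functions vanishes. -/
theorem ae_eq_zero_of_integral_mul_test [FiniteDimensional ℝ V] {O : Set V} (hO : IsOpen O)
    {f : V → ℝ} (hf : MemLp f 2 (volume.restrict O))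
    (h : ∀ φ, IsTestFunction O φ → ∫ x in O, f x * φ x = 0) : f =ᵐ[volume.restrict O] 0 := by
  have hloc : LocallyIntegrableOn f O volume :=
    locallyIntegrableOn_of_locallyIntegrable_restrict (hf.locallyIntegrable one_le_two)
  have h1 := IsOpen.ae_eq_zero_of_integral_contDiff_smul_eq_zero hO hloc fun φ h1 h2 h3 => by
    rw [← h φ ⟨h1, h2, h3⟩, ← setIntegral_eq_integral_of_forall_compl_eq_zero (s := O)]
    · simp only [smul_eq_mul, mul_comm]
    · intro x hx
      rw [image_eq_zero_of_notMem_tsupport fun hx' => hx (h3 hx'), zero_smul]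
  exact (ae_restrict_iff' hO.measurableSet).2 h1

omit [BorelSpace V] [IsLocallyFiniteMeasure (volume : Measure V)] in
theorem isWeakDeriv_iff {e : ι → V} {O : Set V} {β : ι → ℕ} {f g : V → ℝ} :
    IsWeakDeriv e O β f g ↔ ∀ φ, IsTestFunction O φ →
      ∫ x in O, f x * multiDeriv e β φ x = (-1 : ℝ) ^ (∑ i, β i) * ∫ x in O, g x * φ x :=
  ⟨fun h φ hφ => h φ hφ.1 hφ.2 hφ.3, fun h φ h1 h2 h3 => h φ ⟨h1, h2, h3⟩⟩

/-- Both derivatives have the same integral against every test function, so their difference is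
orthogonal to all test functions. -/
theorem IsWeakDeriv.ae_eq [FiniteDimensional ℝ V] {e : ι → V} {O : Set V} (hO : IsOpen O)
    {β : ι → ℕ} {f f' g g' : V → ℝ} (hff : f =ᵐ[volume.restrict O] f')
    (h : IsWeakDeriv e O β f g) (h' : IsWeakDeriv e O β f' g')
    (hg : MemLp g 2 (volume.restrict O)) (hg' : MemLp g' 2 (volume.restrict O)) :
    g =ᵐ[volume.restrict O] g' := by
  have : (fun x => g x - g' x) =ᵐ[volume.restrict O] 0 := by
    refine ae_eq_zero_of_integral_mul_test hO (hg.sub hg') fun φ hφ => ?_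
    have h1 := isWeakDeriv_iff.1 h φ hφ
    have h2 := isWeakDeriv_iff.1 h' φ hφ
    have h3 : ∫ x in O, f x * multiDeriv e β φ x = ∫ x in O, f' x * multiDeriv e β φ x := by
      refine integral_congr_ae ?_
      filter_upwards [hff] with x hx
      rw [hx]
    rw [h3, h2] at h1
    have h4 : ∫ x in O, g' x * φ x = ∫ x in O, g x * φ x :=
      mul_left_cancel₀ (pow_ne_zero _ (by norm_num)) h1
    simp only [sub_mul]
    rw [integral_sub (memLp_ofLp_mul hg hφ.memLp) (memLp_ofLp_mul hg' hφ.memLp), h4, sub_self]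
  filter_upwards [this] with x hx
  exact sub_eq_zero.1 hx

omit [BorelSpace V] [IsLocallyFiniteMeasure (volume : Measure V)] in
theorem isWeakDeriv_zero (e : ι → V) (O : Set V) (f : V → ℝ) : IsWeakDeriv e O 0 f f := by
  intro φ _ _ _
  rw [multiDeriv_eq_listDeriv, dirList_zero]
  simp [listDeriv]

omit [BorelSpace V] [IsLocallyFiniteMeasure (volume : Measure V)] in
theorem IsWeakDeriv.congr_left {e : ι → V} {O : Set V} {β : ι → ℕ} {f f' g : V → ℝ}
    (h : IsWeakDeriv e O β f g) (hff : f =ᵐ[volume.restrict O] f') : IsWeakDeriv e O β f' g := by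
  intro φ h1 h2 h3
  rw [← h φ h1 h2 h3]
  refine integral_congr_ae ?_
  filter_upwards [hff] with x hx
  rw [hx]

variable [DecidableEq ι]

/-- The multi-indices of order at most `α`. -/
def multiIdx (ι : Type*) [Fintype ι] [DecidableEq ι] (α : ℕ) : Finset (ι → ℕ) :=
  (Finset.range (α + 1)).biUnion fun k => Finset.piAntidiag Finset.univ k

theorem mem_multiIdx {α : ℕ} {β : ι → ℕ} : β ∈ multiIdx ι α ↔ ∑ i, β i ≤ α := by
  simp [multiIdx]

theorem sum_multiIdx (α : ℕ) (F : (ι → ℕ) → ℝ) :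
    ∑ β ∈ multiIdx ι α, F β
      = ∑ k ∈ Finset.range (α + 1), ∑ β ∈ Finset.piAntidiag Finset.univ k, F β := by
  refine Finset.sum_biUnion fun k _ l _ hkl => Finset.disjoint_left.2 fun β h1 h2 => hkl ?_
  exact (Finset.mem_piAntidiag.1 h1).1.symm.trans (Finset.mem_piAntidiag.1 h2).1

/-- `g β` is a square integrable weak `β`-derivative of `f` on `O`, for all `|β| ≤ α`. -/
structure IsSobolevFamily (e : ι → V) (α : ℕ) (O : Set V) (f : V → ℝ) (g : (ι → ℕ) → V → ℝ) :
    Prop where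
  memLp : MemLp f 2 (volume.restrict O)
  memLp_deriv : ∀ β ∈ multiIdx ι α, MemLp (g β) 2 (volume.restrict O)
  isWeakDeriv : ∀ β ∈ multiIdx ι α, IsWeakDeriv e O β f (g β)

omit [BorelSpace V] [IsLocallyFiniteMeasure (volume : Measure V)] in
theorem IsSobolevFamily.memSobolev {e : ι → V} {α : ℕ} {O : Set V} {f : V → ℝ}
    {g : (ι → ℕ) → V → ℝ} (h : IsSobolevFamily e α O f g) : MemSobolev e α O f :=
  ⟨h.memLp, fun β hβ => ⟨g β, h.memLp_deriv β (mem_multiIdx.2 hβ),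
    h.isWeakDeriv β (mem_multiIdx.2 hβ)⟩⟩

omit [BorelSpace V] [IsLocallyFiniteMeasure (volume : Measure V)] in
theorem MemSobolev.isSobolevFamily {e : ι → V} {α : ℕ} {O : Set V} {f : V → ℝ}
    (h : MemSobolev e α O f) : IsSobolevFamily e α O f fun β => weakDeriv e O β f := by
  have h1 : ∀ β ∈ multiIdx ι α, MemLp (weakDeriv e O β f) 2 (volume.restrict O) ∧
      IsWeakDeriv e O β f (weakDeriv e O β f) := by
    intro β hβ
    have h2 := h.2 β (mem_multiIdx.1 hβ)
    rw [weakDeriv, dif_pos h2]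
    exact h2.choose_spec
  exact ⟨h.1, fun β hβ => (h1 β hβ).1, fun β hβ => (h1 β hβ).2⟩

/-- The norm is defined through chosen weak derivatives; by uniqueness any family of weak
derivatives computes it. -/
theorem IsSobolevFamily.sobolevNorm_sq [FiniteDimensional ℝ V] {e : ι → V} {α : ℕ} {O : Set V}
    (hO : IsOpen O) {f : V → ℝ} {g : (ι → ℕ) → V → ℝ} (h : IsSobolevFamily e α O f g) :
    sobolevNorm e α O f ^ 2 = ∑ β ∈ multiIdx ι α, ∫ x in O, g β x ^ 2 := by
  rw [sobolevNorm, Real.sq_sqrt (by positivity), ← sum_multiIdx]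
  refine Finset.sum_congr rfl fun β hβ => ?_
  have h' := h.memSobolev.isSobolevFamily
  have := IsWeakDeriv.ae_eq hO (ae_eq_refl f) (h.isWeakDeriv β hβ) (h'.isWeakDeriv β hβ)
    (h.memLp_deriv β hβ) (h'.memLp_deriv β hβ)
  rw [integral_sq_eq (h.memLp_deriv β hβ), eLpNorm_congr_ae this]

end WeakDerivatives

/-! ### Sobolev regularity of partial pairings -/

section Slices

theorem integral_marginal_swap {X Y : Type*} [MeasurableSpace X] [MeasurableSpace Y]
    {μ : Measure X} {ν : Measure Y} [SFinite μ] [SFinite ν] {F : X × Y → ℝ}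
    (hF : MemLp F 2 (μ.prod ν)) {v : Y → ℝ} (hv : MemLp v 2 ν) {u : X → ℝ} (hu : MemLp u 2 μ) :
    ∫ y, marginal μ (fun p => F p.swap) u y * v y ∂ν
      = ∫ p, F p * (u p.1 * v p.2) ∂(μ.prod ν) := by
  have hF' : MemLp (fun p : Y × X => F p.swap) 2 (ν.prod μ) :=
    hF.comp_measurePreserving Measure.measurePreserving_swap
  rw [integral_marginal_mul hF' hu hv, ← integral_prod_swap]
  simp only [Prod.swap_swap, Prod.fst_swap, Prod.snd_swap]
  refine integral_congr_ae (Eventually.of_forall fun p => ?_)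
  simp only []
  ring

theorem restrict_univ_pi {ι : Type*} [Fintype ι] {Y : ι → Type*} [∀ i, MeasureSpace (Y i)]
    [∀ i, SigmaFinite (volume : Measure (Y i))] (O : ∀ i, Set (Y i)) :
    (volume : Measure (∀ i, Y i)).restrict (Set.pi Set.univ O)
      = Measure.pi fun i => (volume : Measure (Y i)).restrict (O i) := by
  rw [volume_pi, Measure.restrict_pi_pi]

variable {s : ℕ} {d : Fin s → ℕ}

/-- The multi-index of block `j` as a multi-index of all variables. -/
def blockIdx (d : Fin s → ℕ) (j : Fin s) (β : Fin (d j) → ℕ) (p : Σ i, Fin (d i)) : ℕ :=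
  if h : p.1 = j then β (h ▸ p.2) else 0

theorem blockIdx_self (j : Fin s) (β : Fin (d j) → ℕ) (k : Fin (d j)) :
    blockIdx d j β ⟨j, k⟩ = β k := by
  simp [blockIdx]

theorem blockIdx_of_ne {i j : Fin s} (h : i ≠ j) (β : Fin (d j) → ℕ) (k : Fin (d i)) :
    blockIdx d j β ⟨i, k⟩ = 0 := by
  simp [blockIdx, h]

theorem blockIdx_injective (j : Fin s) : Function.Injective (blockIdx d j) := by
  intro β γ h
  ext k
  rw [← blockIdx_self j β k, h, blockIdx_self]

theorem sum_blockIdx (j : Fin s) (β : Fin (d j) → ℕ) : ∑ p, blockIdx d j β p = ∑ k, β k := by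
  rw [Fintype.sum_sigma, Finset.sum_eq_single j]
  · simp only [blockIdx_self]
  · intro i _ hi
    simp [blockIdx_of_ne hi]
  · simp

theorem dirList_blockIdx_perm (j : Fin s) (β : Fin (d j) → ℕ) :
    (dirList (prodVec d) (blockIdx d j β)).Perm
      ((dirList (stdVec (d j)) β).map (Pi.single (M := fun i => Fin (d i) → ℝ) j)) := by
  rw [← Multiset.coe_eq_coe, coe_dirList, ← Multiset.map_coe, coe_dirList,
    ← Multiset.coe_mapAddMonoidHom, map_sum, Fintype.sum_sigma, Finset.sum_eq_single j]
  · refine Finset.sum_congr rfl fun k _ => ?_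
    rw [blockIdx_self, Multiset.coe_mapAddMonoidHom, Multiset.map_replicate]
    rfl
  · intro i _ hi
    simp [blockIdx_of_ne hi]
  · simp

/-- The product of a function of block `j` and a function of the other blocks. -/
def blockMul (j : Fin s) (u : (Fin (d j) → ℝ) → ℝ) (v : (∀ i : {i // i ≠ j}, Fin (d i) → ℝ) → ℝ)
    (x : ∀ i, Fin (d i) → ℝ) : ℝ :=
  u (x j) * v fun i : {i // i ≠ j} => x i.1

/-- The continuous linear restriction to the blocks other than `j`. -/
def restrictBlocks (d : Fin s → ℕ) (j : Fin s) :
    (∀ i, Fin (d i) → ℝ) →L[ℝ] (∀ i : {i // i ≠ j}, Fin (d i) → ℝ) :=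
  ContinuousLinearMap.pi fun i : {i // i ≠ j} => ContinuousLinearMap.proj i.1

theorem blockMul_eq (j : Fin s) (u : (Fin (d j) → ℝ) → ℝ)
    (v : (∀ i : {i // i ≠ j}, Fin (d i) → ℝ) → ℝ) :
    blockMul j u v = fun x =>
      u (ContinuousLinearMap.proj (R := ℝ) (φ := fun i => Fin (d i) → ℝ) j x)
        * v (restrictBlocks d j x) := rfl

/-- After reordering, all directions lie in the block `j`, where the second factor is constant. -/
theorem multiDeriv_blockMul (j : Fin s) (β : Fin (d j) → ℕ) {u : (Fin (d j) → ℝ) → ℝ}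
    {v : (∀ i : {i // i ≠ j}, Fin (d i) → ℝ) → ℝ}
    (hu : ContDiff ℝ ((⊤ : ℕ∞) : WithTop ℕ∞) u) (hv : ContDiff ℝ ((⊤ : ℕ∞) : WithTop ℕ∞) v) :
    multiDeriv (prodVec d) (blockIdx d j β) (blockMul j u v)
      = blockMul j (multiDeriv (stdVec (d j)) β u) v := by
  have hs : ContDiff ℝ ((⊤ : ℕ∞) : WithTop ℕ∞) (blockMul j u v) := by
    rw [blockMul_eq]
    exact (hu.comp (ContinuousLinearMap.contDiff _)).mul (hv.comp (ContinuousLinearMap.contDiff _))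
  rw [multiDeriv_eq_listDeriv, listDeriv_perm (dirList_blockIdx_perm j β) hs, blockMul_eq,
    listDeriv_map_mul (fun w => ?_) (fun w => ?_) _ hu hv]
  · rfl
  · simp
  · ext i k
    simp [restrictBlocks, i.2]

theorem IsTestFunction.blockMul {O : ∀ i, Set (Fin (d i) → ℝ)} {j : Fin s}
    {u : (Fin (d j) → ℝ) → ℝ} {v : (∀ i : {i // i ≠ j}, Fin (d i) → ℝ) → ℝ}
    (hu : IsTestFunction (O j) u)
    (hv : IsTestFunction (Set.pi Set.univ fun i : {i // i ≠ j} => O i) v) :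
    IsTestFunction (Set.pi Set.univ O) (blockMul j u v) := by
  set K : Set (∀ i, Fin (d i) → ℝ) :=
    (Homeomorph.piSplitAt j fun i => Fin (d i) → ℝ) ⁻¹' (tsupport u ×ˢ tsupport v) with hK
  have hKc : IsCompact K :=
    (Homeomorph.isCompact_preimage _).2 (hu.compact.isCompact.prod hv.compact.isCompact)
  have hsub : Function.support (PointProcessHOSVD.blockMul j u v) ⊆ K := by
    intro x hx
    have hx' : u (x j) * v (fun i : {i // i ≠ j} => x i.1) ≠ 0 := hx
    exact ⟨subset_tsupport u (left_ne_zero_of_mul hx'),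
      subset_tsupport v (right_ne_zero_of_mul hx')⟩
  refine ⟨?_, HasCompactSupport.of_support_subset_isCompact hKc hsub, ?_⟩
  · rw [blockMul_eq]
    exact (hu.contDiff.comp (ContinuousLinearMap.contDiff _)).mul
      (hv.contDiff.comp (ContinuousLinearMap.contDiff _))
  · refine (closure_minimal hsub hKc.isClosed).trans ?_
    rintro x ⟨h1, h2⟩ i -
    by_cases h : i = j
    · subst h; exact hu.subset h1
    · exact hv.subset h2 ⟨i, h⟩ trivial

/-- The partial pairing of `f` with a function of the blocks other than `j`, over a product set. -/
def blockMarginal (O : ∀ i, Set (Fin (d i) → ℝ)) (j : Fin s) (f : (∀ i, Fin (d i) → ℝ) → ℝ)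
    (v : (∀ i : {i // i ≠ j}, Fin (d i) → ℝ) → ℝ) : (Fin (d j) → ℝ) → ℝ :=
  marginal (volume.restrict (Set.pi Set.univ fun i : {i // i ≠ j} => O i))
    (fun p => f ((splitAt j).symm p)) v

variable {O : ∀ i, Set (Fin (d i) → ℝ)} {j : Fin s} {f : (∀ i, Fin (d i) → ℝ) → ℝ}

theorem memLp_splitAt_restrict (hf : MemLp f 2 (volume.restrict (Set.pi Set.univ O))) :
    MemLp (fun p => f ((splitAt j).symm p)) 2 ((volume.restrict (O j)).prod
      (volume.restrict (Set.pi Set.univ fun i : {i // i ≠ j} => O i))) := by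
  rw [restrict_univ_pi] at hf ⊢
  exact memLp_comp_splitAt_symm j hf

theorem memLp_blockMarginal (hf : MemLp f 2 (volume.restrict (Set.pi Set.univ O)))
    {v : (∀ i : {i // i ≠ j}, Fin (d i) → ℝ) → ℝ}
    (hv : MemLp v 2 (volume.restrict (Set.pi Set.univ fun i : {i // i ≠ j} => O i))) :
    MemLp (blockMarginal O j f v) 2 (volume.restrict (O j)) :=
  memLp_marginal (memLp_splitAt_restrict hf) hv

theorem integral_prod_splitAt (g : (∀ i, Fin (d i) → ℝ) → ℝ) :
    ∫ p, g ((splitAt j).symm p) ∂((volume.restrict (O j)).prod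
      (volume.restrict (Set.pi Set.univ fun i : {i // i ≠ j} => O i)))
      = ∫ x in Set.pi Set.univ O, g x := by
  rw [restrict_univ_pi, restrict_univ_pi,
    ← integral_splitAt (fun i => (volume : Measure (Fin (d i) → ℝ)).restrict (O i)) j
      fun p => g ((splitAt j).symm p)]
  simp only [MeasurableEquiv.symm_apply_apply]

theorem integral_prod_mul_blockMul (u : (Fin (d j) → ℝ) → ℝ)
    (v : (∀ i : {i // i ≠ j}, Fin (d i) → ℝ) → ℝ) :
    ∫ p, f ((splitAt j).symm p) * (u p.1 * v p.2) ∂((volume.restrict (O j)).prod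
      (volume.restrict (Set.pi Set.univ fun i : {i // i ≠ j} => O i)))
      = ∫ x in Set.pi Set.univ O, f x * blockMul j u v x := by
  rw [← integral_prod_splitAt (j := j)]
  refine integral_congr_ae (Eventually.of_forall fun p => ?_)
  simp only [blockMul, splitAt_symm_self, splitAt_symm_ne]

theorem integral_blockMarginal_mul (hf : MemLp f 2 (volume.restrict (Set.pi Set.univ O)))
    {v : (∀ i : {i // i ≠ j}, Fin (d i) → ℝ) → ℝ}
    (hv : MemLp v 2 (volume.restrict (Set.pi Set.univ fun i : {i // i ≠ j} => O i)))
    {u : (Fin (d j) → ℝ) → ℝ} (hu : MemLp u 2 (volume.restrict (O j))) :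
    ∫ t in O j, blockMarginal O j f v t * u t = ∫ x in Set.pi Set.univ O, f x * blockMul j u v x := by
  rw [← integral_prod_mul_blockMul, ← integral_marginal_mul (memLp_splitAt_restrict hf) hv hu]
  rfl

/-- Partial pairings inherit weak derivatives in the remaining variables. -/
theorem isWeakDeriv_blockMarginal (hO : ∀ i, IsOpen (O i)) (β : Fin (d j) → ℕ)
    {F : (∀ i, Fin (d i) → ℝ) → ℝ} (hf : MemLp f 2 (volume.restrict (Set.pi Set.univ O)))
    (hF : MemLp F 2 (volume.restrict (Set.pi Set.univ O)))
    (hw : IsWeakDeriv (prodVec d) (Set.pi Set.univ O) (blockIdx d j β) f F)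
    {v : (∀ i : {i // i ≠ j}, Fin (d i) → ℝ) → ℝ}
    (hv : MemLp v 2 (volume.restrict (Set.pi Set.univ fun i : {i // i ≠ j} => O i))) :
    IsWeakDeriv (stdVec (d j)) (O j) β (blockMarginal O j f v) (blockMarginal O j F v) := by
  rw [isWeakDeriv_iff]
  intro ψ hψ
  set Dψ := multiDeriv (stdVec (d j)) β ψ with hDψ
  have hDψ' : IsTestFunction (O j) Dψ := hψ.multiDeriv _ β
  have hO' : IsOpen (Set.pi Set.univ fun i : {i // i ≠ j} => O i) :=
    isOpen_set_pi Set.finite_univ fun i _ => hO i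
  set ν := volume.restrict (Set.pi Set.univ fun i : {i // i ≠ j} => O i) with hν
  -- The variable `x_j` is integrated out first, against `D^β ψ` for `f` and against `ψ` for `F`.
  -- The remaining functions `a` and `b` of the other blocks can be compared without any smoothness
  -- of `v`.
  set a := marginal (volume.restrict (O j)) (fun p => f ((splitAt j).symm p.swap)) Dψ
  set b := marginal (volume.restrict (O j)) (fun p => F ((splitAt j).symm p.swap)) ψ
  have hfs := memLp_splitAt_restrict (j := j) hf
  have hFs := memLp_splitAt_restrict (j := j) hF
  have ha : MemLp a 2 ν :=
    memLp_marginal (hfs.comp_measurePreserving Measure.measurePreserving_swap) hDψ'.memLp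
  have hb : MemLp b 2 ν :=
    memLp_marginal (hFs.comp_measurePreserving Measure.measurePreserving_swap) hψ.memLp
  have ha' : ∀ w, MemLp w 2 ν →
      ∫ y, a y * w y ∂ν = ∫ x in Set.pi Set.univ O, f x * blockMul j Dψ w x := fun w hw => by
    rw [← integral_prod_mul_blockMul]
    exact integral_marginal_swap hfs hw hDψ'.memLp
  have hb' : ∀ w, MemLp w 2 ν →
      ∫ y, b y * w y ∂ν = ∫ x in Set.pi Set.univ O, F x * blockMul j ψ w x := fun w hw => by
    rw [← integral_prod_mul_blockMul]
    exact integral_marginal_swap hFs hw hψ.memLp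
  -- Testing the weak derivative of `f` on products `ψ ⊗ χ` shows that `a - (-1)^|β| b` is
  -- orthogonal to every test function `χ` of the other blocks.
  have hc : (fun y => a y - (-1 : ℝ) ^ (∑ i, β i) * b y) =ᵐ[ν] 0 := by
    refine ae_eq_zero_of_integral_mul_test hO' (ha.sub (hb.const_mul _)) fun χ hχ => ?_
    have h1 := isWeakDeriv_iff.1 hw _ (hψ.blockMul hχ)
    rw [multiDeriv_blockMul j β hψ.contDiff hχ.contDiff, sum_blockIdx, ← ha' χ hχ.memLp,
      ← hb' χ hχ.memLp] at h1
    simp only [sub_mul, mul_assoc]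
    rw [integral_sub (memLp_ofLp_mul ha hχ.memLp) ((memLp_ofLp_mul hb hχ.memLp).const_mul _),
      integral_const_mul]
    exact sub_eq_zero.2 h1
  rw [integral_blockMarginal_mul hf hv hDψ'.memLp, integral_blockMarginal_mul hF hv hψ.memLp,
    ← ha' v hv, ← hb' v hv, ← integral_const_mul]
  refine integral_congr_ae ?_
  filter_upwards [hc] with y hy
  have : a y = (-1 : ℝ) ^ (∑ i, β i) * b y := sub_eq_zero.1 hy
  rw [this, mul_assoc]

theorem IsSobolevFamily.blockMarginal (hO : ∀ i, IsOpen (O i)) {α : ℕ}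
    {F : ((Σ i, Fin (d i)) → ℕ) → (∀ i, Fin (d i) → ℝ) → ℝ}
    (h : IsSobolevFamily (prodVec d) α (Set.pi Set.univ O) f F)
    {v : (∀ i : {i // i ≠ j}, Fin (d i) → ℝ) → ℝ}
    (hv : MemLp v 2 (volume.restrict (Set.pi Set.univ fun i : {i // i ≠ j} => O i))) :
    IsSobolevFamily (stdVec (d j)) α (O j) (blockMarginal O j f v)
      fun β => blockMarginal O j (F (blockIdx d j β)) v := by
  have hmem : ∀ β ∈ multiIdx (Fin (d j)) α, blockIdx d j β ∈ multiIdx (Σ i, Fin (d i)) α := by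
    intro β hβ
    rw [mem_multiIdx] at hβ ⊢
    rwa [sum_blockIdx]
  exact ⟨memLp_blockMarginal h.memLp hv,
    fun β hβ => memLp_blockMarginal (h.memLp_deriv _ (hmem β hβ)) hv,
    fun β hβ => isWeakDeriv_blockMarginal hO β h.memLp (h.memLp_deriv _ (hmem β hβ))
      (h.isWeakDeriv _ (hmem β hβ)) hv⟩

/-- Bessel's inequality holds for each derivative separately. The derivatives in the block `j` are
distinct members of the family of all derivatives, so their sum is part of the full Sobolev norm. -/
theorem sum_sobolev_blockMarginal_le {α : ℕ}
    {F : ((Σ i, Fin (d i)) → ℕ) → (∀ i, Fin (d i) → ℝ) → ℝ}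
    (h : IsSobolevFamily (prodVec d) α (Set.pi Set.univ O) f F) {κ : Type*} [DecidableEq κ]
    {v : κ → (∀ i : {i // i ≠ j}, Fin (d i) → ℝ) → ℝ}
    (hv : ∀ k, MemLp (v k) 2 (volume.restrict (Set.pi Set.univ fun i : {i // i ≠ j} => O i)))
    (hon : ∀ k l, ∫ y in Set.pi Set.univ fun i : {i // i ≠ j} => O i, v k y * v l y
      = if k = l then 1 else 0) (S : Finset κ) :
    ∑ k ∈ S, ∑ β ∈ multiIdx (Fin (d j)) α,
        ∫ t in O j, PointProcessHOSVD.blockMarginal O j (F (blockIdx d j β)) (v k) t ^ 2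
      ≤ ∑ γ ∈ multiIdx (Σ i, Fin (d i)) α, ∫ x in Set.pi Set.univ O, F γ x ^ 2 := by
  have hmem : ∀ β ∈ multiIdx (Fin (d j)) α, blockIdx d j β ∈ multiIdx (Σ i, Fin (d i)) α := by
    intro β hβ
    rw [mem_multiIdx] at hβ ⊢
    rwa [sum_blockIdx]
  rw [Finset.sum_comm]
  calc _ ≤ ∑ β ∈ multiIdx (Fin (d j)) α, ∫ x in Set.pi Set.univ O, F (blockIdx d j β) x ^ 2 := by
        refine Finset.sum_le_sum fun β hβ => ?_
        rw [← integral_prod_splitAt (j := j) fun x => F (blockIdx d j β) x ^ 2]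
        exact sum_integral_marginal_sq_le
          (memLp_splitAt_restrict (h.memLp_deriv _ (hmem β hβ))) hv hon S
    _ = ∑ γ ∈ (multiIdx (Fin (d j)) α).image (blockIdx d j),
          ∫ x in Set.pi Set.univ O, F γ x ^ 2 :=
        (Finset.sum_image (f := fun γ => ∫ x in Set.pi Set.univ O, F γ x ^ 2)
          (blockIdx_injective j).injOn).symm
    _ ≤ _ := by
        refine Finset.sum_le_sum_of_subset_of_nonneg ?_
          fun γ _ _ => integral_nonneg fun x => sq_nonneg _
        intro γ hγ
        obtain ⟨β, hβ, rfl⟩ := Finset.mem_image.1 hγ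
        exact hmem β hβ

end Slices

/-! ### Sobolev spaces as Hilbert spaces and bounded relations -/

section SobolevSpace

/-- The open mapping theorem for closed relations. -/
theorem exists_bound_of_closed_relation {E F : Type*} [NormedAddCommGroup E] [NormedSpace ℝ E]
    [CompleteSpace E] [NormedAddCommGroup F] [NormedSpace ℝ F] [CompleteSpace F]
    {G : Submodule ℝ (E × F)} (hG : IsClosed (G : Set (E × F))) {S : Submodule ℝ E}
    (hS : IsClosed (S : Set E)) (hGS : ∀ p ∈ G, p.1 ∈ S) (h : ∀ x ∈ S, ∃ y, (x, y) ∈ G) :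
    ∃ C > 0, ∀ x ∈ S, ∃ y, (x, y) ∈ G ∧ ‖y‖ ≤ C * ‖x‖ := by
  have := hG.completeSpace_coe
  have := hS.completeSpace_coe
  -- The first projection is a surjection between Banach spaces, since both submodules are closed.
  -- The open mapping theorem supplies preimages of controlled norm, and their second components are
  -- the required `y`.
  set T : G →L[ℝ] S := ((ContinuousLinearMap.fst ℝ E F).comp G.subtypeL).codRestrict S
    (fun p => hGS p.1 p.2) with hT
  have hsurj : Function.Surjective T := by
    rintro ⟨x, hx⟩
    obtain ⟨y, hy⟩ := h x hx
    exact ⟨⟨(x, y), hy⟩, rfl⟩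
  obtain ⟨C, hC, hpre⟩ := T.exists_preimage_norm_le hsurj
  refine ⟨C, hC, fun x hx => ?_⟩
  obtain ⟨p, hp, hn⟩ := hpre ⟨x, hx⟩
  have hp1 : p.1.1 = x := congrArg Subtype.val hp
  refine ⟨p.1.2, ?_, ?_⟩
  · rw [← hp1]; exact p.2
  · exact (norm_snd_le p.1).trans hn

variable {ι V : Type*} [Fintype ι] [DecidableEq ι] [NormedAddCommGroup V] [NormedSpace ℝ V]
  [MeasureSpace V] [BorelSpace V] [IsLocallyFiniteMeasure (volume : Measure V)]

/-- Families of square integrable functions indexed by the multi-indices of order at most `α`. -/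
abbrev JetSpace (ι : Type*) [Fintype ι] [DecidableEq ι] {V : Type*} [NormedAddCommGroup V]
    [MeasureSpace V] (α : ℕ) (O : Set V) : Type _ :=
  PiLp 2 fun _ : multiIdx ι α => Lp ℝ 2 ((volume : Measure V).restrict O)

/-- The index of the function itself. -/
def zeroMultiIdx (ι : Type*) [Fintype ι] [DecidableEq ι] (α : ℕ) : multiIdx ι α :=
  ⟨0, mem_multiIdx.2 (by simp)⟩

/-- The functional whose vanishing expresses the weak derivative property for one test function. -/
def weakDerivFunctional (e : ι → V) (α : ℕ) (O : Set V) (β : multiIdx ι α)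
    (φ : {φ : V → ℝ // IsTestFunction O φ}) : JetSpace ι (V := V) α O →L[ℝ] ℝ :=
  (innerSL ℝ ((φ.2.multiDeriv e β.1).memLp (O' := O)).toLp).comp
      (PiLp.proj 2 (fun _ : multiIdx ι α => Lp ℝ 2 ((volume : Measure V).restrict O))
        (zeroMultiIdx ι α))
    - (-1 : ℝ) ^ (∑ i, β.1 i) • (innerSL ℝ (φ.2.memLp (O' := O)).toLp).comp
      (PiLp.proj 2 (fun _ : multiIdx ι α => Lp ℝ 2 ((volume : Measure V).restrict O)) β)

/-- The Sobolev space as a subspace of the space of jets. -/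
def sobolevSpace (e : ι → V) (α : ℕ) (O : Set V) : Submodule ℝ (JetSpace ι (V := V) α O) :=
  ⨅ β : multiIdx ι α, ⨅ φ : {φ : V → ℝ // IsTestFunction O φ},
    LinearMap.ker (weakDerivFunctional e α O β φ : JetSpace ι (V := V) α O →ₗ[ℝ] ℝ)

/-- Each test function and each multi-index imposes one continuous linear condition on the jet, so
the space is an intersection of closed kernels. -/
theorem isClosed_sobolevSpace (e : ι → V) (α : ℕ) (O : Set V) :
    IsClosed (sobolevSpace e α O : Set (JetSpace ι (V := V) α O)) := by
  rw [sobolevSpace, Submodule.coe_iInf]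
  refine isClosed_iInter fun β => ?_
  rw [Submodule.coe_iInf]
  exact isClosed_iInter fun φ => ContinuousLinearMap.isClosed_ker (weakDerivFunctional e α O β φ)

theorem real_inner_toLp_left {X : Type*} [MeasurableSpace X] {μ : Measure X} {f : X → ℝ}
    (hf : MemLp f 2 μ) (g : Lp ℝ 2 μ) : inner ℝ (hf.toLp f) g = ∫ x, g x * f x ∂μ := by
  have := real_inner_toLp hf (Lp.memLp g)
  rw [Lp.toLp_coeFn] at this
  rw [this]
  exact integral_congr_ae (Eventually.of_forall fun x => mul_comm _ _)

theorem mem_sobolevSpace {e : ι → V} {α : ℕ} {O : Set V} {h : JetSpace ι (V := V) α O} :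
    h ∈ sobolevSpace e α O ↔
      ∀ β : multiIdx ι α, IsWeakDeriv e O β.1 (h (zeroMultiIdx ι α)) (h β) := by
  simp only [sobolevSpace, Submodule.mem_iInf, LinearMap.mem_ker, isWeakDeriv_iff, Subtype.forall]
  refine forall₂_congr fun β hβ => forall₂_congr fun φ hφ => ?_
  simp only [weakDerivFunctional, ContinuousLinearMap.coe_coe, _root_.sub_apply,
    ContinuousLinearMap.comp_apply, _root_.smul_apply, PiLp.proj_apply,
    innerSL_apply_apply, real_inner_toLp_left, smul_eq_mul, sub_eq_zero]

theorem IsSobolevFamily.of_mem_sobolevSpace {e : ι → V} {α : ℕ} {O : Set V}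
    {h : JetSpace ι (V := V) α O} (hh : h ∈ sobolevSpace e α O) :
    ∃ g, IsSobolevFamily e α O (h (zeroMultiIdx ι α)) g ∧
      ∑ β ∈ multiIdx ι α, ∫ x in O, g β x ^ 2 = ‖h‖ ^ 2 := by
  refine ⟨fun β => if hβ : β ∈ multiIdx ι α then h ⟨β, hβ⟩ else 0, ⟨Lp.memLp _, fun β hβ => ?_,
    fun β hβ => ?_⟩, ?_⟩
  · simp only [hβ, dite_true]; exact Lp.memLp _
  · simp only [hβ, dite_true]; exact mem_sobolevSpace.1 hh ⟨β, hβ⟩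
  · rw [PiLp.norm_sq_eq_of_L2, ← Finset.sum_coe_sort]
    refine Finset.sum_congr rfl fun β _ => ?_
    simp only [β.2, dite_true]
    rw [← norm_toLp_sq (Lp.memLp (h β)), Lp.toLp_coeFn]

theorem IsSobolevFamily.exists_mem_sobolevSpace [FiniteDimensional ℝ V] {e : ι → V} {α : ℕ}
    {O : Set V} (hO : IsOpen O) {f : V → ℝ} {g : (ι → ℕ) → V → ℝ} (h : IsSobolevFamily e α O f g) :
    ∃ u ∈ sobolevSpace e α O, u (zeroMultiIdx ι α) =ᵐ[volume.restrict O] f ∧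
      ‖u‖ ^ 2 = ∑ β ∈ multiIdx ι α, ∫ x in O, g β x ^ 2 := by
  set u : JetSpace ι (V := V) α O := WithLp.toLp 2 fun β => (h.memLp_deriv β.1 β.2).toLp (g β.1)
    with hu
  have hu' : ∀ β, u β =ᵐ[volume.restrict O] g β.1 := fun β => (h.memLp_deriv β.1 β.2).coeFn_toLp
  -- The component of order zero is `g 0` rather than `f`, but `f` is also a weak derivative of
  -- order zero of itself, and uniqueness identifies the two.
  have h0 : u (zeroMultiIdx ι α) =ᵐ[volume.restrict O] f := by
    refine (hu' _).trans ?_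
    exact IsWeakDeriv.ae_eq hO (ae_eq_refl f) (h.isWeakDeriv 0 (zeroMultiIdx ι α).2)
      (isWeakDeriv_zero e O f) (h.memLp_deriv _ (zeroMultiIdx ι α).2) h.memLp
  refine ⟨u, mem_sobolevSpace.2 fun β => ?_, h0, ?_⟩
  · have h1 := (h.isWeakDeriv β.1 β.2).congr_left h0.symm
    intro φ a b c
    rw [h1 φ a b c]
    congr 1
    refine integral_congr_ae ?_
    filter_upwards [hu' β] with x hx
    rw [hx]
  · rw [PiLp.norm_sq_eq_of_L2,
      ← Finset.sum_coe_sort (multiIdx ι α) fun β => ∫ x in O, g β x ^ 2]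
    exact Finset.sum_congr rfl fun (β : multiIdx ι α) _ => norm_toLp_sq (h.memLp_deriv β.1 β.2)

end SobolevSpace

/-! ### Norm equivalence of the reproducing kernel Hilbert space and the Sobolev space -/

section NormEquivalence

theorem memℓp_two_iff {a : ℕ → ℝ} : Memℓp a 2 ↔ Summable fun k => a k ^ 2 := by
  rw [memℓp_gen_iff (by norm_num)]
  simp

theorem hasSum_sq_lp (a : lp (fun _ : ℕ => ℝ) 2) : HasSum (fun k => a k ^ 2) (‖a‖ ^ 2) := by
  have := lp.hasSum_norm (p := 2) (by norm_num) a
  simpa using this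

variable {n α : ℕ} {X : Set (Fin n → ℝ)} {K : (Fin n → ℝ) → (Fin n → ℝ) → ℝ} {eig : ℕ → ℝ}
  {ψ : ℕ → (Fin n → ℝ) → ℝ}

theorem IsSobolevDomain.restrict_interior (hX : IsSobolevDomain α X) :
    (volume : Measure (Fin n → ℝ)).restrict (interior X) = volume.restrict X :=
  Measure.restrict_congr_set (interior_ae_eq_of_null_frontier hX.frontier_null)

theorem IsSobolevFamily.congr_fun {g g' : (Fin n → ℝ) → ℝ} {G : (Fin n → ℕ) → (Fin n → ℝ) → ℝ}
    {O : Set (Fin n → ℝ)} (h : IsSobolevFamily (stdVec n) α O g G)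
    (hg : g =ᵐ[volume.restrict O] g') : IsSobolevFamily (stdVec n) α O g' G :=
  ⟨h.memLp.ae_eq hg, h.memLp_deriv, fun β hβ => (h.isWeakDeriv β hβ).congr_left hg⟩

/-- The Hilbert basis of eigenfunctions. -/
def IsMercerKernel.basis (h : IsMercerKernel X K eig ψ) :
    HilbertBasis ℕ ℝ (Lp ℝ 2 ((volume : Measure (Fin n → ℝ)).restrict X)) :=
  hilbertBasisOfComplete ψ h.memLp
    (fun k l => by simpa [mul_comm] using h.orthonormal k l)
    (fun g hg h0 => h.complete g hg fun k => by simpa using h0 k)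

theorem IsMercerKernel.basis_apply (h : IsMercerKernel X K eig ψ) (k : ℕ) :
    h.basis k = (h.memLp k).toLp (ψ k) :=
  hilbertBasisOfComplete_apply _ _ _ _ k

theorem IsMercerKernel.exists_memLp_of_coeff (h : IsMercerKernel X K eig ψ) {c : ℕ → ℝ}
    (hc : Summable fun k => c k ^ 2) :
    ∃ f, MemLp f 2 (volume.restrict X) ∧ ∀ k, ∫ x in X, f x * ψ k x = c k := by
  set a : lp (fun _ : ℕ => ℝ) 2 := ⟨c, memℓp_two_iff.2 hc⟩
  refine ⟨h.basis.repr.symm a, Lp.memLp _, fun k => ?_⟩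
  have h1 := h.basis.repr_apply_apply (h.basis.repr.symm a) k
  rw [LinearIsometryEquiv.apply_symm_apply, h.basis_apply, real_inner_toLp_left] at h1
  exact h1.symm

/-- The relation between jets in the Sobolev space and coefficient sequences scaled by the square
roots of the eigenvalues. -/
def kernelRelation (n α : ℕ) (O : Set (Fin n → ℝ)) {ψ : ℕ → (Fin n → ℝ) → ℝ} (eig : ℕ → ℝ)
    (hψ : ∀ k, MemLp (ψ k) 2 (volume.restrict O)) :
    Submodule ℝ (JetSpace (Fin n) α O × lp (fun _ : ℕ => ℝ) 2) :=
  (sobolevSpace (stdVec n) α O).comap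
      (ContinuousLinearMap.fst ℝ (JetSpace (Fin n) α O) (lp (fun _ : ℕ => ℝ) 2)).toLinearMap ⊓
    ⨅ k, LinearMap.ker
      (((innerSL ℝ (hψ k).toLp).comp
          ((PiLp.proj 2 (fun _ : multiIdx (Fin n) α => Lp ℝ 2 (volume.restrict O))
            (zeroMultiIdx (Fin n) α)).comp
            (ContinuousLinearMap.fst ℝ (JetSpace (Fin n) α O) (lp (fun _ : ℕ => ℝ) 2)))
        - √(eig k) • (innerSL ℝ (lp.single (E := fun _ : ℕ => ℝ) 2 k (1 : ℝ))).comp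
            (ContinuousLinearMap.snd ℝ (JetSpace (Fin n) α O) (lp (fun _ : ℕ => ℝ) 2)) :
        JetSpace (Fin n) α O × lp (fun _ : ℕ => ℝ) 2 →L[ℝ] ℝ).toLinearMap)

theorem mem_kernelRelation {O : Set (Fin n → ℝ)} (hψ : ∀ k, MemLp (ψ k) 2 (volume.restrict O))
    {p : JetSpace (Fin n) α O × lp (fun _ : ℕ => ℝ) 2} :
    p ∈ kernelRelation n α O eig hψ ↔ p.1 ∈ sobolevSpace (stdVec n) α O ∧
      ∀ k, ∫ x in O, p.1 (zeroMultiIdx (Fin n) α) x * ψ k x = √(eig k) * p.2 k := by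
  have h1 : ∀ (k : ℕ) (a : lp (fun _ : ℕ => ℝ) 2),
      inner ℝ (lp.single (E := fun _ : ℕ => ℝ) 2 k (1 : ℝ)) a = a k := by
    intro k a
    rw [lp.inner_single_left]
    simp
  simp only [kernelRelation, Submodule.mem_inf, Submodule.mem_comap, Submodule.mem_iInf,
    LinearMap.mem_ker, ContinuousLinearMap.coe_coe, _root_.sub_apply,
    ContinuousLinearMap.comp_apply, _root_.smul_apply, PiLp.proj_apply, innerSL_apply_apply,
    real_inner_toLp_left, h1, smul_eq_mul, sub_eq_zero, ContinuousLinearMap.coe_fst',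
    ContinuousLinearMap.coe_snd']

theorem isClosed_kernelRelation {O : Set (Fin n → ℝ)}
    (hψ : ∀ k, MemLp (ψ k) 2 (volume.restrict O)) :
    IsClosed (kernelRelation n α O eig hψ :
      Set (JetSpace (Fin n) α O × lp (fun _ : ℕ => ℝ) 2)) := by
  rw [kernelRelation, Submodule.coe_inf, Submodule.coe_iInf]
  refine IsClosed.inter ?_ (isClosed_iInter fun k => ContinuousLinearMap.isClosed_ker _)
  exact (isClosed_sobolevSpace (stdVec n) α O).preimage continuous_fst

variable (hX : IsSobolevDomain α X) (hK : GeneratesSobolev α X K eig ψ)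
include hX hK

/-- Membership in the RKHS says exactly that the coefficients divided by `√(eig k)` are square
summable. Where `eig k = 0` the coefficient vanishes, in agreement with the convention `0⁻¹ = 0`. -/
theorem exists_coeff_of_mem_sobolevSpace
    (hψ : ∀ k, MemLp (ψ k) 2 (volume.restrict (interior X))) {h : JetSpace (Fin n) α (interior X)}
    (hh : h ∈ sobolevSpace (stdVec n) α (interior X)) :
    ∃ a, (h, a) ∈ kernelRelation n α (interior X) eig hψ := by
  obtain ⟨g, hg, -⟩ := IsSobolevFamily.of_mem_sobolevSpace hh
  have hm : MemLp (h (zeroMultiIdx (Fin n) α)) 2 (volume.restrict X) := by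
    rw [← hX.restrict_interior]; exact hg.memLp
  obtain ⟨-, h0, hs⟩ := (hK.memRKHS_iff _ hm).2 hg.memSobolev
  have hnn := hK.isMercerKernel.eig_nonneg
  refine ⟨⟨fun k => (√(eig k))⁻¹ * ∫ x in X, h (zeroMultiIdx (Fin n) α) x * ψ k x,
    memℓp_two_iff.2 ?_⟩, (mem_kernelRelation hψ).2 ⟨hh, fun k => ?_⟩⟩
  · refine hs.congr fun k => ?_
    rw [mul_pow, inv_pow, Real.sq_sqrt (hnn k)]
  · have hF : ∀ F : (Fin n → ℝ) → ℝ, ∫ x in interior X, F x = ∫ x in X, F x := fun F => by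
      rw [hX.restrict_interior]
    refine (hF _).trans ?_
    change _ = √(eig k) * ((√(eig k))⁻¹ * _)
    rcases (hnn k).eq_or_lt with hk | hk
    · rw [h0 k hk.symm, mul_zero, mul_zero]
    · rw [← mul_assoc, mul_inv_cancel₀ (Real.sqrt_pos.2 hk).ne', one_mul]

/-- The eigenvalues are bounded by `eig 0`, so the sequence `√(eig k) * a k` is square summable and
is the coefficient sequence of some `f`. This `f` lies in the RKHS, hence in the Sobolev space. -/
theorem exists_mem_sobolevSpace_of_coeff
    (hψ : ∀ k, MemLp (ψ k) 2 (volume.restrict (interior X))) (a : lp (fun _ : ℕ => ℝ) 2) :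
    ∃ h, (h, a) ∈ kernelRelation n α (interior X) eig hψ := by
  have hnn := hK.isMercerKernel.eig_nonneg
  have ha : Summable fun k => a k ^ 2 := (hasSum_sq_lp a).summable
  have hc : Summable fun k => (√(eig k) * a k) ^ 2 := by
    refine (ha.mul_left (eig 0)).of_nonneg_of_le (fun k => sq_nonneg _) fun k => ?_
    rw [mul_pow, Real.sq_sqrt (hnn k)]
    exact mul_le_mul_of_nonneg_right (hK.isMercerKernel.eig_antitone (Nat.zero_le k)) (sq_nonneg _)
  obtain ⟨f, hf, hfc⟩ := hK.isMercerKernel.exists_memLp_of_coeff hc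
  have hR : MemRKHS X eig ψ f := by
    refine ⟨hf, fun k hk => by rw [hfc, hk]; simp, ?_⟩
    refine ha.of_nonneg_of_le (fun k => mul_nonneg (inv_nonneg.2 (hnn k)) (sq_nonneg _))
      fun k => ?_
    rw [hfc, mul_pow, Real.sq_sqrt (hnn k), ← mul_assoc]
    rcases (hnn k).eq_or_lt with hk | hk
    · rw [← hk]; simpa using sq_nonneg (a k)
    · rw [inv_mul_cancel₀ hk.ne', one_mul]
  have hS := ((hK.memRKHS_iff f hf).1 hR).isSobolevFamily
  obtain ⟨u, hu, hu0, -⟩ := hS.exists_mem_sobolevSpace isOpen_interior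
  refine ⟨u, (mem_kernelRelation hψ).2 ⟨hu, fun k => ?_⟩⟩
  rw [← hfc k, ← hX.restrict_interior]
  refine integral_congr_ae ?_
  filter_upwards [hu0] with x hx
  rw [hx]

/-- The coefficients of a Sobolev function decay like the square roots of the eigenvalues. -/
theorem exists_sum_coeff_sq_le : ∃ C > 0, ∀ (g : (Fin n → ℝ) → ℝ)
    (G : (Fin n → ℕ) → (Fin n → ℝ) → ℝ), IsSobolevFamily (stdVec n) α (interior X) g G →
    ∀ (M : ℕ) (s : Finset ℕ), (∀ k ∈ s, M ≤ k) →
      ∑ k ∈ s, (∫ x in interior X, g x * ψ k x) ^ 2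
        ≤ C * eig M * ∑ β ∈ multiIdx (Fin n) α, ∫ x in interior X, G β x ^ 2 := by
  have hψ : ∀ k, MemLp (ψ k) 2 (volume.restrict (interior X)) := fun k => by
    rw [hX.restrict_interior]; exact hK.isMercerKernel.memLp k
  have hnn := hK.isMercerKernel.eig_nonneg
  -- The scaled coefficient sequence can thus be chosen with norm at most a constant times the
  -- Sobolev norm; no explicit comparison of the two norms is needed.
  obtain ⟨C, hC, hb⟩ := exists_bound_of_closed_relation
    (isClosed_kernelRelation (α := α) (eig := eig) hψ)
    (isClosed_sobolevSpace (stdVec n) α (interior X))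
    (fun p hp => ((mem_kernelRelation hψ).1 hp).1)
    (fun x hx => exists_coeff_of_mem_sobolevSpace hX hK hψ hx)
  refine ⟨C ^ 2, by positivity, fun g G hg M s hs => ?_⟩
  obtain ⟨u, hu, hu0, hun⟩ := hg.exists_mem_sobolevSpace isOpen_interior
  obtain ⟨a, ha, han⟩ := hb u hu
  have hga : ∀ k, ∫ x in interior X, g x * ψ k x = √(eig k) * a k := by
    intro k
    rw [← ((mem_kernelRelation hψ).1 ha).2 k]
    refine integral_congr_ae ?_
    filter_upwards [hu0] with x hx
    rw [hx]
  calc _ = ∑ k ∈ s, eig k * a k ^ 2 := by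
        refine Finset.sum_congr rfl fun k _ => ?_
        rw [hga, mul_pow, Real.sq_sqrt (hnn k)]
    _ ≤ ∑ k ∈ s, eig M * a k ^ 2 := by
        refine Finset.sum_le_sum fun k hk => ?_
        exact mul_le_mul_of_nonneg_right (hK.isMercerKernel.eig_antitone (hs k hk)) (sq_nonneg _)
    _ = eig M * ∑ k ∈ s, a k ^ 2 := by rw [Finset.mul_sum]
    _ ≤ eig M * ‖a‖ ^ 2 :=
        mul_le_mul_of_nonneg_left (sum_le_hasSum s (fun k _ => sq_nonneg _) (hasSum_sq_lp a))
          (hnn M)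
    _ ≤ eig M * (C * ‖u‖) ^ 2 := by
        refine mul_le_mul_of_nonneg_left ?_ (hnn M)
        exact pow_le_pow_left₀ (norm_nonneg _) han 2
    _ = _ := by rw [mul_pow, hun]; ring

/-- An inverse inequality: the Sobolev norm on the span of the leading eigenfunctions. -/
theorem exists_sobolev_le_of_span : ∃ C > 0, ∀ (M : ℕ), 0 < eig M → ∀ c : ℕ → ℝ,
    ∃ G : (Fin n → ℕ) → (Fin n → ℝ) → ℝ,
      IsSobolevFamily (stdVec n) α (interior X)
        (fun x => ∑ k ∈ Finset.range (M + 1), c k * ψ k x) G ∧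
      ∑ β ∈ multiIdx (Fin n) α, ∫ x in interior X, G β x ^ 2
        ≤ C * (eig M)⁻¹ * ∑ k ∈ Finset.range (M + 1), c k ^ 2 := by
  have hψ : ∀ k, MemLp (ψ k) 2 (volume.restrict (interior X)) := fun k => by
    rw [hX.restrict_interior]; exact hK.isMercerKernel.memLp k
  set e := ContinuousLinearEquiv.prodComm ℝ (lp (fun _ : ℕ => ℝ) 2)
    (JetSpace (Fin n) α (interior X)) with he
  -- The same relation with its factors exchanged: now every sequence has a jet of controlled norm.
  set G' := (kernelRelation n α (interior X) eig hψ).comap e.toLinearEquiv.toLinearMap with hG'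
  have hcl : IsClosed (G' : Set (lp (fun _ : ℕ => ℝ) 2 × JetSpace (Fin n) α (interior X))) :=
    (isClosed_kernelRelation (α := α) (eig := eig) hψ).preimage e.continuous
  obtain ⟨C, hC, hb⟩ := exists_bound_of_closed_relation (S := ⊤) hcl isClosed_univ
    (fun _ _ => trivial) (fun a _ => exists_mem_sobolevSpace_of_coeff hX hK hψ a)
  refine ⟨C ^ 2, by positivity, fun M hM c => ?_⟩
  have hpos : ∀ k, k < M + 1 → 0 < eig k := fun k hk =>
    hM.trans_le (hK.isMercerKernel.eig_antitone (Nat.lt_succ_iff.1 hk))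
  -- Scaled so that `√(eig k) * a k` is `c k` for `k ≤ M`. The squared norm of `a` is then at most
  -- `(eig M)⁻¹ ∑ c k ^ 2`, because `eig M` is the smallest eigenvalue involved.
  set a : lp (fun _ : ℕ => ℝ) 2 := ⟨fun k => if k < M + 1 then (√(eig k))⁻¹ * c k else 0,
    memℓp_two_iff.2 (summable_of_ne_finset_zero (s := Finset.range (M + 1)) fun k hk => by
      rw [if_neg (by simpa using hk)]; simp)⟩ with ha
  obtain ⟨h, hh, hn⟩ := hb a trivial
  have hh' : (h, a) ∈ kernelRelation n α (interior X) eig hψ := hh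
  obtain ⟨hS, hco⟩ := (mem_kernelRelation hψ).1 hh'
  obtain ⟨G, hG, hGn⟩ := IsSobolevFamily.of_mem_sobolevSpace hS
  have hco' : ∀ k, ∫ x in interior X, h (zeroMultiIdx (Fin n) α) x * ψ k x
      = if k < M + 1 then c k else 0 := by
    intro k
    rw [hco k]
    change √(eig k) * (if k < M + 1 then (√(eig k))⁻¹ * c k else 0) = _
    split_ifs with hk
    · rw [← mul_assoc, mul_inv_cancel₀ (Real.sqrt_pos.2 (hpos k hk)).ne', one_mul]
    · rw [mul_zero]
  have hsum : MemLp (fun x => ∑ k ∈ Finset.range (M + 1), c k * ψ k x) 2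
      (volume.restrict (interior X)) := memLp_finsetSum _ fun k _ => (hψ k).const_mul _
  -- The jet provides some Sobolev function with the right coefficients; completeness shows that it
  -- is the given combination of eigenfunctions.
  have hae : h (zeroMultiIdx (Fin n) α) =ᵐ[volume.restrict (interior X)]
      fun x => ∑ k ∈ Finset.range (M + 1), c k * ψ k x := by
    have h1 := hK.isMercerKernel.complete
      (fun x => h (zeroMultiIdx (Fin n) α) x - ∑ k ∈ Finset.range (M + 1), c k * ψ k x) (by
        rw [← hX.restrict_interior]
        exact hG.memLp.sub hsum) fun k => by
      rw [← hX.restrict_interior]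
      simp only [sub_mul]
      rw [integral_sub (memLp_ofLp_mul hG.memLp (hψ k)) (memLp_ofLp_mul hsum (hψ k)), hco' k]
      simp only [Finset.sum_mul, mul_assoc]
      rw [integral_finsetSum _ fun l _ => (memLp_ofLp_mul (hψ l) (hψ k)).const_mul _]
      simp only [integral_const_mul]
      rw [hX.restrict_interior]
      simp [hK.isMercerKernel.orthonormal]
    rw [← hX.restrict_interior] at h1
    filter_upwards [h1] with x hx
    exact sub_eq_zero.1 hx
  refine ⟨G, hG.congr_fun hae, ?_⟩
  have han : ‖a‖ ^ 2 ≤ (eig M)⁻¹ * ∑ k ∈ Finset.range (M + 1), c k ^ 2 := by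
    have h1 : HasSum (fun k => a k ^ 2) (∑ k ∈ Finset.range (M + 1), a k ^ 2) :=
      hasSum_sum_of_ne_finset_zero fun k hk => by
        change (if k < M + 1 then (√(eig k))⁻¹ * c k else 0) ^ 2 = 0
        rw [if_neg (by simpa using hk)]; simp
    rw [(hasSum_sq_lp a).unique h1, Finset.mul_sum]
    refine Finset.sum_le_sum fun k hk => ?_
    have hk' := Finset.mem_range.1 hk
    change (if k < M + 1 then (√(eig k))⁻¹ * c k else 0) ^ 2 ≤ _
    rw [if_pos hk', mul_pow, inv_pow, Real.sq_sqrt (hpos k hk').le]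
    refine mul_le_mul_of_nonneg_right ?_ (sq_nonneg _)
    exact inv_anti₀ hM (hK.isMercerKernel.eig_antitone (Nat.lt_succ_iff.1 hk'))
  rw [hGn]
  calc ‖h‖ ^ 2 ≤ (C * ‖a‖) ^ 2 := pow_le_pow_left₀ (norm_nonneg _) hn 2
    _ = C ^ 2 * ‖a‖ ^ 2 := mul_pow _ _ _
    _ ≤ C ^ 2 * ((eig M)⁻¹ * ∑ k ∈ Finset.range (M + 1), c k ^ 2) :=
        mul_le_mul_of_nonneg_left han (sq_nonneg _)
    _ = _ := by ring

end NormEquivalence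

/-! ### Multiplication by a cutoff and iterated integration by parts -/

section Leibniz

variable {V : Type*} [NormedAddCommGroup V] [NormedSpace ℝ V]
  [MeasureSpace V] [BorelSpace V] [IsLocallyFiniteMeasure (volume : Measure V)]

theorem IsTestFunction.memLp_volume {O : Set V} {φ : V → ℝ} (h : IsTestFunction O φ) :
    MemLp φ 2 volume :=
  h.contDiff.continuous.memLp_of_hasCompactSupport h.compact

omit [NormedAddCommGroup V] [NormedSpace ℝ V] [BorelSpace V]
  [IsLocallyFiniteMeasure (volume : Measure V)] in
theorem integral_add_sq_le {f g : V → ℝ} (hf : MemLp f 2 volume) (hg : MemLp g 2 volume) :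
    ∫ x, (f x + g x) ^ 2 ≤ 2 * (∫ x, f x ^ 2) + 2 * ∫ x, g x ^ 2 := by
  rw [← integral_const_mul, ← integral_const_mul,
    ← integral_add (hf.integrable_sq.const_mul 2) (hg.integrable_sq.const_mul 2)]
  refine integral_mono (hf.add hg).integrable_sq
    ((hf.integrable_sq.const_mul 2).add (hg.integrable_sq.const_mul 2)) fun x => ?_
  simp only []
  nlinarith [sq_nonneg (f x - g x)]

/-- A cutoff times a function with weak directional derivatives, tested against a pure derivative,
can be written as a square integrable function supported in the cutoff region. -/
theorem exists_cutoff_integration_by_parts (v : V) (a : ℕ) :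
    ∀ χ : V → ℝ, IsTestFunction Set.univ χ → ∃ C : ℝ, 0 ≤ C ∧ ∀ F : ℕ → V → ℝ,
      (∀ l ≤ a, MemLp (F l) 2 volume) →
      (∀ l ≤ a, ∀ φ, IsTestFunction Set.univ φ →
        ∫ x, F 0 x * listDeriv (List.replicate l v) φ x = (-1 : ℝ) ^ l * ∫ x, F l x * φ x) →
      ∃ G : V → ℝ, MemLp G 2 volume ∧ (∀ x ∉ tsupport χ, G x = 0) ∧
        ∫ x, G x ^ 2 ≤ C * ∑ l ∈ Finset.range (a + 1), ∫ x, F l x ^ 2 ∧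
        ∀ e, ContDiff ℝ ((⊤ : ℕ∞) : WithTop ℕ∞) e → Integrable (fun x => G x * e x) volume ∧
          ∫ x, F 0 x * (χ x * listDeriv (List.replicate a v) e x) = ∫ x, G x * e x := by
  induction a with
  | zero =>
    intro χ hχ
    obtain ⟨B, hB⟩ := hχ.compact.exists_bound_of_continuous hχ.contDiff.continuous
    refine ⟨B ^ 2, sq_nonneg _, fun F hF _ => ⟨fun x => F 0 x * χ x, ?_, ?_, ?_, ?_⟩⟩
    · have := (hF 0 le_rfl).mul (p := ∞) (q := 2) (r := 2)
        (memLp_top_of_bound hχ.contDiff.continuous.aestronglyMeasurable B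
          (Eventually.of_forall hB))
      exact this.congr_norm ((hF 0 le_rfl).1.mul hχ.contDiff.continuous.aestronglyMeasurable)
        (Eventually.of_forall fun x => by simp [mul_comm])
    · intro x hx
      change F 0 x * χ x = 0
      rw [image_eq_zero_of_notMem_tsupport hx, mul_zero]
    · rw [Finset.sum_range_one, ← integral_const_mul]
      refine integral_mono_of_nonneg (Eventually.of_forall fun x => sq_nonneg _)
        ((hF 0 le_rfl).integrable_sq.const_mul _) (Eventually.of_forall fun x => ?_)
      simp only []
      rw [mul_pow, mul_comm]
      refine mul_le_mul_of_nonneg_right ?_ (sq_nonneg _)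
      rw [← sq_abs]
      exact pow_le_pow_left₀ (abs_nonneg _) (hB x) 2
    · intro e he
      have : (fun x => F 0 x * χ x * e x) = fun x => F 0 x * (χ x * e x) := by
        ext x; ring
      simp only [this, List.replicate_zero]
      exact ⟨memLp_ofLp_mul (hF 0 le_rfl) (hχ.mul_left he).memLp_volume, rfl⟩
  | succ a ih =>
    intro χ hχ
    have hχ' := hχ.fderiv_apply v
    -- With `h` the derivative of order `a` of the smooth function, `χ ∂h = ∂(χ h) - (∂χ) h`. The
    -- first term moves one derivative onto `F 0` and uses the induction hypothesis for the shifted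
    -- family `F (l + 1)`; the second uses it for the cutoff `∂χ`.
    obtain ⟨C₁, hC₁, h₁⟩ := ih χ hχ
    obtain ⟨C₂, hC₂, h₂⟩ := ih _ hχ'
    refine ⟨2 * C₁ + 2 * C₂, by positivity, fun F hF hw => ?_⟩
    have hw1 : ∀ φ, IsTestFunction Set.univ φ →
        ∫ x, F 0 x * fderiv ℝ φ x v = -∫ x, F 1 x * φ x := by
      intro φ hφ
      have := hw 1 (by omega) φ hφ
      rw [pow_one, neg_one_mul] at this
      exact this
    obtain ⟨G₁, hG₁, hs₁, hn₁, hi₁⟩ := h₁ (fun l => F (l + 1)) (fun l hl => hF _ (by omega))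
      (fun l hl φ hφ => by
        have e1 := hw (l + 1) (by omega) φ hφ
        rw [List.replicate_succ, listDeriv_cons, hw1 _ (hφ.listDeriv _)] at e1
        rw [zero_add, ← neg_eq_iff_eq_neg.2 e1.symm, pow_succ]
        ring)
    obtain ⟨G₂, hG₂, hs₂, hn₂, hi₂⟩ := h₂ F (fun l hl => hF l (by omega))
      (fun l hl => hw l (by omega))
    refine ⟨fun x => -(G₁ x + G₂ x), (hG₁.add hG₂).neg, fun x hx => ?_, ?_, fun e he => ?_⟩
    · change -(G₁ x + G₂ x) = 0
      rw [hs₁ x hx, hs₂ x fun h => hx (tsupport_fderiv_apply_subset ℝ v h), add_zero, neg_zero]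
    · simp only [neg_sq]
      have e1 : ∑ l ∈ Finset.range (a + 1), ∫ x, F (l + 1) x ^ 2
          ≤ ∑ l ∈ Finset.range (a + 1 + 1), ∫ x, F l x ^ 2 := by
        rw [Finset.sum_range_succ' _ (a + 1)]
        exact le_add_of_nonneg_right (integral_nonneg fun x => sq_nonneg _)
      have e2 : ∑ l ∈ Finset.range (a + 1), ∫ x, F l x ^ 2
          ≤ ∑ l ∈ Finset.range (a + 1 + 1), ∫ x, F l x ^ 2 := by
        rw [Finset.sum_range_succ _ (a + 1)]
        exact le_add_of_nonneg_right (integral_nonneg fun x => sq_nonneg _)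
      have e3 := integral_add_sq_le hG₁ hG₂
      have e4 := mul_le_mul_of_nonneg_left e1 hC₁
      have e5 := mul_le_mul_of_nonneg_left e2 hC₂
      linarith
    · obtain ⟨i1, e1⟩ := hi₁ e he
      obtain ⟨i2, e2⟩ := hi₂ e he
      have hneg : (fun x => -(G₁ x + G₂ x) * e x) = fun x => -(G₁ x * e x + G₂ x * e x) := by
        ext x; ring
      rw [hneg]
      refine ⟨(i1.add i2).neg, ?_⟩
      rw [integral_neg, integral_add i1 i2, ← e1, ← e2, List.replicate_succ, listDeriv_cons]
      set h := listDeriv (List.replicate a v) e with hh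
      have hsm : ContDiff ℝ ((⊤ : ℕ∞) : WithTop ℕ∞) h := contDiff_listDeriv _ he
      have hprod : ∀ x, χ x * fderiv ℝ h x v
          = fderiv ℝ (fun y => χ y * h y) x v - fderiv ℝ χ x v * h x := by
        intro x
        have d1 : DifferentiableAt ℝ χ x := hχ.contDiff.differentiable (by simp) x
        have d2 : DifferentiableAt ℝ h x := hsm.differentiable (by simp) x
        rw [fderiv_fun_mul d1 d2]
        simp
        ring
      have t1 := hχ.mul_left hsm
      have t2 := hχ'.mul_left hsm
      have e3 := hw1 _ t1
      simp only [hprod, mul_sub]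
      rw [integral_sub (memLp_ofLp_mul (hF 0 (by omega)) (t1.fderiv_apply v).memLp_volume)
        (memLp_ofLp_mul (hF 0 (by omega)) t2.memLp_volume), e3]
      ring

end Leibniz

/-! ### Fourier series on a box -/

section HilbertBasisTail

variable {𝕜 H ι : Type*} [RCLike 𝕜] [NormedAddCommGroup H] [InnerProductSpace 𝕜 H]

/-- By Parseval the inner product is a sum over coordinates. Those in `low` drop out because of `y`,
and Cauchy–Schwarz leaves only the tail of `x`. -/
theorem norm_inner_sq_le_of_tail (b : HilbertBasis ι 𝕜 H) {x y : H} {low : Set ι}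
    {B : ℝ} (hB : ∀ s : Finset ι, (∀ k ∈ s, k ∉ low) → ∑ k ∈ s, ‖inner 𝕜 (b k) x‖ ^ 2 ≤ B)
    (hy : ∀ k ∈ low, inner 𝕜 (b k) y = 0) : ‖inner 𝕜 x y‖ ^ 2 ≤ B * ‖y‖ ^ 2 := by
  classical
  refine le_of_tendsto ((b.hasSum_inner_mul_inner x y).norm.pow 2) (Eventually.of_forall fun s => ?_)
  have h1 : ∑ k ∈ s, inner 𝕜 x (b k) * inner 𝕜 (b k) y
      = ∑ k ∈ s with k ∉ low, inner 𝕜 x (b k) * inner 𝕜 (b k) y := by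
    rw [Finset.sum_filter_of_ne]
    intro k _ hk hl
    exact hk (by rw [hy k hl, mul_zero])
  rw [h1]
  set t := s.filter fun k => k ∉ low
  calc ‖∑ k ∈ t, inner 𝕜 x (b k) * inner 𝕜 (b k) y‖ ^ 2
      ≤ (∑ k ∈ t, ‖inner 𝕜 (b k) x‖ * ‖inner 𝕜 (b k) y‖) ^ 2 := by
        refine pow_le_pow_left₀ (norm_nonneg _) ((norm_sum_le _ _).trans ?_) 2
        refine Finset.sum_le_sum fun k _ => ?_
        rw [norm_mul, norm_inner_symm]
    _ ≤ (∑ k ∈ t, ‖inner 𝕜 (b k) x‖ ^ 2) * ∑ k ∈ t, ‖inner 𝕜 (b k) y‖ ^ 2 :=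
        Finset.sum_mul_sq_le_sq_mul_sq _ _ _
    _ ≤ B * ‖y‖ ^ 2 := by
        have h2 := hB t fun k hk => (Finset.mem_filter.1 hk).2
        have h3 := b.orthonormal.sum_inner_products_le (x := y) (s := t)
        exact mul_le_mul h2 h3 (Finset.sum_nonneg fun k _ => sq_nonneg _)
          ((Finset.sum_nonneg fun k _ => sq_nonneg _).trans h2)

end HilbertBasisTail

/-! ### Trigonometric basis of a cube and Fourier decay of Sobolev functions -/

section FourierBox

open Complex in
/-- The trigonometric function of frequency `k` with period `2 * T`, normalised in
`L₂(-T, T)`. -/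
def trigFun (T : ℝ) (k : ℤ) (t : ℝ) : ℂ :=
  ((√(2 * T))⁻¹ : ℝ) * exp ((Real.pi / T * k : ℝ) * I * t)

theorem continuous_trigFun (T : ℝ) (k : ℤ) : Continuous (trigFun T k) := by
  unfold trigFun
  fun_prop

theorem memLp_trigFun (T : ℝ) (k : ℤ) :
    MemLp (trigFun T k) 2 (volume.restrict (Set.Ioc (-T) T)) := by
  refine MemLp.of_bound (continuous_trigFun T k).aestronglyMeasurable |(√(2 * T))⁻¹|
    (Eventually.of_forall fun t => ?_)
  rw [trigFun, norm_mul, Complex.norm_real, Real.norm_eq_abs]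
  have : ((Real.pi / T * k : ℝ) : ℂ) * Complex.I * t = ((Real.pi / T * k * t : ℝ) : ℂ) * Complex.I := by
    push_cast; ring
  rw [this, Complex.norm_exp_ofReal_mul_I, mul_one]

theorem conj_trigFun (T : ℝ) (k : ℤ) (t : ℝ) :
    (starRingEnd ℂ) (trigFun T k t) = trigFun T (-k) t := by
  rw [trigFun, trigFun, map_mul, Complex.conj_ofReal, ← Complex.exp_conj]
  simp

theorem integral_trigFun_mul_conj {T : ℝ} (hT : 0 < T) (k l : ℤ) :
    ∫ t in Set.Ioc (-T) T, trigFun T k t * (starRingEnd ℂ) (trigFun T l t)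
      = if k = l then 1 else 0 := by
  have h0 : ∀ t, trigFun T k t * (starRingEnd ℂ) (trigFun T l t)
      = ((2 * T)⁻¹ : ℝ) * Complex.exp ((Real.pi / T * (k - l : ℤ) : ℝ) * Complex.I * t) := by
    intro t
    rw [conj_trigFun, trigFun, trigFun, mul_mul_mul_comm, ← Complex.exp_add, ← Complex.ofReal_mul,
      ← mul_inv, Real.mul_self_sqrt (by positivity)]
    congr 2
    push_cast
    ring
  simp only [h0]
  rw [integral_const_mul, ← intervalIntegral.integral_of_le (by linarith)]
  have hT' : (T : ℂ) ≠ 0 := by exact_mod_cast hT.ne'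
  split_ifs with h
  · subst h
    simp only [sub_self, Int.cast_zero, mul_zero, Complex.ofReal_zero, zero_mul, Complex.exp_zero,
      intervalIntegral.integral_const, Complex.real_smul]
    push_cast
    field_simp
    ring
  · have hne : ((k - l : ℤ) : ℂ) ≠ 0 := by exact_mod_cast sub_ne_zero.2 h
    have hc : ((Real.pi / T * (k - l : ℤ) : ℝ) : ℂ) * Complex.I ≠ 0 := by
      have : (Real.pi : ℂ) ≠ 0 := by exact_mod_cast Real.pi_ne_zero
      push_cast at hne ⊢
      simp [this, hT', hne]
    rw [integral_exp_mul_complex hc]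
    -- The exponents at the two endpoints differ by an integer multiple of `2πi`, so the integral of
    -- a nonconstant exponential vanishes.
    have e1 : ((Real.pi / T * (k - l : ℤ) : ℝ) : ℂ) * Complex.I * T
        = ((Real.pi / T * (k - l : ℤ) : ℝ) : ℂ) * Complex.I * (-T : ℝ)
          + (k - l : ℤ) * (2 * Real.pi * Complex.I) := by
      push_cast
      field_simp
      ring
    rw [e1, Complex.exp_add, Complex.exp_int_mul_two_pi_mul_I]
    simp

/-- All Fourier coefficients on the circle of length `2T` vanish, and Parseval's identity then makes
the `L₂` norm zero. -/
theorem ae_eq_zero_of_integral_mul_trigFun {T : ℝ} (hT : 0 < T) {g : ℝ → ℂ}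
    (hg : MemLp g 2 (volume.restrict (Set.Ioc (-T) T)))
    (h0 : ∀ k, ∫ t in Set.Ioc (-T) T, g t * trigFun T k t = 0) :
    g =ᵐ[volume.restrict (Set.Ioc (-T) T)] 0 := by
  have hlt : -T < T := by linarith
  have h1 := hasSum_sq_fourierCoeffOn hlt hg
  have hc : ∀ k, fourierCoeffOn hlt g k = 0 := by
    intro k
    rw [fourierCoeffOn_eq_integral, intervalIntegral.integral_of_le hlt.le]
    have h2 : ∀ t : ℝ, fourier (-k) (t : AddCircle (T - -T)) • g t
        = (√(2 * T) : ℝ) * (g t * trigFun T (-k) t) := by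
      intro t
      have hs : ((√(2 * T) : ℝ) : ℂ) ≠ 0 := by
        exact_mod_cast (Real.sqrt_pos.2 (by positivity)).ne'
      have hT' : (T : ℂ) ≠ 0 := by exact_mod_cast hT.ne'
      have h3 : 2 * (Real.pi : ℂ) * Complex.I * (-k : ℤ) * t / ((T - -T : ℝ) : ℂ)
          = (Real.pi / T * (-k : ℤ) : ℝ) * Complex.I * t := by
        push_cast
        field_simp
        ring
      rw [fourier_coe_apply, trigFun, Complex.ofReal_inv, smul_eq_mul, h3, mul_left_comm,
        mul_inv_cancel_left₀ hs, mul_comm]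
    simp only [h2]
    rw [integral_const_mul, h0, mul_zero, smul_zero]
  simp only [hc, norm_zero, ne_eq, OfNat.ofNat_ne_zero, not_false_eq_true, zero_pow] at h1
  have h3 := h1.unique hasSum_zero
  rw [smul_eq_zero, intervalIntegral.integral_of_le hlt.le] at h3
  have h4 := h3.resolve_left (inv_ne_zero (by linarith))
  rw [integral_eq_zero_iff_of_nonneg (fun t => sq_nonneg _) (hg.integrable_norm_pow (by norm_num))]
    at h4
  filter_upwards [h4] with t ht
  simpa using ht

variable {n : ℕ}

/-- The box `(-T, T]ⁿ`. -/
def cube (n : ℕ) (T : ℝ) : Set (Fin n → ℝ) := Set.pi Set.univ fun _ => Set.Ioc (-T) T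

/-- The trigonometric functions on a box. -/
def trigProd (T : ℝ) (k : Fin n → ℤ) (x : Fin n → ℝ) : ℂ := ∏ i, trigFun T (k i) (x i)

theorem continuous_trigProd (T : ℝ) (k : Fin n → ℤ) : Continuous (trigProd T k) := by
  unfold trigProd
  exact continuous_finsetProd _ fun i _ => (continuous_trigFun T (k i)).comp (continuous_apply i)

theorem restrict_cube (T : ℝ) : (volume : Measure (Fin n → ℝ)).restrict (cube n T)
    = Measure.pi fun _ => volume.restrict (Set.Ioc (-T) T) :=
  restrict_univ_pi _

theorem memLp_trigProd (T : ℝ) (k : Fin n → ℤ) :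
    MemLp (trigProd T k) 2 (volume.restrict (cube n T)) := by
  rw [restrict_cube]
  exact memLp_two_prod_apply fun i => memLp_trigFun T (k i)

theorem conj_trigProd (T : ℝ) (k : Fin n → ℤ) (x : Fin n → ℝ) :
    (starRingEnd ℂ) (trigProd T k x) = trigProd T (-k) x := by
  simp [trigProd, map_prod, conj_trigFun]

/-- The Fourier basis of `L₂((-T, T]ⁿ)`. -/
def trigBasis (n : ℕ) {T : ℝ} (hT : 0 < T) :
    HilbertBasis (Fin n → ℤ) ℂ (Lp ℂ 2 ((volume : Measure (Fin n → ℝ)).restrict (cube n T))) :=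
  hilbertBasisOfComplete (trigProd T) (memLp_trigProd T)
    (fun k l => by
      rw [restrict_cube]
      simp only [trigProd, map_prod]
      rw [integral_prod_mul_prod (ψ := fun _ => trigFun T)
        (χ := fun _ k t => (starRingEnd ℂ) (trigFun T k t))
        (fun i k l => integral_trigFun_mul_conj hT k l)]
      simp [eq_comm])
    (fun g hg h0 => by
      rw [restrict_cube] at *
      refine ae_eq_zero_of_integral_mul_prod_eq_zero (ψ := fun _ => trigFun T)
        (fun _ k => memLp_trigFun T k)
        (fun _ g hg h0 => ae_eq_zero_of_integral_mul_trigFun hT hg h0) hg fun k => ?_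
      have := h0 (-k)
      simp only [conj_trigProd, neg_neg] at this
      exact this)

theorem trigBasis_apply {T : ℝ} (hT : 0 < T) (k : Fin n → ℤ) :
    trigBasis n hT k = (memLp_trigProd T k).toLp (trigProd T k) :=
  hilbertBasisOfComplete_apply _ _ _ _ k

/-- The exponent of the trigonometric function of frequency `k`. -/
def trigForm (T : ℝ) (k : Fin n → ℤ) : (Fin n → ℝ) →L[ℝ] ℂ :=
  ∑ i, (((Real.pi / T * k i : ℝ) : ℂ) * Complex.I) •
    Complex.ofRealCLM.comp (ContinuousLinearMap.proj (R := ℝ) (φ := fun _ : Fin n => ℝ) i)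

theorem trigForm_apply (T : ℝ) (k : Fin n → ℤ) (x : Fin n → ℝ) :
    trigForm T k x = ∑ i, ((Real.pi / T * k i : ℝ) : ℂ) * Complex.I * x i := by
  simp [trigForm]

theorem trigForm_stdVec (T : ℝ) (k : Fin n → ℤ) (i : Fin n) :
    trigForm T k (stdVec n i) = ((Real.pi / T * k i : ℝ) : ℂ) * Complex.I := by
  rw [trigForm_apply, Finset.sum_eq_single i]
  · simp [stdVec]
  · intro j _ hj
    simp [stdVec, hj]
  · simp

theorem trigProd_eq (T : ℝ) (k : Fin n → ℤ) (x : Fin n → ℝ) :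
    trigProd T k x = (((√(2 * T))⁻¹ : ℝ) : ℂ) ^ n * Complex.exp (trigForm T k x) := by
  simp only [trigProd, trigFun]
  rw [Finset.prod_mul_distrib, ← Complex.exp_sum, trigForm_apply]
  simp

/-- A real trigonometric function on the box. -/
def realTrig (T : ℝ) (k : Fin n → ℤ) (z : ℂ) (x : Fin n → ℝ) : ℝ := (z * trigProd T k x).re

theorem hasFDerivAt_realTrig (T : ℝ) (k : Fin n → ℤ) (z : ℂ) (x : Fin n → ℝ) :
    HasFDerivAt (realTrig T k z)
      (Complex.reCLM.comp ((z * trigProd T k x) • trigForm T k)) x := by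
  have h0 : realTrig T k z = fun y => Complex.reCLM
      (z * (((√(2 * T))⁻¹ : ℝ) : ℂ) ^ n * Complex.exp (trigForm T k y)) := by
    ext y
    simp [realTrig, trigProd_eq, mul_assoc]
  have h1 := ((trigForm T k).hasFDerivAt (x := x)).cexp.const_mul
    (z * (((√(2 * T))⁻¹ : ℝ) : ℂ) ^ n)
  rw [h0, trigProd_eq, ← mul_assoc, mul_smul]
  exact Complex.reCLM.hasFDerivAt.comp x h1

theorem contDiff_realTrig (T : ℝ) (k : Fin n → ℤ) (z : ℂ) :
    ContDiff ℝ ((⊤ : ℕ∞) : WithTop ℕ∞) (realTrig T k z) := by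
  have h : realTrig T k z = fun x => Complex.reCLM
      (z * ((((√(2 * T))⁻¹ : ℝ) : ℂ) ^ n * Complex.exp (trigForm T k x))) := by
    ext y
    simp [realTrig, trigProd_eq]
  rw [h]
  exact Complex.reCLM.contDiff.comp
    (contDiff_const.mul (contDiff_const.mul (trigForm T k).contDiff.cexp))

/-- An exponential is an eigenfunction of each directional derivative. The free complex amplitude
`z` keeps the derivatives inside a family of real functions, to which real weak derivatives apply.
-/
theorem listDeriv_realTrig (T : ℝ) (k : Fin n → ℤ) (z : ℂ) (i : Fin n) (a : ℕ) :
    listDeriv (List.replicate a (stdVec n i)) (realTrig T k z)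
      = realTrig T k ((((Real.pi / T * k i : ℝ) : ℂ) * Complex.I) ^ a * z) := by
  induction a with
  | zero => simp [listDeriv]
  | succ a ih =>
    rw [List.replicate_succ, listDeriv_cons, ih]
    ext x
    rw [(hasFDerivAt_realTrig T k _ x).fderiv]
    simp only [ContinuousLinearMap.comp_apply, _root_.smul_apply, trigForm_stdVec,
      realTrig, Complex.reCLM_apply, smul_eq_mul]
    congr 1
    ring

/-- The Fourier coefficient of a real function on the box. -/
def trigCoeff (T : ℝ) (k : Fin n → ℤ) (h : (Fin n → ℝ) → ℝ) : ℂ :=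
  ∫ x in cube n T, (h x : ℂ) * trigProd T k x

theorem integral_mul_realTrig {T : ℝ} {h : (Fin n → ℝ) → ℝ}
    (hh : MemLp h 2 (volume.restrict (cube n T))) (k : Fin n → ℤ) (z : ℂ) :
    ∫ x in cube n T, h x * realTrig T k z x = (z * trigCoeff T k h).re := by
  have h1 : Integrable (fun x => (h x : ℂ) * trigProd T k x) (volume.restrict (cube n T)) :=
    memLp_ofLp_mul hh.ofReal (memLp_trigProd T k)
  rw [trigCoeff, ← integral_const_mul, ← Complex.reCLM_apply,
    ← Complex.reCLM.integral_comp_comm (h1.const_mul z)]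
  refine integral_congr_ae (Eventually.of_forall fun x => ?_)
  simp only [realTrig, Complex.reCLM_apply]
  rw [mul_left_comm, Complex.re_ofReal_mul]

theorem inner_trigBasis {T : ℝ} (hT : 0 < T) {h : (Fin n → ℝ) → ℝ}
    (hh : MemLp h 2 (volume.restrict (cube n T))) (k : Fin n → ℤ) :
    inner ℂ (trigBasis n hT k) (hh.ofReal (K := ℂ)).toLp = trigCoeff T (-k) h := by
  rw [trigBasis_apply, inner_toLp, trigCoeff]
  simp only [conj_trigProd]
  rfl

theorem norm_ofReal_toLp_sq {Y : Type*} [MeasurableSpace Y] {μ : Measure Y} {h : Y → ℝ}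
    (hh : MemLp h 2 μ) : ‖(hh.ofReal (K := ℂ)).toLp‖ ^ 2 = ∫ x, h x ^ 2 ∂μ := by
  have h1 := inner_self_eq_norm_sq_to_K (𝕜 := ℂ) (hh.ofReal (K := ℂ)).toLp
  rw [inner_toLp] at h1
  have h2 : ∀ x, ((h x : ℝ) : ℂ) * (starRingEnd ℂ) ((h x : ℝ) : ℂ) = ((h x ^ 2 : ℝ) : ℂ) := by
    intro x; rw [Complex.conj_ofReal]; push_cast; ring
  have h3 : ∫ x, ((h x : ℝ) : ℂ) * (starRingEnd ℂ) ((h x : ℝ) : ℂ) ∂μ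
      = ((∫ x, h x ^ 2 ∂μ : ℝ) : ℂ) := by
    simp only [h2]
    exact integral_ofReal
  have h4 := h3.symm.trans h1
  exact (Complex.ofReal_injective (h4.trans (by push_cast; rfl))).symm

/-- A smooth cutoff which equals one on a compact set and is supported in a box. -/
theorem exists_cutoff {X : Set (Fin n → ℝ)} (hX : IsCompact X) :
    ∃ T > 0, ∃ χ : (Fin n → ℝ) → ℝ, IsTestFunction Set.univ χ ∧ (∀ x ∈ X, χ x = 1) ∧
      tsupport χ ⊆ cube n T := by
  obtain ⟨r, hr0, hr⟩ := hX.isBounded.subset_closedBall_lt 0 0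
  let b : ContDiffBump (0 : Fin n → ℝ) := ⟨r, r + 1, hr0, by linarith⟩
  refine ⟨r + 2, by linarith, b, ⟨b.contDiff, b.hasCompactSupport, Set.subset_univ _⟩,
    fun x hx => b.one_of_mem_closedBall (hr hx), ?_⟩
  rw [b.tsupport_eq]
  intro x hx i _
  have h1 : ‖x i‖ ≤ r + 1 := (norm_le_pi_norm x i).trans (mem_closedBall_zero_iff.1 hx)
  rw [Real.norm_eq_abs, abs_le] at h1
  exact ⟨by linarith [h1.1], by linarith [h1.2]⟩

/-- Multiplying a Sobolev function by a cutoff, the Fourier coefficients decay. -/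
theorem exists_sum_trigCoeff_sq_le {χ : (Fin n → ℝ) → ℝ} (hχ : IsTestFunction Set.univ χ) (α : ℕ)
    {T : ℝ} (hT : 0 < T) (hs : tsupport χ ⊆ cube n T) :
    ∃ C ≥ 0, ∀ (p : ℕ), 1 ≤ p → ∀ (F : (Fin n → ℝ) → ℝ) (G : (Fin n → ℕ) → (Fin n → ℝ) → ℝ),
      IsSobolevFamily (stdVec n) α Set.univ F G →
      ∀ s : Finset (Fin n → ℤ), (∀ k ∈ s, ∃ i, (p : ℤ) ≤ |k i|) →
        ∑ k ∈ s, ‖trigCoeff T (-k) fun x => G 0 x * χ x‖ ^ 2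
          ≤ C * ((p : ℝ) ^ (2 * α))⁻¹ * ∑ β ∈ multiIdx (Fin n) α, ∫ x, G β x ^ 2 := by
  choose C hC0 hC using fun i => exists_cutoff_integration_by_parts (stdVec n i) α χ hχ
  have hω : 0 < Real.pi / T := div_pos Real.pi_pos hT
  refine ⟨((Real.pi / T) ^ (2 * α))⁻¹ * ∑ i, C i,
    mul_nonneg (by positivity) (Finset.sum_nonneg fun i _ => hC0 i), fun p hp F G hG s hsp => ?_⟩
  have hmem : ∀ (i : Fin n) (l : ℕ), l ≤ α → ∑ j, (Pi.single i l : Fin n → ℕ) j ≤ α := by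
    intro i l hl; simpa using hl
  have hF0 : F =ᵐ[volume] G 0 := by
    have h0 : (0 : Fin n → ℕ) ∈ multiIdx (Fin n) α := mem_multiIdx.2 (by simp)
    have := IsWeakDeriv.ae_eq isOpen_univ EventuallyEq.rfl
      (isWeakDeriv_zero (stdVec n) Set.univ F) (hG.isWeakDeriv 0 h0) hG.memLp (hG.memLp_deriv 0 h0)
    rwa [Measure.restrict_univ] at this
  have hmem' : ∀ (i : Fin n) (l : ℕ), l ≤ α → MemLp (G (Pi.single i l)) 2 volume := by
    intro i l hl
    have := hG.memLp_deriv _ (mem_multiIdx.2 (hmem i l hl))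
    rwa [Measure.restrict_univ] at this
  have hM0 : MemLp (G 0) 2 volume := by
    have := hG.memLp_deriv 0 (mem_multiIdx.2 (by simp))
    rwa [Measure.restrict_univ] at this
  -- Up to the sign `(-1)^α`, `g i` plays the role of the pure derivative of order `α` in direction
  -- `i` of the cut-off function. It may be tested against smooth functions without compact support,
  -- such as trigonometric ones.
  have hcut : ∀ i, ∃ g : (Fin n → ℝ) → ℝ, MemLp g 2 volume ∧ (∀ x ∉ tsupport χ, g x = 0) ∧
      ∫ x, g x ^ 2 ≤ C i * ∑ l ∈ Finset.range (α + 1), ∫ x, G (Pi.single i l) x ^ 2 ∧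
      ∀ e, ContDiff ℝ ((⊤ : ℕ∞) : WithTop ℕ∞) e → Integrable (fun x => g x * e x) volume ∧
        ∫ x, G 0 x * (χ x * listDeriv (List.replicate α (stdVec n i)) e x) = ∫ x, g x * e x := by
    intro i
    have := hC i (fun l => G (Pi.single i l)) (hmem' i) (fun l hl φ hφ => by
      have h1 := isWeakDeriv_iff.1 (hG.isWeakDeriv _ (mem_multiIdx.2 (hmem i l hl))) φ hφ
      rw [multiDeriv_eq_listDeriv, listDeriv_perm (dirList_single_perm _ i l) hφ.contDiff,
        Measure.restrict_univ, Finset.sum_pi_single', if_pos (Finset.mem_univ i)] at h1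
      rw [← h1]
      refine integral_congr_ae ?_
      filter_upwards [hF0] with x hx
      simp only [Pi.single_zero, hx])
    simpa only [Pi.single_zero] using this
  choose g hg hgs hgn hge using hcut
  have hgm : ∀ i, MemLp (g i) 2 (volume.restrict (cube n T)) := fun i => (hg i).restrict _
  set h : (Fin n → ℝ) → ℝ := fun x => G 0 x * χ x with hh
  obtain ⟨B, hB⟩ := hχ.compact.exists_bound_of_continuous hχ.contDiff.continuous
  have hhm : MemLp h 2 (volume.restrict (cube n T)) := by
    have h1 := hM0.mul (p := ∞) (q := 2) (r := 2)
      (memLp_top_of_bound hχ.contDiff.continuous.aestronglyMeasurable B (Eventually.of_forall hB))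
    exact (h1.congr_norm (hM0.1.mul hχ.contDiff.continuous.aestronglyMeasurable)
      (Eventually.of_forall fun x => by simp [mul_comm])).restrict _
  -- Differentiation becomes multiplication of the Fourier coefficient. The identity is read off
  -- from real parts, and the amplitudes `1` and `-i` recover the real and imaginary parts.
  have hcoef : ∀ i (k : Fin n → ℤ), (((Real.pi / T * k i : ℝ) : ℂ) * Complex.I) ^ α
      * trigCoeff T k h = trigCoeff T k (g i) := by
    intro i k
    have h1 : ∀ z : ℂ, (z * ((((Real.pi / T * k i : ℝ) : ℂ) * Complex.I) ^ α
        * trigCoeff T k h)).re = (z * trigCoeff T k (g i)).re := by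
      intro z
      have h2 := (hge i _ (contDiff_realTrig T k z)).2
      rw [listDeriv_realTrig] at h2
      have h3 : ∀ z, ∫ x, G 0 x * (χ x * realTrig T k z x) = (z * trigCoeff T k h).re := by
        intro z
        rw [← integral_mul_realTrig hhm, setIntegral_eq_integral_of_forall_compl_eq_zero]
        · simp only [hh, mul_assoc]
        · intro x hx
          simp only [hh]
          rw [image_eq_zero_of_notMem_tsupport fun hx' => hx (hs hx'), mul_zero, zero_mul]
      have h4 : ∫ x, g i x * realTrig T k z x = (z * trigCoeff T k (g i)).re := by
        rw [← integral_mul_realTrig (hgm i), setIntegral_eq_integral_of_forall_compl_eq_zero]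
        intro x hx
        rw [hgs i x fun hx' => hx (hs hx'), zero_mul]
      rw [h3, h4] at h2
      rw [← h2]
      congr 1
      ring
    refine Complex.ext ?_ ?_
    · simpa using h1 1
    · simpa using h1 (-Complex.I)
  -- The coordinate in which a frequency is large depends on `k`; summing over all `i` removes this
  -- dependence.
  have hbound : ∀ k ∈ s, ‖trigCoeff T (-k) h‖ ^ 2
      ≤ (((Real.pi / T) ^ (2 * α))⁻¹ * ((p : ℝ) ^ (2 * α))⁻¹)
        * ∑ i, ‖trigCoeff T (-k) (g i)‖ ^ 2 := by
    intro k hk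
    obtain ⟨i, hi⟩ := hsp k hk
    have h1 : ‖trigCoeff T (-k) (g i)‖ ^ 2 ≤ ∑ i, ‖trigCoeff T (-k) (g i)‖ ^ 2 :=
      Finset.single_le_sum (f := fun i => ‖trigCoeff T (-k) (g i)‖ ^ 2)
        (fun i _ => sq_nonneg _) (Finset.mem_univ i)
    have hp' : (0 : ℝ) < p := by exact_mod_cast hp
    have hi' : (p : ℝ) ≤ |(k i : ℝ)| := by exact_mod_cast hi
    rw [← mul_inv, ← mul_pow, inv_mul_eq_div, le_div_iff₀ (by positivity)]
    refine le_trans ?_ h1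
    rw [← hcoef i (-k), norm_mul, norm_pow, norm_mul, Complex.norm_I, mul_one, Complex.norm_real,
      Real.norm_eq_abs, mul_pow (_ ^ α) ‖_‖, ← pow_mul, mul_comm α 2, mul_comm]
    refine mul_le_mul_of_nonneg_right (pow_le_pow_left₀ (by positivity) ?_ _) (sq_nonneg _)
    rw [abs_mul, abs_of_pos hω]
    refine mul_le_mul_of_nonneg_left ?_ hω.le
    simpa using hi'
  have hbessel : ∀ i, ∑ k ∈ s, ‖trigCoeff T (-k) (g i)‖ ^ 2
      ≤ C i * ∑ β ∈ multiIdx (Fin n) α, ∫ x, G β x ^ 2 := by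
    intro i
    calc ∑ k ∈ s, ‖trigCoeff T (-k) (g i)‖ ^ 2
        ≤ ‖((hgm i).ofReal (K := ℂ)).toLp‖ ^ 2 := by
          have := (trigBasis n hT).orthonormal.sum_inner_products_le
            (x := ((hgm i).ofReal (K := ℂ)).toLp) (s := s)
          simpa only [inner_trigBasis hT (hgm i)] using this
      _ = ∫ x in cube n T, g i x ^ 2 := norm_ofReal_toLp_sq (hgm i)
      _ ≤ ∫ x, g i x ^ 2 :=
          setIntegral_le_integral (hg i).integrable_sq (Eventually.of_forall fun x => sq_nonneg _)
      _ ≤ _ := by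
          refine (hgn i).trans (mul_le_mul_of_nonneg_left ?_ (hC0 i))
          rw [← Finset.sum_image (f := fun β => ∫ x, G β x ^ 2) (s := Finset.range (α + 1))
            (g := fun l => (Pi.single i l : Fin n → ℕ))
            (fun a _ b _ hab => Pi.single_injective i hab)]
          refine Finset.sum_le_sum_of_subset_of_nonneg ?_
            fun β _ _ => integral_nonneg fun x => sq_nonneg _
          intro β hβ
          obtain ⟨l, hl, rfl⟩ := Finset.mem_image.1 hβ
          exact mem_multiIdx.2 (hmem i l (Nat.lt_succ_iff.1 (Finset.mem_range.1 hl)))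
  calc ∑ k ∈ s, ‖trigCoeff T (-k) h‖ ^ 2
      ≤ ∑ k ∈ s, (((Real.pi / T) ^ (2 * α))⁻¹ * ((p : ℝ) ^ (2 * α))⁻¹)
        * ∑ i, ‖trigCoeff T (-k) (g i)‖ ^ 2 := Finset.sum_le_sum hbound
    _ = (((Real.pi / T) ^ (2 * α))⁻¹ * ((p : ℝ) ^ (2 * α))⁻¹)
        * ∑ i, ∑ k ∈ s, ‖trigCoeff T (-k) (g i)‖ ^ 2 := by
        rw [← Finset.mul_sum, Finset.sum_comm]
    _ ≤ (((Real.pi / T) ^ (2 * α))⁻¹ * ((p : ℝ) ^ (2 * α))⁻¹)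
        * ∑ i, C i * ∑ β ∈ multiIdx (Fin n) α, ∫ x, G β x ^ 2 := by
        have hp' : (0 : ℝ) < p := by exact_mod_cast hp
        exact mul_le_mul_of_nonneg_left (Finset.sum_le_sum fun i _ => hbessel i) (by positivity)
    _ = _ := by rw [← Finset.sum_mul]; ring

/-- A Sobolev function on `ℝⁿ` is almost orthogonal to the functions on a compact set which are
orthogonal to low frequencies. -/
theorem exists_integral_mul_sq_le_of_trig {X : Set (Fin n → ℝ)} (hX : IsCompact X) (α : ℕ) :
    ∃ T : ℝ, 0 < T ∧ ∃ C ≥ 0, ∀ (p : ℕ), 1 ≤ p → ∀ (F : (Fin n → ℝ) → ℝ)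
      (G : (Fin n → ℕ) → (Fin n → ℝ) → ℝ), IsSobolevFamily (stdVec n) α Set.univ F G →
      ∀ w : (Fin n → ℝ) → ℝ, MemLp w 2 (volume.restrict X) →
      (∀ k : Fin n → ℤ, (∀ i, |k i| < p) → ∫ x in X, (w x : ℂ) * trigProd T k x = 0) →
      (∫ x in X, F x * w x) ^ 2 ≤ C * ((p : ℝ) ^ (2 * α))⁻¹
        * (∑ β ∈ multiIdx (Fin n) α, ∫ x, G β x ^ 2) * ∫ x in X, w x ^ 2 := by
  obtain ⟨T, hT, χ, hχ, hχ1, hs⟩ := exists_cutoff hX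
  obtain ⟨C, hC0, hC⟩ := exists_sum_trigCoeff_sq_le hχ α hT hs
  refine ⟨T, hT, C, hC0, fun p hp F G hG w hw hw0 => ?_⟩
  have hXm : MeasurableSet X := hX.isClosed.measurableSet
  have hXs : X ⊆ cube n T := fun x hx => hs (subset_tsupport χ (by simp [hχ1 x hx]))
  have hF0 : F =ᵐ[volume] G 0 := by
    have h0 : (0 : Fin n → ℕ) ∈ multiIdx (Fin n) α := mem_multiIdx.2 (by simp)
    have := IsWeakDeriv.ae_eq isOpen_univ EventuallyEq.rfl
      (isWeakDeriv_zero (stdVec n) Set.univ F) (hG.isWeakDeriv 0 h0) hG.memLp (hG.memLp_deriv 0 h0)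
    rwa [Measure.restrict_univ] at this
  have hM0 : MemLp (G 0) 2 volume := by
    have := hG.memLp_deriv 0 (mem_multiIdx.2 (by simp))
    rwa [Measure.restrict_univ] at this
  obtain ⟨B, hB⟩ := hχ.compact.exists_bound_of_continuous hχ.contDiff.continuous
  have hhm : MemLp (fun x => G 0 x * χ x) 2 (volume.restrict (cube n T)) := by
    have h1 := hM0.mul (p := ∞) (q := 2) (r := 2)
      (memLp_top_of_bound hχ.contDiff.continuous.aestronglyMeasurable B (Eventually.of_forall hB))
    exact (h1.congr_norm (hM0.1.mul hχ.contDiff.continuous.aestronglyMeasurable)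
      (Eventually.of_forall fun x => by simp [mul_comm])).restrict _
  have hrestr : ∀ {E : Type} [NormedAddCommGroup E] [NormedSpace ℝ E] (u : (Fin n → ℝ) → E),
      ∫ x in cube n T, X.indicator u x = ∫ x in X, u x := by
    intro E _ _ u
    rw [setIntegral_indicator hXm, Set.inter_eq_right.2 hXs]
  have hwm : MemLp (X.indicator w) 2 (volume.restrict (cube n T)) :=
    ((memLp_indicator_iff_restrict hXm).2 hw).restrict _
  -- Applied to the cut-off function and to the extension of `w` by zero. The former has a small
  -- tail, the latter has no low frequencies; the set of low frequencies is symmetric, so the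
  -- conjugation `k ↦ -k` is harmless.
  have key := norm_inner_sq_le_of_tail (trigBasis n hT) (low := {k | ∀ i, |k i| < p})
    (x := (hhm.ofReal (K := ℂ)).toLp) (y := (hwm.ofReal (K := ℂ)).toLp)
    (B := C * ((p : ℝ) ^ (2 * α))⁻¹ * ∑ β ∈ multiIdx (Fin n) α, ∫ x, G β x ^ 2)
    (fun s hs => by
      simp only [inner_trigBasis hT hhm]
      exact hC p hp F G hG s fun k hk => by simpa using hs k hk)
    (fun k hk => by
      rw [inner_trigBasis hT hwm, trigCoeff, ← hw0 (-k) (by simpa using hk), ← hrestr]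
      refine integral_congr_ae (Eventually.of_forall fun x => ?_)
      by_cases hx : x ∈ X <;> simp [hx])
  rw [norm_ofReal_toLp_sq hwm] at key
  have e1 : ∫ x in cube n T, X.indicator w x ^ 2 = ∫ x in X, w x ^ 2 := by
    rw [← hrestr]
    refine integral_congr_ae (Eventually.of_forall fun x => ?_)
    by_cases hx : x ∈ X <;> simp [hx]
  -- The cutoff equals one on `X`, so it disappears from the pairing with a function supported
  -- there.
  have e2 : inner ℂ (hhm.ofReal (K := ℂ)).toLp (hwm.ofReal (K := ℂ)).toLp
      = ((∫ x in X, F x * w x : ℝ) : ℂ) := by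
    rw [inner_toLp, ← hrestr]
    have h1 : ∀ x, ((X.indicator w x : ℝ) : ℂ) * (starRingEnd ℂ) ((G 0 x * χ x : ℝ) : ℂ)
        = ((X.indicator (fun x => G 0 x * w x) x : ℝ) : ℂ) := by
      intro x
      rw [Complex.conj_ofReal]
      by_cases hx : x ∈ X <;> simp [hx, hχ1, mul_comm]
    have h2 : ∫ x in cube n T, X.indicator (fun x => F x * w x) x
        = ∫ x in cube n T, X.indicator (fun x => G 0 x * w x) x := by
      refine integral_congr_ae (ae_restrict_of_ae ?_)
      filter_upwards [hF0] with x hx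
      by_cases hx' : x ∈ X <;> simp [hx', hx]
    rw [h2]
    refine Eq.trans ?_ integral_ofReal
    exact integral_congr_ae (Eventually.of_forall h1)
  rwa [e1, e2, Complex.norm_real, Real.norm_eq_abs, sq_abs] at key

end FourierBox

/-! ### Decay of the eigenvalues -/

section EigenvalueDecay

variable {n α : ℕ} {X : Set (Fin n → ℝ)} {K : (Fin n → ℝ) → (Fin n → ℝ) → ℝ} {eig : ℕ → ℝ}
  {ψ : ℕ → (Fin n → ℝ) → ℝ}

/-- A nonzero vector satisfying fewer linear constraints than its dimension. -/
theorem exists_ne_zero_sum_eq_zero {κ : Type*} [Fintype κ] {N : ℕ} (A : κ → ℕ → ℂ)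
    (hN : 2 * Fintype.card κ < N) :
    ∃ c : ℕ → ℝ, (∃ l < N, c l ≠ 0) ∧ ∀ k, ∑ l ∈ Finset.range N, (c l : ℂ) * A k l = 0 := by
  let f : (Fin N → ℝ) →ₗ[ℝ] (κ → ℂ) :=
    LinearMap.pi fun k => ∑ l : Fin N,
      (LinearMap.toSpanSingleton ℝ ℂ (A k l)).comp (LinearMap.proj l)
  have hf : LinearMap.ker f ≠ ⊥ := by
    -- Each complex condition on the real vector counts as two real ones, whence the factor `2` in
    -- `hN`.
    refine LinearMap.ker_ne_bot_of_finrank_lt ?_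
    rw [Module.finrank_pi_fintype]
    simpa [mul_comm] using hN
  obtain ⟨v, hv, hv0⟩ := Submodule.exists_mem_ne_zero_of_ne_bot hf
  obtain ⟨l, hl⟩ := Function.ne_iff.1 hv0
  refine ⟨fun l => if h : l < N then v ⟨l, h⟩ else 0, ⟨l, l.2, by simpa using hl⟩, fun k => ?_⟩
  have := congrFun (LinearMap.mem_ker.1 hv) k
  rw [Finset.sum_range]
  simpa [f] using this

variable (hX : IsSobolevDomain α X) (hK : GeneratesSobolev α X K eig ψ)
include hX hK

/-- Among `M + 1` eigenfunctions some combination `w` avoids all `(2p - 1)^n` low frequencies. The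
inverse inequality bounds its squared Sobolev norm by a multiple of `(eig M)⁻¹ ‖w‖²`, whereas
orthogonality to low frequencies forces that norm to be at least of order `p^(2α) ‖w‖²`. -/
theorem exists_eig_mul_le : ∃ C ≥ 0, ∀ (p M : ℕ), 1 ≤ p → 2 * (2 * p - 1) ^ n < M + 1 →
    eig M ≤ C * ((p : ℝ) ^ (2 * α))⁻¹ := by
  obtain ⟨T, hT, C₁, hC₁, h₁⟩ := exists_integral_mul_sq_le_of_trig hX.isCompact α
  obtain ⟨C₂, hC₂, h₂⟩ := exists_sobolev_le_of_span hX hK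
  obtain ⟨c₀, hc₀⟩ := hX.extension
  refine ⟨C₁ * (c₀ ^ 2 * C₂), by positivity, fun p M hp hM => ?_⟩
  have hp' : (0 : ℝ) < p := by exact_mod_cast hp
  rcases (hK.isMercerKernel.eig_nonneg M).eq_or_lt with h0 | hpos
  · rw [← h0]; positivity
  have hψ := hK.isMercerKernel.memLp
  set low : Finset (Fin n → ℤ) := Fintype.piFinset fun _ => Finset.Ioo (-(p : ℤ)) p with hlow
  have hcard : Fintype.card low = (2 * p - 1) ^ n := by
    rw [Fintype.card_coe, hlow, Fintype.card_piFinset]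
    simp only [Int.card_Ioo, Finset.prod_const, Finset.card_univ, Fintype.card_fin]
    congr 1
    omega
  obtain ⟨c, ⟨l₀, hl₀, hcl₀⟩, hc⟩ := exists_ne_zero_sum_eq_zero (κ := low) (N := M + 1)
    (fun k l => ∫ x in X, (ψ l x : ℂ) * trigProd T k.1 x) (by rw [hcard]; exact hM)
  set w : (Fin n → ℝ) → ℝ := fun x => ∑ k ∈ Finset.range (M + 1), c k * ψ k x with hw
  have hwm : MemLp w 2 (volume.restrict X) := memLp_finsetSum _ fun k _ => (hψ k).const_mul _
  set N := ∑ k ∈ Finset.range (M + 1), c k ^ 2 with hN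
  have hNpos : 0 < N := Finset.sum_pos' (fun k _ => sq_nonneg _)
    ⟨l₀, Finset.mem_range.2 hl₀, by positivity⟩
  have hww : ∫ x in X, w x ^ 2 = N := by
    have e1 : ∀ k, ∫ x in X, ψ k x * w x = if k < M + 1 then c k else 0 := by
      intro k
      simp only [hw, Finset.mul_sum]
      rw [integral_finsetSum _ fun l _ => memLp_ofLp_mul (hψ k) ((hψ l).const_mul _)]
      simp only [mul_left_comm _ (c _), integral_const_mul, hK.isMercerKernel.orthonormal]
      simp
    have e2 : ∀ x, w x ^ 2 = ∑ k ∈ Finset.range (M + 1), c k * (ψ k x * w x) := by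
      intro x
      calc w x ^ 2 = (∑ k ∈ Finset.range (M + 1), c k * ψ k x) * w x := sq _
        _ = _ := by simp only [Finset.sum_mul, mul_assoc]
    simp only [e2]
    rw [integral_finsetSum _ fun l _ => (memLp_ofLp_mul (hψ l) hwm).const_mul _]
    simp only [integral_const_mul, e1]
    refine Finset.sum_congr rfl fun k hk => ?_
    rw [if_pos (Finset.mem_range.1 hk), sq]
  obtain ⟨G, hG, hGn⟩ := h₂ M hpos c
  obtain ⟨F, hF, hFw, hFn⟩ := hc₀ w hG.memSobolev
  have hFf := hF.isSobolevFamily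
  have htrig : ∀ k : Fin n → ℤ, (∀ i, |k i| < p) → ∫ x in X, (w x : ℂ) * trigProd T k x = 0 := by
    intro k hk
    have hkl : k ∈ low := Fintype.mem_piFinset.2 fun i => Finset.mem_Ioo.2 (abs_lt.1 (hk i))
    rw [← hc ⟨k, hkl⟩]
    have hint : ∀ l, Integrable (fun x => (ψ l x : ℂ) * trigProd T k x) (volume.restrict X) := by
      intro l
      have : IsFiniteMeasure ((volume : Measure (Fin n → ℝ)).restrict X) :=
        ⟨by simpa using hX.isCompact.measure_lt_top⟩
      obtain ⟨B, hB⟩ := hX.isCompact.exists_bound_of_continuousOn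
        (continuous_trigProd T k).continuousOn
      refine memLp_ofLp_mul (hψ l).ofReal (MemLp.of_bound
        (continuous_trigProd T k).aestronglyMeasurable B ?_)
      exact (ae_restrict_iff' hX.isCompact.isClosed.measurableSet).2 (Eventually.of_forall hB)
    have e : ∀ x, (w x : ℂ) * trigProd T k x
        = ∑ l ∈ Finset.range (M + 1), (c l : ℂ) * ((ψ l x : ℂ) * trigProd T k x) := by
      intro x
      simp only [hw, Complex.ofReal_sum, Complex.ofReal_mul, Finset.sum_mul, mul_assoc]
    simp only [e]
    rw [integral_finsetSum _ fun l _ => (hint l).const_mul _]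
    simp only [integral_const_mul]
  -- The extension `F` agrees with `w` on `X`, so the pairing on the left is `‖w‖² = N`.
  have key := h₁ p hp F _ hFf w hwm htrig
  have eF : ∫ x in X, F x * w x = N := by
    rw [← hww]
    refine integral_congr_ae ?_
    filter_upwards [hFw] with x hx
    rw [hx, sq]
  have eS := hFf.sobolevNorm_sq isOpen_univ
  have eS' := hG.sobolevNorm_sq isOpen_interior
  rw [Measure.restrict_univ] at eS
  have hFn2 : sobolevNorm (stdVec n) α Set.univ F ^ 2
      ≤ c₀ ^ 2 * (C₂ * (eig M)⁻¹ * N) := by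
    calc _ ≤ (c₀ * sobolevNorm (stdVec n) α (interior X) w) ^ 2 :=
          pow_le_pow_left₀ (Real.sqrt_nonneg _) hFn 2
      _ = c₀ ^ 2 * sobolevNorm (stdVec n) α (interior X) w ^ 2 := mul_pow _ _ _
      _ ≤ _ := by
          rw [eS']
          exact mul_le_mul_of_nonneg_left hGn (sq_nonneg _)
  rw [eF, hww, ← eS] at key
  have h3 : N ^ 2 ≤ C₁ * ((p : ℝ) ^ (2 * α))⁻¹ * (c₀ ^ 2 * (C₂ * (eig M)⁻¹ * N)) * N :=
    key.trans (mul_le_mul_of_nonneg_right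
      (mul_le_mul_of_nonneg_left hFn2 (by positivity)) hNpos.le)
  have h4 : N ^ 2 * eig M ≤ N ^ 2 * (C₁ * (c₀ ^ 2 * C₂) * ((p : ℝ) ^ (2 * α))⁻¹) := by
    calc N ^ 2 * eig M ≤ C₁ * ((p : ℝ) ^ (2 * α))⁻¹ * (c₀ ^ 2 * (C₂ * (eig M)⁻¹ * N)) * N * eig M :=
          mul_le_mul_of_nonneg_right h3 hpos.le
      _ = N ^ 2 * (C₁ * (c₀ ^ 2 * C₂) * ((p : ℝ) ^ (2 * α))⁻¹) * ((eig M)⁻¹ * eig M) := by ring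
      _ = _ := by rw [inv_mul_cancel₀ hpos.ne', mul_one]
  exact le_of_mul_le_mul_left h4 (by positivity)

/-- The eigenvalues of a kernel which generates `W₂^α` in dimension `n` decay like
`k ^ (-2α / n)`. -/
theorem exists_eig_le (hn : 1 ≤ n) : ∃ C > 0, ∀ m : ℕ, 1 ≤ m →
    eig (m ^ n) ≤ C * ((m : ℝ) ^ (2 * α))⁻¹ := by
  obtain ⟨C, hC, h⟩ := exists_eig_mul_le hX hK
  have h0 := hK.isMercerKernel.eig_nonneg 0
  refine ⟨C * 8 ^ (2 * α) + eig 0 + 1, by positivity, fun m hm => ?_⟩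
  -- The frequency cutoff below is `p = (m + 2) / 4`, which is zero for `m = 1`; that case is
  -- covered by the summand `eig 0` of the constant.
  rcases hm.eq_or_lt with rfl | hm
  · have := hK.isMercerKernel.eig_antitone (Nat.zero_le (1 ^ n))
    have h8 : 0 ≤ C * 8 ^ (2 * α) := by positivity
    simp only [Nat.cast_one, one_pow, inv_one, mul_one] at this ⊢
    linarith
  have hm0 : (0 : ℝ) < m := by exact_mod_cast (by omega : 0 < m)
  have hp1 : 1 ≤ (m + 2) / 4 := by omega
  -- This `p` satisfies `2 (2p - 1) ≤ m`, so the constraints number at most `m ^ n`, and `p ≥ m / 8`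
  -- loses only the factor `8 ^ (2α)`.
  have hcount : 2 * (2 * ((m + 2) / 4) - 1) ^ n < m ^ n + 1 := by
    calc 2 * (2 * ((m + 2) / 4) - 1) ^ n ≤ 2 ^ n * (2 * ((m + 2) / 4) - 1) ^ n :=
          Nat.mul_le_mul_right _ (Nat.le_self_pow (by omega) 2)
      _ = (2 * (2 * ((m + 2) / 4) - 1)) ^ n := (mul_pow _ _ _).symm
      _ ≤ m ^ n := Nat.pow_le_pow_left (by omega) n
      _ < m ^ n + 1 := Nat.lt_succ_self _
  refine (h _ _ hp1 hcount).trans ?_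
  have hp8 : (m : ℝ) / 8 ≤ ((m + 2) / 4 : ℕ) := by
    rw [div_le_iff₀ (by norm_num)]
    exact_mod_cast (by omega : m ≤ (m + 2) / 4 * 8)
  calc C * ((((m + 2) / 4 : ℕ) : ℝ) ^ (2 * α))⁻¹ ≤ C * (((m : ℝ) / 8) ^ (2 * α))⁻¹ := by
        gcongr
    _ = C * 8 ^ (2 * α) * ((m : ℝ) ^ (2 * α))⁻¹ := by
        rw [div_pow, inv_div]; ring
    _ ≤ _ := by
        refine mul_le_mul_of_nonneg_right ?_ (by positivity)
        linarith

/-- The `L₂` error of truncating the expansion of a Sobolev function. -/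
theorem exists_sum_coeff_tail_le (hn : 1 ≤ n) : ∃ C > 0, ∀ m : ℕ, 1 ≤ m →
    ∀ (g : (Fin n → ℝ) → ℝ) (G : (Fin n → ℕ) → (Fin n → ℝ) → ℝ),
    IsSobolevFamily (stdVec n) α (interior X) g G →
    ∀ s : Finset ℕ, (∀ k ∈ s, m ^ n ≤ k) →
      ∑ k ∈ s, (∫ x in interior X, g x * ψ k x) ^ 2
        ≤ C * ((m : ℝ) ^ (2 * α))⁻¹ * ∑ β ∈ multiIdx (Fin n) α, ∫ x in interior X, G β x ^ 2 := by
  obtain ⟨C₁, hC₁, h₁⟩ := exists_sum_coeff_sq_le hX hK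
  obtain ⟨C₂, hC₂, h₂⟩ := exists_eig_le hX hK hn
  refine ⟨C₁ * C₂, by positivity, fun m hm g G hG s hs => (h₁ g G hG _ s hs).trans ?_⟩
  refine mul_le_mul_of_nonneg_right ?_
    (Finset.sum_nonneg fun β _ => integral_nonneg fun x => sq_nonneg _)
  rw [mul_assoc]
  exact mul_le_mul_of_nonneg_left (h₂ m hm) hC₁.le

end EigenvalueDecay

/-! ### Tensor products of functions of the blocks -/

section TensorMap

variable {s : ℕ} {d : Fin s → ℕ} (O : ∀ i, Set (Fin (d i) → ℝ)) (j : Fin s)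

theorem measurePreserving_splitAt_restrict :
    MeasurePreserving (splitAt j) (volume.restrict (Set.pi Set.univ O))
      ((volume.restrict (O j)).prod
        (volume.restrict (Set.pi Set.univ fun i : {i // i ≠ j} => O i))) := by
  rw [restrict_univ_pi, restrict_univ_pi]
  exact measurePreserving_splitAt (fun i => (volume : Measure (Fin (d i) → ℝ)).restrict (O i)) j

variable {O j}

/-- Makes the tensor product of almost everywhere classes bilinear: a null set of one block lifts to
a null set of the product. -/
theorem ae_left_block {P : (Fin (d j) → ℝ) → Prop} (h : ∀ᵐ t ∂volume.restrict (O j), P t) :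
    ∀ᵐ x ∂volume.restrict (Set.pi Set.univ O), P (x j) :=
  (Measure.quasiMeasurePreserving_fst.comp
    (measurePreserving_splitAt_restrict O j).quasiMeasurePreserving).ae h

theorem ae_right_block {P : (∀ i : {i // i ≠ j}, Fin (d i) → ℝ) → Prop}
    (h : ∀ᵐ y ∂volume.restrict (Set.pi Set.univ fun i : {i // i ≠ j} => O i), P y) :
    ∀ᵐ x ∂volume.restrict (Set.pi Set.univ O), P fun i => x i.1 :=
  (Measure.quasiMeasurePreserving_snd.comp
    (measurePreserving_splitAt_restrict O j).quasiMeasurePreserving).ae h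

theorem memLp_blockMul {u : (Fin (d j) → ℝ) → ℝ} (hu : MemLp u 2 (volume.restrict (O j)))
    {v : (∀ i : {i // i ≠ j}, Fin (d i) → ℝ) → ℝ}
    (hv : MemLp v 2 (volume.restrict (Set.pi Set.univ fun i : {i // i ≠ j} => O i))) :
    MemLp (blockMul j u v) 2 (volume.restrict (Set.pi Set.univ O)) :=
  (memLp_two_mul_prod hu hv).comp_measurePreserving (measurePreserving_splitAt_restrict O j)

variable (O j)

/-- The tensor product of functions of the block `j` and of the other blocks. -/
def tensorMap : Lp ℝ 2 ((volume : Measure (Fin (d j) → ℝ)).restrict (O j)) →ₗ[ℝ]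
    Lp ℝ 2 ((volume : Measure (∀ i : {i // i ≠ j}, Fin (d i) → ℝ)).restrict
      (Set.pi Set.univ fun i : {i // i ≠ j} => O i)) →ₗ[ℝ]
    Lp ℝ 2 ((volume : Measure (∀ i, Fin (d i) → ℝ)).restrict (Set.pi Set.univ O)) :=
  LinearMap.mk₂ ℝ (fun u v => (memLp_blockMul (Lp.memLp u) (Lp.memLp v)).toLp (blockMul j u v))
    (fun u u' v => by
      rw [← MemLp.toLp_add, MemLp.toLp_eq_toLp_iff]
      filter_upwards [ae_left_block (Lp.coeFn_add u u')] with x hx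
      simp only [blockMul, Pi.add_apply] at hx ⊢
      rw [hx, add_mul])
    (fun c u v => by
      rw [← MemLp.toLp_const_smul, MemLp.toLp_eq_toLp_iff]
      filter_upwards [ae_left_block (Lp.coeFn_smul c u)] with x hx
      simp only [blockMul, Pi.smul_apply, smul_eq_mul] at hx ⊢
      rw [hx, mul_assoc])
    (fun u v v' => by
      rw [← MemLp.toLp_add, MemLp.toLp_eq_toLp_iff]
      filter_upwards [ae_right_block (Lp.coeFn_add v v')] with x hx
      simp only [blockMul, Pi.add_apply] at hx ⊢
      rw [hx, mul_add])
    (fun c u v => by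
      rw [← MemLp.toLp_const_smul, MemLp.toLp_eq_toLp_iff]
      filter_upwards [ae_right_block (Lp.coeFn_smul c v)] with x hx
      simp only [blockMul, Pi.smul_apply, smul_eq_mul] at hx ⊢
      rw [hx, mul_left_comm])

variable {O j}

theorem tensorMap_toLp {u : (Fin (d j) → ℝ) → ℝ} (hu : MemLp u 2 (volume.restrict (O j)))
    {v : (∀ i : {i // i ≠ j}, Fin (d i) → ℝ) → ℝ}
    (hv : MemLp v 2 (volume.restrict (Set.pi Set.univ fun i : {i // i ≠ j} => O i))) :
    tensorMap O j (hu.toLp u) (hv.toLp v) = (memLp_blockMul hu hv).toLp (blockMul j u v) := by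
  rw [tensorMap, LinearMap.mk₂_apply, MemLp.toLp_eq_toLp_iff]
  filter_upwards [ae_left_block hu.coeFn_toLp, ae_right_block hv.coeFn_toLp] with x h1 h2
  simp only [blockMul] at h1 h2 ⊢
  rw [h1, h2]

theorem inner_tensorMap
    (u u' : Lp ℝ 2 ((volume : Measure (Fin (d j) → ℝ)).restrict (O j)))
    (v v' : Lp ℝ 2 ((volume : Measure (∀ i : {i // i ≠ j}, Fin (d i) → ℝ)).restrict
      (Set.pi Set.univ fun i : {i // i ≠ j} => O i))) :
    inner ℝ (tensorMap O j u v) (tensorMap O j u' v') = inner ℝ u u' * inner ℝ v v' := by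
  have e1 := real_inner_toLp (Lp.memLp u) (Lp.memLp u')
  have e2 := real_inner_toLp (Lp.memLp v) (Lp.memLp v')
  rw [Lp.toLp_coeFn, Lp.toLp_coeFn] at e1 e2
  rw [tensorMap, LinearMap.mk₂_apply, LinearMap.mk₂_apply, real_inner_toLp, e1, e2,
    ← integral_prod_mul, ← integral_prod_splitAt (j := j)]
  refine integral_congr_ae (Eventually.of_forall fun p => ?_)
  simp only [blockMul, splitAt_symm_self, splitAt_symm_ne]
  ring

theorem norm_tensorMap (u : Lp ℝ 2 ((volume : Measure (Fin (d j) → ℝ)).restrict (O j)))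
    (v : Lp ℝ 2 ((volume : Measure (∀ i : {i // i ≠ j}, Fin (d i) → ℝ)).restrict
      (Set.pi Set.univ fun i : {i // i ≠ j} => O i))) :
    ‖tensorMap O j u v‖ = ‖u‖ * ‖v‖ := by
  have h := inner_tensorMap u u v v
  rw [real_inner_self_eq_norm_sq, real_inner_self_eq_norm_sq, real_inner_self_eq_norm_sq,
    ← mul_pow] at h
  exact (sq_eq_sq₀ (norm_nonneg _) (by positivity)).1 h

end TensorMap

/-! ### Products of complete orthonormal systems -/

section ProductBasis

/-- `ψ` is a complete orthonormal system of `L₂(O)`. -/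
structure IsCompleteSystem {V : Type*} [MeasureSpace V] (O : Set V) (ψ : ℕ → V → ℝ) : Prop where
  memLp : ∀ k, MemLp (ψ k) 2 (volume.restrict O)
  orthonormal : ∀ k l, ∫ x in O, ψ k x * ψ l x = if k = l then 1 else 0
  complete : ∀ f : V → ℝ, MemLp f 2 (volume.restrict O) → (∀ k, ∫ x in O, f x * ψ k x = 0) →
    f =ᵐ[volume.restrict O] 0

/-- Products of functions of the blocks. -/
def prodFun {ι : Type*} [Fintype ι] {Y : ι → Type*} (φ : ∀ i, ℕ → Y i → ℝ) (μ : ι → ℕ)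
    (x : ∀ i, Y i) : ℝ := ∏ i, φ i (μ i) (x i)

variable {ι : Type*} [Fintype ι] {Y : ι → Type*} [∀ i, MeasureSpace (Y i)]
  [∀ i, SigmaFinite (volume : Measure (Y i))] {O : ∀ i, Set (Y i)} {φ : ∀ i, ℕ → Y i → ℝ}
  (h : ∀ i, IsCompleteSystem (O i) (φ i))
include h

theorem memLp_prodFun (μ : ι → ℕ) :
    MemLp (prodFun φ μ) 2 (volume.restrict (Set.pi Set.univ O)) := by
  rw [restrict_univ_pi]
  exact memLp_two_prod_apply fun i => (h i).memLp (μ i)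

theorem integral_prodFun_mul_prodFun [∀ i, IsFiniteMeasure ((volume : Measure (Y i)).restrict (O i))]
    (μ ν : ι → ℕ) :
    ∫ x in Set.pi Set.univ O, prodFun φ μ x * prodFun φ ν x = if μ = ν then 1 else 0 := by
  classical
  rw [restrict_univ_pi]
  have := integral_prod_mul_prod (μ := fun i => (volume : Measure (Y i)).restrict (O i))
    (ψ := φ) (χ := φ) (fun i => (h i).orthonormal) μ ν
  simpa only [prodFun] using this

/-- The basis of products. -/
def prodBasis [∀ i, IsFiniteMeasure ((volume : Measure (Y i)).restrict (O i))] :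
    HilbertBasis (ι → ℕ) ℝ (Lp ℝ 2 ((volume : Measure (∀ i, Y i)).restrict (Set.pi Set.univ O))) :=
  hilbertBasisOfComplete (prodFun φ) (memLp_prodFun h)
    (fun μ ν => by simpa [eq_comm] using integral_prodFun_mul_prodFun h ν μ)
    (fun g hg h0 => by
      classical
      rw [restrict_univ_pi] at *
      refine ae_eq_zero_of_integral_mul_prod_eq_zero (ψ := φ) (fun i k => (h i).memLp k)
        (fun i g hg h0 => (h i).complete g hg h0) hg fun k => ?_
      simpa [prodFun] using h0 k)

theorem prodBasis_apply [∀ i, IsFiniteMeasure ((volume : Measure (Y i)).restrict (O i))]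
    (μ : ι → ℕ) : prodBasis h μ = (memLp_prodFun h μ).toLp (prodFun φ μ) :=
  hilbertBasisOfComplete_apply _ _ _ _ μ

end ProductBasis

/-! ### Truncation of product expansions -/

section Truncation

theorem norm_sum_inner_smul_le {H κ : Type*} [NormedAddCommGroup H] [InnerProductSpace ℝ H]
    [Fintype κ] {e : κ → H} (he : Orthonormal ℝ e) (u : H) :
    ‖∑ k, inner ℝ (e k) u • e k‖ ≤ ‖u‖ := by
  rw [norm_sum_smul_of_orthonormal he]
  exact norm_toLp_inner_le_of_orthonormal he u

variable {s : ℕ} {d : Fin s → ℕ} {O : ∀ i, Set (Fin (d i) → ℝ)} {φ : ∀ i, ℕ → (Fin (d i) → ℝ) → ℝ}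

theorem prodFun_eq_blockMul (j : Fin s) (μ : Fin s → ℕ) :
    prodFun φ μ = blockMul j (φ j (μ j))
      (prodFun (fun i : {i // i ≠ j} => φ i) fun i : {i // i ≠ j} => μ i) := by
  ext x
  exact Fintype.prod_eq_mul_prod_subtype_ne (fun i => φ i (μ i) (x i)) j

variable (h : ∀ i, IsCompleteSystem (O i) (φ i))
  [∀ i, IsFiniteMeasure ((volume : Measure (Fin (d i) → ℝ)).restrict (O i))]
include h

/-- The indices are sorted by a block `j` with `N j ≤ μ j`. For fixed indices `c` of the other
blocks, the coefficients are those of the partial pairing of `f` with the product function `w c`, a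
Sobolev function of `x_j` to which the one-block tail bound applies. Summing over `c` is controlled
by Bessel, and summing over `j` gives `∑ j, C j`. -/
theorem sum_integral_prodFun_sq_le (hO : ∀ i, IsOpen (O i)) {α : ℕ} {N : Fin s → ℕ} {C : Fin s → ℝ}
    (hC : ∀ j, 0 ≤ C j)
    (htail : ∀ j (g : (Fin (d j) → ℝ) → ℝ) (G : (Fin (d j) → ℕ) → (Fin (d j) → ℝ) → ℝ),
      IsSobolevFamily (stdVec (d j)) α (O j) g G → ∀ S : Finset ℕ, (∀ k ∈ S, N j ≤ k) →
        ∑ k ∈ S, (∫ x in O j, g x * φ j k x) ^ 2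
          ≤ C j * ∑ β ∈ multiIdx (Fin (d j)) α, ∫ x in O j, G β x ^ 2)
    {f : (∀ i, Fin (d i) → ℝ) → ℝ} {F : ((Σ i, Fin (d i)) → ℕ) → (∀ i, Fin (d i) → ℝ) → ℝ}
    (hf : IsSobolevFamily (prodVec d) α (Set.pi Set.univ O) f F) (S : Finset (Fin s → ℕ))
    (hS : ∀ μ ∈ S, ∃ j, N j ≤ μ j) :
    ∑ μ ∈ S, (∫ x in Set.pi Set.univ O, f x * prodFun φ μ x) ^ 2
      ≤ (∑ j, C j) * ∑ γ ∈ multiIdx (Σ i, Fin (d i)) α, ∫ x in Set.pi Set.univ O, F γ x ^ 2 := by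
  set a : (Fin s → ℕ) → ℝ := fun μ => (∫ x in Set.pi Set.univ O, f x * prodFun φ μ x) ^ 2 with ha
  have ha0 : ∀ μ, 0 ≤ a μ := fun μ => sq_nonneg _
  have hblock : ∀ j, ∑ μ ∈ S with N j ≤ μ j, a μ
      ≤ C j * ∑ γ ∈ multiIdx (Σ i, Fin (d i)) α, ∫ x in Set.pi Set.univ O, F γ x ^ 2 := by
    intro j
    set w : ({i // i ≠ j} → ℕ) → (∀ i : {i // i ≠ j}, Fin (d i) → ℝ) → ℝ :=
      prodFun fun i : {i // i ≠ j} => φ i with hw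
    have hwm : ∀ c, MemLp (w c) 2
        (volume.restrict (Set.pi Set.univ fun i : {i // i ≠ j} => O i)) := fun c =>
      memLp_prodFun (fun i : {i // i ≠ j} => h i) c
    set b : ℕ → ({i // i ≠ j} → ℕ) → ℝ := fun k c =>
      (∫ t in O j, blockMarginal O j f (w c) t * φ j k t) ^ 2 with hb
    have hab : ∀ μ, a μ = b (μ j) fun i => μ i.1 := by
      intro μ
      simp only [ha, hb]
      rw [integral_blockMarginal_mul hf.memLp (hwm _) ((h j).memLp _), prodFun_eq_blockMul j μ]
    set S' := S.filter fun μ => N j ≤ μ j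
    calc ∑ μ ∈ S', a μ
        = ∑ q ∈ S'.image (Equiv.piSplitAt j fun _ => ℕ), b q.1 q.2 := by
          rw [Finset.sum_image (Equiv.injective _).injOn]
          exact Finset.sum_congr rfl fun μ _ => hab μ
      -- Enlarging the index set to a product separates the sum over block `j` from the sum over the
      -- others; the index in block `j` remains at least `N j`.
      _ ≤ ∑ q ∈ (S'.image fun μ => μ j) ×ˢ (S'.image fun μ (i : {i // i ≠ j}) => μ i.1),
            b q.1 q.2 := by
          refine Finset.sum_le_sum_of_subset_of_nonneg ?_ fun q _ _ => sq_nonneg _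
          intro q hq
          obtain ⟨μ, hμ, rfl⟩ := Finset.mem_image.1 hq
          exact Finset.mem_product.2 ⟨Finset.mem_image_of_mem _ hμ, Finset.mem_image_of_mem _ hμ⟩
      _ = ∑ c ∈ S'.image fun μ (i : {i // i ≠ j}) => μ i.1, ∑ k ∈ S'.image fun μ => μ j, b k c :=
          Finset.sum_product_right _ _ _
      _ ≤ ∑ c ∈ S'.image fun μ (i : {i // i ≠ j}) => μ i.1,
            C j * ∑ β ∈ multiIdx (Fin (d j)) α,
              ∫ t in O j, blockMarginal O j (F (blockIdx d j β)) (w c) t ^ 2 := by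
          refine Finset.sum_le_sum fun c _ => htail j _ _ (hf.blockMarginal hO (hwm c)) _ ?_
          intro k hk
          obtain ⟨μ, hμ, rfl⟩ := Finset.mem_image.1 hk
          exact (Finset.mem_filter.1 hμ).2
      _ ≤ _ := by
          rw [← Finset.mul_sum]
          refine mul_le_mul_of_nonneg_left (sum_sobolev_blockMarginal_le hf hwm
            (fun c c' => ?_) _) (hC j)
          exact integral_prodFun_mul_prodFun (fun i : {i // i ≠ j} => h i) c c'
  calc ∑ μ ∈ S, a μ ≤ ∑ μ ∈ S, ∑ j, if N j ≤ μ j then a μ else 0 := by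
        refine Finset.sum_le_sum fun μ hμ => ?_
        obtain ⟨j, hj⟩ := hS μ hμ
        refine le_trans (by rw [if_pos hj])
          (Finset.single_le_sum (f := fun j => if N j ≤ μ j then a μ else 0) (fun j _ => ?_)
            (Finset.mem_univ j))
        split_ifs
        exacts [ha0 μ, le_rfl]
    _ = ∑ j, ∑ μ ∈ S with N j ≤ μ j, a μ := by
        rw [Finset.sum_comm]
        exact Finset.sum_congr rfl fun j _ => (Finset.sum_filter _ _).symm
    _ ≤ ∑ j, C j * ∑ γ ∈ multiIdx (Σ i, Fin (d i)) α, ∫ x in Set.pi Set.univ O, F γ x ^ 2 :=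
        Finset.sum_le_sum fun j _ => hblock j
    _ = _ := (Finset.sum_mul _ _ _).symm

omit [∀ i, IsFiniteMeasure ((volume : Measure (Fin (d i) → ℝ)).restrict (O i))] in
/-- The leading basis functions of a block as vectors of `L₂`. -/
theorem orthonormal_block (j : Fin s) (N : ℕ) :
    Orthonormal ℝ fun k : Fin N => ((h j).memLp k).toLp (φ j k) :=
  real_orthonormal_toLp (fun k : Fin N => (h j).memLp k)
    fun k l => by simp [(h j).orthonormal, Fin.val_inj]

theorem orthonormal_others (j : Fin s) (N : Fin s → ℕ) :
    Orthonormal ℝ fun c : ∀ i : {i // i ≠ j}, Fin (N i) =>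
      (memLp_prodFun (fun i : {i // i ≠ j} => h i) fun i => (c i : ℕ)).toLp
        (prodFun (fun i : {i // i ≠ j} => φ i) fun i => (c i : ℕ)) :=
  real_orthonormal_toLp
    (fun c : ∀ i : {i // i ≠ j}, Fin (N i) =>
      memLp_prodFun (fun i : {i // i ≠ j} => h i) fun i => (c i : ℕ))
    fun c c' => by
      rw [integral_prodFun_mul_prodFun (fun i : {i // i ≠ j} => h i)]
      simp [funext_iff, Fin.val_inj]

/-- Replacing the factors of a tensor product by their projections. -/
theorem abs_inner_tensorMap_sub_le {N : Fin s → ℕ} {B : ℝ}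
    {x : Lp ℝ 2 ((volume : Measure (∀ i, Fin (d i) → ℝ)).restrict (Set.pi Set.univ O))}
    (hB : ∀ S : Finset (Fin s → ℕ), (∀ μ ∈ S, ∃ j, N j ≤ μ j) →
      ∑ μ ∈ S, ‖inner ℝ (prodBasis h μ) x‖ ^ 2 ≤ B) (j : Fin s)
    (u : Lp ℝ 2 ((volume : Measure (Fin (d j) → ℝ)).restrict (O j)))
    (v : Lp ℝ 2 ((volume : Measure (∀ i : {i // i ≠ j}, Fin (d i) → ℝ)).restrict
      (Set.pi Set.univ fun i : {i // i ≠ j} => O i))) :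
    |inner ℝ x (tensorMap O j u v) - inner ℝ x (tensorMap O j
        (∑ k : Fin (N j), inner ℝ (((h j).memLp k).toLp (φ j k)) u • ((h j).memLp k).toLp (φ j k))
        (∑ c : ∀ i : {i // i ≠ j}, Fin (N i),
          inner ℝ ((memLp_prodFun (fun i : {i // i ≠ j} => h i) fun i => (c i : ℕ)).toLp
            (prodFun (fun i : {i // i ≠ j} => φ i) fun i => (c i : ℕ))) v •
          (memLp_prodFun (fun i : {i // i ≠ j} => h i) fun i => (c i : ℕ)).toLp
            (prodFun (fun i : {i // i ≠ j} => φ i) fun i => (c i : ℕ))))|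
      ≤ 2 * √B * (‖u‖ * ‖v‖) := by
  have he := orthonormal_block h j (N j)
  have hg := orthonormal_others h j N
  set e := fun k : Fin (N j) => ((h j).memLp k).toLp (φ j k)
  set g := fun c : ∀ i : {i // i ≠ j}, Fin (N i) =>
      (memLp_prodFun (fun i : {i // i ≠ j} => h i) fun i => (c i : ℕ)).toLp
        (prodFun (fun i : {i // i ≠ j} => φ i) fun i => (c i : ℕ))
  change |inner ℝ x (tensorMap O j u v) - inner ℝ x (tensorMap O j
    (∑ k, inner ℝ (e k) u • e k) (∑ c, inner ℝ (g c) v • g c))| ≤ _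
  set u' := ∑ k, inner ℝ (e k) u • e k with hu'
  set v' := ∑ c, inner ℝ (g c) v • g c with hv'
  have hB0 : 0 ≤ B := by simpa using hB ∅ (by simp)
  set y := tensorMap O j u v - tensorMap O j u' v'
  -- Projecting the factors leaves all coefficients inside the box unchanged, so the error `y` lives
  -- on the discarded indices, where the coefficients of `x` are small.
  have hlow : ∀ μ : Fin s → ℕ, μ ∈ {μ : Fin s → ℕ | ∀ i, μ i < N i} →
      inner ℝ (prodBasis h μ) y = 0 := by
    intro μ hμ
    have h1 : prodBasis h μ = tensorMap O j (e ⟨μ j, hμ j⟩) (g fun i => ⟨μ i, hμ i⟩) := by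
      rw [prodBasis_apply]
      simp only [e, g]
      rw [tensorMap_toLp]
      congr 1
      exact prodFun_eq_blockMul j μ
    rw [h1, inner_sub_right, inner_tensorMap, inner_tensorMap, hu', hv',
      he.inner_right_fintype, hg.inner_right_fintype, sub_self]
  have hy : ‖y‖ ≤ 2 * (‖u‖ * ‖v‖) := by
    calc ‖y‖ ≤ ‖tensorMap O j u v‖ + ‖tensorMap O j u' v'‖ := norm_sub_le _ _
      _ = ‖u‖ * ‖v‖ + ‖u'‖ * ‖v'‖ := by rw [norm_tensorMap, norm_tensorMap]
      _ ≤ ‖u‖ * ‖v‖ + ‖u‖ * ‖v‖ := by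
          gcongr
          exacts [norm_sum_inner_smul_le he u, norm_sum_inner_smul_le hg v]
      _ = _ := by ring
  have key := norm_inner_sq_le_of_tail (prodBasis h) (x := x) (y := y)
    (low := {μ : Fin s → ℕ | ∀ i, μ i < N i}) (B := B)
    (fun S hS => hB S fun μ hμ => by simpa using hS μ hμ) hlow
  rw [← inner_sub_right, ← Real.norm_eq_abs]
  calc ‖inner ℝ x y‖ ≤ √B * ‖y‖ := by
        refine abs_le_of_sq_le_sq' ?_ (by positivity) |>.2
        rwa [mul_pow, Real.sq_sqrt hB0]
    _ ≤ √B * (2 * (‖u‖ * ‖v‖)) := mul_le_mul_of_nonneg_left hy (Real.sqrt_nonneg _)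
    _ = _ := by ring

end Truncation

/-! ### The reshaped intensity and its matrix of coefficients -/

section Reshaping

theorem coeFn_sum_smul_toLp {Y : Type*} [MeasurableSpace Y] {μ : Measure Y} {g : ℕ → Y → ℝ}
    (hg : ∀ k, MemLp (g k) 2 μ) (c : ℕ → ℝ) (N : ℕ) :
    ⇑(∑ k ∈ Finset.range N, c k • (hg k).toLp (g k))
      =ᵐ[μ] fun x => ∑ k ∈ Finset.range N, c k * g k x := by
  induction N with
  | zero =>
    simp only [Finset.range_zero, Finset.sum_empty]
    exact Lp.coeFn_zero ℝ 2 μ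
  | succ N ih =>
    rw [Finset.sum_range_succ]
    filter_upwards [Lp.coeFn_add (∑ k ∈ Finset.range N, c k • (hg k).toLp (g k))
      (c N • (hg N).toLp (g N)), ih, Lp.coeFn_smul (c N) ((hg N).toLp (g N)), (hg N).coeFn_toLp]
      with x h1 h2 h3 h4
    rw [h1, Pi.add_apply, h2, h3, Pi.smul_apply, h4, smul_eq_mul, Finset.sum_range_succ]

theorem tendsto_sum_smul_toLp {Y : Type*} [MeasurableSpace Y] {μ : Measure Y} {g : ℕ → Y → ℝ}
    (hg : ∀ k, MemLp (g k) 2 μ) {c : ℕ → ℝ} {f : Y → ℝ} (hf : MemLp f 2 μ)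
    (h : Tendsto (fun N : ℕ => eLpNorm (fun x => f x - ∑ k ∈ Finset.range N, c k * g k x) 2 μ)
      atTop (𝓝 0)) :
    Tendsto (fun N => ∑ k ∈ Finset.range N, c k • (hg k).toLp (g k)) atTop (𝓝 (hf.toLp f)) := by
  rw [Lp.tendsto_Lp_iff_tendsto_eLpNorm']
  refine h.congr fun N => ?_
  rw [← eLpNorm_neg]
  refine eLpNorm_congr_ae ?_
  filter_upwards [coeFn_sum_smul_toLp hg c N, hf.coeFn_toLp] with x h4 h5
  rw [Pi.sub_apply, h4, h5, Pi.neg_apply, neg_sub]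

theorem restrict_univ_pi_congr {ι : Type*} [Fintype ι] {Y : ι → Type*} [∀ i, MeasureSpace (Y i)]
    [∀ i, SigmaFinite (volume : Measure (Y i))] {O X : ∀ i, Set (Y i)}
    (h : ∀ i, (volume : Measure (Y i)).restrict (O i) = volume.restrict (X i)) :
    (volume : Measure (∀ i, Y i)).restrict (Set.pi Set.univ O)
      = volume.restrict (Set.pi Set.univ X) := by
  rw [restrict_univ_pi, restrict_univ_pi]
  simp only [h]

variable {s : ℕ} {d : Fin s → ℕ} {O X : ∀ i, Set (Fin (d i) → ℝ)}
  (hOX : ∀ i, (volume : Measure (Fin (d i) → ℝ)).restrict (O i) = volume.restrict (X i))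
  {f : (∀ i, Fin (d i) → ℝ) → ℝ} {j : Fin s} {σ : ℕ → ℝ} {Φ : ℕ → (Fin (d j) → ℝ) → ℝ}
  {Ψ : ℕ → (∀ i : {i // i ≠ j}, Fin (d i) → ℝ) → ℝ}
include hOX

/-- Sobolev regularity lives on the interiors and the singular value decomposition on the closed
domains; equality of the restricted measures transports the latter. -/
theorem IsFunctionSVD.exists_isTensorExpansion (h : IsFunctionSVD X f j σ Φ Ψ)
    (hf : MemLp f 2 (volume.restrict (Set.pi Set.univ O))) :
    ∃ (Φ' : ℕ → Lp ℝ 2 (volume.restrict (O j)))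
      (Ψ' : ℕ → Lp ℝ 2 (volume.restrict (Set.pi Set.univ fun i : {i // i ≠ j} => O i))),
      IsTensorExpansion (tensorMap O j) (hf.toLp f) σ Φ' Ψ' := by
  have hOX' := restrict_univ_pi_congr fun i : {i // i ≠ j} => hOX i
  have hOXp := restrict_univ_pi_congr hOX
  have hΦ : ∀ k, MemLp (Φ k) 2 (volume.restrict (O j)) := fun k => by
    rw [hOX]; exact h.memLp_left k
  have hΨ : ∀ k, MemLp (Ψ k) 2
      (volume.restrict (Set.pi Set.univ fun i : {i // i ≠ j} => O i)) := fun k => by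
    rw [hOX']; exact h.memLp_right k
  refine ⟨fun k => (hΦ k).toLp (Φ k), fun k => (hΨ k).toLp (Ψ k),
    fun u v u' v' => inner_tensorMap u u' v v', h.nonneg,
    h.antitone, real_orthonormal_toLp hΦ fun k l => ?_, real_orthonormal_toLp hΨ fun k l => ?_, ?_⟩
  · rw [hOX]; exact h.orthonormal_left k l
  · rw [hOX']; exact h.orthonormal_right k l
  · simp only [tensorMap_toLp]
    refine tendsto_sum_smul_toLp _ hf ?_
    have h1 := h.expansion
    rw [prodDomain, ← hOXp] at h1
    simpa only [blockMul, mul_assoc] using h1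

variable {φ : ∀ i, ℕ → (Fin (d i) → ℝ) → ℝ} (h : ∀ i, IsCompleteSystem (O i) (φ i))

/-- Exhibits the coefficient matrix as a compression of the reshaped intensity, which brings it
within reach of Weyl's inequalities. -/
theorem matricize_coeffTensor (hf : MemLp f 2 (volume.restrict (Set.pi Set.univ O))) (m : ℕ)
    (j : Fin s) :
    matricize (coeffTensor m X φ f) j = tensorMatrix (tensorMap O j) (hf.toLp f)
      (fun k : Fin (m ^ d j) => ((h j).memLp k).toLp (φ j k))
      (fun c : ∀ i : {i // i ≠ j}, Fin (m ^ d i) =>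
        (memLp_prodFun (fun i : {i // i ≠ j} => h i) fun i => (c i : ℕ)).toLp
          (prodFun (fun i : {i // i ≠ j} => φ i) fun i => (c i : ℕ))) := by
  have hOXp := restrict_univ_pi_congr hOX
  ext k c
  simp only [matricize, coeffTensor, tensorMatrix, of_apply]
  rw [tensorMap_toLp, real_inner_toLp, prodDomain, ← hOXp]
  refine integral_congr_ae (Eventually.of_forall fun x => ?_)
  simp only [blockMul, prodFun]
  rw [Fintype.prod_eq_mul_prod_subtype_ne _ j]
  congr 2
  · simp [Equiv.piSplitAt]
  · refine Finset.prod_congr rfl fun i _ => ?_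
    simp [Equiv.piSplitAt, i.2]

end Reshaping

/-! ### Truncation on products of Sobolev domains -/

section Approximation

variable {s : ℕ} {d : Fin s → ℕ} {α : ℕ} {X : ∀ j, Set (Fin (d j) → ℝ)}
  {K : ∀ j, (Fin (d j) → ℝ) → (Fin (d j) → ℝ) → ℝ} {eig : Fin s → ℕ → ℝ}
  {φ : ∀ j, ℕ → (Fin (d j) → ℝ) → ℝ}

theorem GeneratesSobolev.isCompleteSystem {n : ℕ} {X : Set (Fin n → ℝ)}
    {K : (Fin n → ℝ) → (Fin n → ℝ) → ℝ} {eig : ℕ → ℝ} {ψ : ℕ → (Fin n → ℝ) → ℝ}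
    (hX : IsSobolevDomain α X) (hK : GeneratesSobolev α X K eig ψ) :
    IsCompleteSystem (interior X) ψ := by
  constructor
  · rw [hX.restrict_interior]; exact hK.isMercerKernel.memLp
  · rw [hX.restrict_interior]; exact hK.isMercerKernel.orthonormal
  · rw [hX.restrict_interior]; exact hK.isMercerKernel.complete

theorem IsSobolevDomain.isFiniteMeasure_interior {n : ℕ} {X : Set (Fin n → ℝ)}
    (hX : IsSobolevDomain α X) :
    IsFiniteMeasure ((volume : Measure (Fin n → ℝ)).restrict (interior X)) := by
  rw [hX.restrict_interior]
  exact ⟨by simpa using hX.isCompact.measure_lt_top⟩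

theorem interior_prodDomain : interior (prodDomain X) = Set.pi Set.univ fun j => interior (X j) :=
  interior_pi_set Set.finite_univ

/-- The matrix of leading coefficients of a smooth intensity has almost the same singular values as
the intensity itself. -/
theorem exists_singularValue_le_add (hd : ∀ j, 1 ≤ d j) (hX : ∀ j, IsSobolevDomain α (X j))
    (hK : ∀ j, GeneratesSobolev α (X j) (K j) (eig j) (φ j)) :
    ∃ C > 0, ∀ (f : (∀ j, Fin (d j) → ℝ) → ℝ), IsSmoothIntensity α X f →
    ∀ (m : ℕ), 1 ≤ m → ∀ (j : Fin s) (σ : ℕ → ℝ) (Φ : ℕ → (Fin (d j) → ℝ) → ℝ)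
      (Ψ : ℕ → (∀ i : {i // i ≠ j}, Fin (d i) → ℝ) → ℝ), IsFunctionSVD X f j σ Φ Ψ →
    ∀ {a b : ℕ} (U : Matrix (Fin (m ^ d j)) (Fin a) ℝ)
      (V : Matrix (∀ i : {i // i ≠ j}, Fin (m ^ d i)) (Fin b) ℝ) (τ : ℕ → ℝ),
      Uᵀ * U = 1 → Vᵀ * V = 1 → Antitone τ → (∀ k, 0 ≤ τ k) →
      (matricize (coeffTensor m X φ f) j = U * rectDiag a b τ * Vᵀ →
        ∀ R, σ R ≤ τ R + C * (sobNorm α X f / (m : ℝ) ^ α)) ∧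
      ∀ M' : Matrix (Fin (m ^ d j)) (∀ i : {i // i ≠ j}, Fin (m ^ d i)) ℝ,
        M' = U * rectDiag a b τ * Vᵀ → ∀ R, R < a → R < b →
          τ R ≤ σ R + ‖M' - matricize (coeffTensor m X φ f) j‖ := by
  choose C hC0 hC using fun j => exists_sum_coeff_tail_le (hX j) (hK j) (hd j)
  have hsys : ∀ j, IsCompleteSystem (interior (X j)) (φ j) := fun j => (hK j).isCompleteSystem (hX j)
  have hfin : ∀ j, IsFiniteMeasure ((volume : Measure (Fin (d j) → ℝ)).restrict (interior (X j))) :=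
    fun j => (hX j).isFiniteMeasure_interior
  have hCs : 0 ≤ ∑ j, C j := Finset.sum_nonneg fun j _ => (hC0 j).le
  -- The factor `2 √B` comes from the truncation estimate, with `√B = √(∑ C j) ‖f‖ m^(-α)`; the
  -- summand `1` only ensures positivity.
  refine ⟨2 * √(∑ j, C j) + 1, by positivity,
    fun f hf m hm j σ Φ Ψ hSVD a b U V τ hU hV hτ hτ0 => ?_⟩
  have hOX := fun j => (hX j).restrict_interior
  have hm0 : (0 : ℝ) < m := by exact_mod_cast hm
  obtain ⟨F, hfam⟩ : ∃ F,
      IsSobolevFamily (prodVec d) α (Set.pi Set.univ fun j => interior (X j)) f F := by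
    have := hf.memSobolev.isSobolevFamily
    rw [interior_prodDomain] at this
    exact ⟨_, this⟩
  have hopen : IsOpen (Set.pi Set.univ fun j => interior (X j)) :=
    isOpen_set_pi Set.finite_univ fun j _ => isOpen_interior
  have hnorm := hfam.sobolevNorm_sq hopen
  have hfm := hfam.memLp
  obtain ⟨Φ', Ψ', hexp⟩ := hSVD.exists_isTensorExpansion hOX hfm
  have hmat := matricize_coeffTensor hOX hsys hfm m j
  have he := orthonormal_block hsys j (m ^ d j)
  have hg := orthonormal_others hsys j fun j => m ^ d j
  refine ⟨fun hM R => ?_, fun M' hM' R hRa hRb => ?_⟩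
  · set B := (∑ j, C j * ((m : ℝ) ^ (2 * α))⁻¹) * sobNorm α X f ^ 2 with hBdef
    have hB : ∀ S : Finset (Fin s → ℕ), (∀ μ ∈ S, ∃ j, m ^ d j ≤ μ j) →
        ∑ μ ∈ S, ‖inner ℝ (prodBasis hsys μ) (hfm.toLp f)‖ ^ 2 ≤ B := by
      intro S hS
      have h1 := sum_integral_prodFun_sq_le hsys (fun j => isOpen_interior)
        (C := fun j => C j * ((m : ℝ) ^ (2 * α))⁻¹)
        (fun j => mul_nonneg (hC0 j).le (by positivity))
        (fun j g G hg S hS => hC j m hm g G hg S hS) hfam S hS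
      rw [← hnorm] at h1
      rw [hBdef, sobNorm, interior_prodDomain]
      refine le_trans (le_of_eq ?_) h1
      refine Finset.sum_congr rfl fun μ _ => ?_
      rw [prodBasis_apply, real_inner_toLp, Real.norm_eq_abs, sq_abs]
      congr 1
      exact integral_congr_ae (Eventually.of_forall fun x => mul_comm _ _)
    have hsq : √B = √(∑ j, C j) * (sobNorm α X f / (m : ℝ) ^ α) := by
      have h0 : 0 ≤ sobNorm α X f := Real.sqrt_nonneg _
      have : B = (∑ j, C j) * (sobNorm α X f / (m : ℝ) ^ α) ^ 2 := by
        rw [hBdef, ← Finset.sum_mul, div_pow, ← pow_mul, mul_comm α 2]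
        ring
      rw [this, Real.sqrt_mul hCs, Real.sqrt_sq (by positivity)]
    have h2 := hexp.le_singularValue_add he hg hU hV (hmat.symm.trans hM) hτ hτ0
      (ε := 2 * √B) (by positivity) (abs_inner_tensorMap_sub_le hsys hB j) R
    refine h2.trans ?_
    have h0 : 0 ≤ sobNorm α X f / (m : ℝ) ^ α := div_nonneg (Real.sqrt_nonneg _) (by positivity)
    rw [hsq]
    linarith
  · rw [hmat]
    exact hexp.singularValue_perturbed_le he hg hU hV hM' hτ hRa hRb

end Approximation

/-! ### Perturbation of the leading singular subspaces -/

section Perturbation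

/-- Here `t` and `t'` are the `R`-th and `(R+1)`-st singular values of the underlying function, and
`hlow`, `hup` are Weyl's inequalities. Either the perturbation is small against `t - t'` and Wedin's
theorem applies, or it is so large that the trivial bound by one suffices. -/
theorem norm_sinTheta_mul_le {a R : ℕ} {q : Type*} [Fintype q] [DecidableEq q]
    {M M' : Matrix (Fin a) q ℝ} {W W' : Matrix (Fin a) (Fin R) ℝ} (hW : IsTruncSVD M W)
    (hW' : IsTruncSVD M' W') {t t' ε : ℝ} (hR : 1 ≤ R) (ht' : 0 ≤ t')
    (hlow : ∀ (U : Matrix (Fin a) (Fin a) ℝ) (V : Matrix q (Fin (Fintype.card q)) ℝ) (τ : ℕ → ℝ),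
      Uᵀ * U = 1 → Vᵀ * V = 1 → Antitone τ → (∀ k, 0 ≤ τ k) →
      M = U * rectDiag a (Fintype.card q) τ * Vᵀ → t ≤ τ (R - 1) + ε)
    (hup : ∀ (U : Matrix (Fin a) (Fin a) ℝ) (V : Matrix q (Fin (Fintype.card q)) ℝ) (τ : ℕ → ℝ),
      Uᵀ * U = 1 → Vᵀ * V = 1 → Antitone τ → (∀ k, 0 ≤ τ k) →
      M' = U * rectDiag a (Fintype.card q) τ * Vᵀ → R < a → R < Fintype.card q →
      τ R ≤ t' + ‖M' - M‖)
    (hgap : 0 < t - t') (hε : 4 * ε ≤ t - t') :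
    ‖sinTheta W' W‖ * (t - t') ≤ 4 * ‖M' - M‖ := by
  obtain ⟨hRa, U, σ, V, hsvd, hWU⟩ := hW
  obtain ⟨_, U', σ', V', hsvd', hWU'⟩ := hW'
  obtain ⟨τ, hτ0, hτ, hτz, hM⟩ := hsvd.exists_normalized
  obtain ⟨τ', hτ0', hτ', hτz', hM'⟩ := hsvd'.exists_normalized
  have h1 := hlow U V τ hsvd.left_orth hsvd.right_orth hτ hτ0 hM
  have h2 : τ' R ≤ t' + ‖M' - M‖ := by
    by_cases h : R < a ∧ R < Fintype.card q
    · exact hup U' V' τ' hsvd'.left_orth hsvd'.right_orth hτ' hτ0' hM' h.1 h.2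
    · rw [hτz' R (by omega)]
      positivity
  -- If the matrix had fewer than `R` columns, its `R`-th singular value would be zero, forcing `t ≤
  -- ε ≤ (t - t') / 4`, which is impossible for `t > t' ≥ 0`.
  have hRb : R ≤ Fintype.card q := by
    by_contra hlt
    have h3 : τ (R - 1) = 0 := hτz _ (by omega)
    linarith
  by_cases hE : 4 * ‖M' - M‖ ≤ t - t'
  · have hg : (t - t') / 2 ≤ τ (R - 1) - τ' R := by linarith
    have hwedin := norm_left_angle_mul_gap_le hsvd.left_orth hsvd'.left_orth hsvd.right_orth
      hsvd'.right_orth hM hM' hτ hτ' hτ0' hRa hRb (by linarith)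
    have hsin := norm_sinTheta_le hRa hsvd.left_orth hsvd'.left_orth
    rw [← leading_eq_mul_rectDiag U W hRa hWU, ← leading_eq_mul_rectDiag U' W' hRa hWU'] at hsin
    have h4 : ‖sinTheta W' W‖ * ((t - t') / 2) ≤ ‖M' - M‖ :=
      (mul_le_mul hsin hg (by linarith) (norm_nonneg _)).trans hwedin
    linarith [norm_nonneg (M' - M)]
  · have h5 := mul_le_mul_of_nonneg_right (norm_sinTheta_le_one W' W) hgap.le
    linarith

theorem matricize_sub {s : ℕ} {p : Fin s → ℕ} (B b : Tensor p) (j : Fin s) :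
    matricize (B - b) j = matricize B j - matricize b j := rfl

/-- An identity matrix with columns numbered by `Fin`. -/
theorem exists_orthogonal_reindex (q : Type*) [Fintype q] [DecidableEq q] :
    ∃ W : Matrix q (Fin (Fintype.card q)) ℝ, Wᵀ * W = 1 ∧ W * Wᵀ = 1 := by
  refine ⟨(1 : Matrix q q ℝ).submatrix id (Fintype.equivFin q).symm, ?_, ?_⟩
  · rw [transpose_submatrix, transpose_one, ← submatrix_mul _ _ _ _ _ Function.bijective_id]
    · simp
  · rw [transpose_submatrix, transpose_one,
      submatrix_mul_equiv (1 : Matrix q q ℝ) 1 id (Fintype.equivFin q).symm id]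
    simp

end Perturbation

/-! ### The size of the fluctuations -/

section Fluctuation

theorem rpow_half_sq {x : ℝ} (hx : 0 ≤ x) (D : ℕ) : (x ^ ((D : ℝ) / 2)) ^ 2 = x ^ D := by
  rw [← Real.rpow_natCast, ← Real.rpow_mul hx, ← Real.rpow_natCast]
  congr 1
  push_cast
  ring

/-- The ceiling adds less than one, and `2 ≤ m` means that this at most doubles the number being
rounded. -/
theorem pow_le_of_eq_ceil {p m n : ℕ} {W L : ℝ} (hp : p ≠ 0) (hm2 : 2 ≤ m) (hW : 0 ≤ W)
    (hWL : W ≤ L) (hm : m = ⌈(W ^ 2 * n) ^ (1 / (p : ℝ))⌉₊) :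
    (m : ℝ) ^ p ≤ 2 ^ p * L ^ 2 * n := by
  have h0 : 0 ≤ W ^ 2 * n := by positivity
  have h1 : (m : ℝ) < (W ^ 2 * n) ^ (1 / (p : ℝ)) + 1 := by
    have := Nat.ceil_lt_add_one (Real.rpow_nonneg h0 (1 / (p : ℝ)))
    rwa [← hm] at this
  have hm2' : (2 : ℝ) ≤ m := by exact_mod_cast hm2
  have h2 : (m : ℝ) ≤ 2 * (W ^ 2 * n) ^ (1 / (p : ℝ)) := by linarith
  calc (m : ℝ) ^ p ≤ (2 * (W ^ 2 * n) ^ (1 / (p : ℝ))) ^ p :=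
        pow_le_pow_left₀ (by positivity) h2 p
    _ = 2 ^ p * (W ^ 2 * n) := by
        rw [mul_pow, one_div, Real.rpow_inv_natCast_pow h0 hp]
    _ ≤ 2 ^ p * (L ^ 2 * n) := by gcongr
    _ = _ := by ring

/-- After squaring, the claim is `m^D log m ≤ K n (m^(D-e) + m^e)`. One extra power of `m` pays for
the logarithm, and `m^(D+1) ≤ m^p m^e ≤ K n m^e`; the hypothesis `hD` is the integer form of the
dimension condition. -/
theorem fluctuation_le {p D e m n : ℕ} {K : ℝ} (hm2 : 2 ≤ m) (hn : 1 ≤ n) (hK : 0 ≤ K)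
    (hpow : (m : ℝ) ^ p ≤ K * n) (hD : D + 1 ≤ p + e) :
    (m : ℝ) ^ ((D : ℝ) / 2) * Real.log m / n
      ≤ √K * √(((m : ℝ) ^ (D - e) + (m : ℝ) ^ e) * Real.log m / n) := by
  have hm0 : (0 : ℝ) ≤ m := by positivity
  have hm1 : (1 : ℝ) ≤ m := by exact_mod_cast (by omega : 1 ≤ m)
  have hn0 : (0 : ℝ) < n := by exact_mod_cast hn
  have hl0 : 0 ≤ Real.log m := Real.log_nonneg hm1
  have hl : Real.log m ≤ m := Real.log_le_self hm0
  rw [← Real.sqrt_mul hK]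
  refine Real.le_sqrt_of_sq_le ?_
  rw [div_pow, mul_pow, rpow_half_sq hm0]
  have h1 : (m : ℝ) ^ D * Real.log m ≤ K * n * ((m : ℝ) ^ (D - e) + (m : ℝ) ^ e) := by
    calc (m : ℝ) ^ D * Real.log m ≤ (m : ℝ) ^ D * m := by gcongr
      _ = (m : ℝ) ^ (D + 1) := (pow_succ _ _).symm
      _ ≤ (m : ℝ) ^ (p + e) := pow_le_pow_right₀ hm1 hD
      _ = (m : ℝ) ^ p * (m : ℝ) ^ e := pow_add _ _ _
      _ ≤ K * n * ((m : ℝ) ^ (D - e) + (m : ℝ) ^ e) := by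
          refine mul_le_mul hpow ?_ (by positivity) (by positivity)
          linarith [pow_nonneg hm0 (D - e)]
  calc (m : ℝ) ^ D * Real.log m ^ 2 / n ^ 2
      = (m : ℝ) ^ D * Real.log m * (Real.log m / n ^ 2) := by ring
    _ ≤ K * n * ((m : ℝ) ^ (D - e) + (m : ℝ) ^ e) * (Real.log m / n ^ 2) := by
        gcongr
    _ = _ := by field_simp

theorem deviation_sqrt_le {lam L x l n : ℝ} (hL : 0 ≤ L) (hlam : lam ≤ L) (hx : 0 ≤ x) (hl : 0 ≤ l)
    (hn : 0 ≤ n) : √(lam * x * l / n) ≤ √L * √(x * l / n) := by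
  rw [← Real.sqrt_mul hL]
  refine Real.sqrt_le_sqrt ?_
  have : 0 ≤ x * l / n := by positivity
  calc lam * x * l / n = lam * (x * l / n) := by ring
    _ ≤ _ := mul_le_mul_of_nonneg_right hlam this

end Fluctuation

end PointProcessHOSVD

end

/-! ### The deviation bound for the leading singular subspaces -/

open PointProcessHOSVD in
theorem proposition1 (s : ℕ) (hs : 3 ≤ s) (d : Fin s → ℕ) (hd : ∀ j, 1 ≤ d j)
    (α : ℕ) (hα : 1 ≤ α)
    -- the condition `d_max + d_min > D - 2 α`
    (hdim : ∑ j, d j < 2 * α + (⨆ j, d j) + ⨅ j, d j)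
    (a₁ a₂ L : ℝ) (ha₁ : 0 < a₁) (ha₂ : 0 < a₂) (hL : 0 < L) :
    ∃ C : ℝ, 0 < C ∧
    ∀ (X : ∀ j, Set (Fin (d j) → ℝ)) (K : ∀ j, (Fin (d j) → ℝ) → (Fin (d j) → ℝ) → ℝ)
      (eig : Fin s → ℕ → ℝ) (φ : ∀ j, ℕ → (Fin (d j) → ℝ) → ℝ),
      (∀ j, IsSobolevDomain α (X j)) →
      (∀ j, GeneratesSobolev α (X j) (K j) (eig j) (φ j)) →
    ∃ Cgap : ℝ, 0 < Cgap ∧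
    ∀ {Ω : Type*} [MeasurableSpace Ω] (P : MeasureTheory.Measure Ω)
      [MeasureTheory.IsProbabilityMeasure P]
      (f : (∀ j, Fin (d j) → ℝ) → ℝ) (n m : ℕ)
      (N : Fin n → Ω → Finset (∀ j, Fin (d j) → ℝ)) (H₁ : Finset (Fin n))
      (R : Fin s → ℕ)
      (σ : Fin s → ℕ → ℝ) (Φ : ∀ j, ℕ → (Fin (d j) → ℝ) → ℝ)
      (Ψ : ∀ j, ℕ → (∀ i : {i // i ≠ j}, Fin (d i) → ℝ) → ℝ)
      (U : ∀ j, Matrix (Fin (m ^ d j)) (Fin (R j)) ℝ)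
      (Uhat : Ω → ∀ j, Matrix (Fin (m ^ d j)) (Fin (R j)) ℝ),
      IsSmoothIntensity α X f →
      sobNorm α X f ≤ L → supNorm X f ≤ L →
      (∀ i, IsPointProcess P X f (N i)) →
      H₁.Nonempty →
      -- the choice of `m`
      m = ⌈(sobNorm α X f ^ 2 * n) ^ (1 / (2 * α + (⨆ j, d j : ℕ)) : ℝ)⌉₊ →
      FundamentalBound P m n d a₁ a₂ (supNorm X f)
        (fun ω => empTensor m φ (fun i => N i ω) H₁) (coeffTensor m X φ f) →
      (∀ j, 1 ≤ R j) →
      (∀ j, IsFunctionSVD X f j (σ j) (Φ j) (Ψ j)) →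
      -- the spectral gap condition; `σ j (R j - 1)` is `σ_{j,R_j}` and `σ j (R j)` is `σ_{j,R_j+1}`
      (∀ j, Cgap * max (sobNorm α X f / (m : ℝ) ^ α)
          √((m : ℝ) ^ max (∑ k, d k - ⨅ k, d k) (⨆ k, d k) * Real.log m / n)
        ≤ σ j (R j - 1) - σ j (R j)) →
      (∀ j, IsTruncSVD (matricize (coeffTensor m X φ f) j) (U j)) →
      (∀ ω j, IsTruncSVD (matricize (empTensor m φ (fun i => N i ω) H₁) j) (Uhat ω j)) →
      P {ω | ¬ ∀ j, ‖sinTheta (Uhat ω j) (U j)‖ ≤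
          C / (σ j (R j - 1) - σ j (R j)) *
            √(((m : ℝ) ^ (∑ k, d k - d j) + (m : ℝ) ^ d j) * Real.log m / n)}
        ≤ ENNReal.ofReal (3 / (m : ℝ) ^ 5) := by
  set M := ⨆ j, d j with hM
  set p := 2 * α + M with hp
  have hp0 : p ≠ 0 := by omega
  -- The `4` comes from the perturbation bound, the bracket from the bound on the fluctuations; the
  -- kernels and domains enter neither.
  refine ⟨4 * (a₁ * √L + a₂ * √(2 ^ p * L ^ 2)), by positivity, fun X K eig φ hX hK => ?_⟩
  obtain ⟨C₀, hC₀, happ⟩ := exists_singularValue_le_add hd hX hK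
  -- Chosen so that four times the truncation error does not exceed the gap.
  refine ⟨4 * C₀, by positivity, ?_⟩
  intro Ω _ P _ f n m N H₁ R σ Φ Ψ U Uhat hf hfL hfs hN hH hm hFB hR hsvd hgap hU hUhat
  have hdM : ∀ j, d j ≤ M := fun j => le_ciSup (Set.finite_range d).bddAbove j
  have hmin : ∀ j, ⨅ k, d k ≤ d j := fun j => ciInf_le (OrderBot.bddBelow _) j
  have hn : 1 ≤ n := by
    obtain ⟨i, -⟩ := hH
    exact i.pos
  -- At least one singular vector is required, and it must fit into `m ^ d j` rows.
  have hm0 : m ≠ 0 := by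
    rintro rfl
    obtain ⟨h, -⟩ := hU ⟨0, by omega⟩
    rw [zero_pow (by have := hd ⟨0, by omega⟩; omega)] at h
    have := hR ⟨0, by omega⟩
    omega
  -- For `m = 1` the allowed probability is at least one. Otherwise `log m > 0`, which makes the gap
  -- positive.
  rcases (Nat.one_le_iff_ne_zero.2 hm0).eq_or_lt with hm1 | hm2
  · have h1 : (m : ℝ) = 1 := by exact_mod_cast hm1.symm
    refine prob_le_one.trans ?_
    rw [ENNReal.one_le_ofReal, h1]
    norm_num
  have hmR : (1 : ℝ) < m := by exact_mod_cast hm2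
  have hn0 : (0 : ℝ) < n := by exact_mod_cast hn
  have hlog : 0 < Real.log m := Real.log_pos hmR
  have hW0 : 0 ≤ sobNorm α X f := Real.sqrt_nonneg _
  have hpow : (m : ℝ) ^ p ≤ 2 ^ p * L ^ 2 * n := by
    refine pow_le_of_eq_ceil hp0 hm2 hW0 hfL ?_
    rw [hm, hp]
    push_cast
    rfl
  have hgap_pos : ∀ j, 0 < σ j (R j - 1) - σ j (R j) := fun j => by
    refine lt_of_lt_of_le (mul_pos (by positivity) (lt_max_of_lt_right ?_)) (hgap j)
    exact Real.sqrt_pos.2 (by positivity)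
  choose W₂ hW₂ hW₂' using fun j : Fin s =>
    exists_orthogonal_reindex (∀ i : {i // i ≠ j}, Fin (m ^ d i))
  have hcard : ∀ j, Fintype.card (∀ i : {i // i ≠ j}, Fin (m ^ d i)) = m ^ (∑ k, d k - d j) := by
    intro j
    rw [Fintype.card_pi]
    simp only [Fintype.card_fin]
    rw [Finset.prod_pow_eq_pow_sum, Fintype.sum_eq_add_sum_subtype_ne d j, Nat.add_sub_cancel_left]
  -- With the identity on the left and an orthogonal reindexing on the right, the bound controls the
  -- full deviation, and `r₁ + r₂` becomes `m^(d j) + m^(D - d j)`. A single application covers all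
  -- modes at once.
  have hbad := hFB (fun j => m ^ d j) (fun j => Fintype.card (∀ i : {i // i ≠ j}, Fin (m ^ d i)))
    (fun j => 1) W₂ (fun j => by simp) hW₂
  refine le_trans (measure_mono ?_)
    (hbad.trans (ENNReal.ofReal_le_ofReal (by gcongr; norm_num)))
  intro ω hω hgood
  refine hω fun j => ?_
  set B := empTensor m φ (fun i => N i ω) H₁
  set b := coeffTensor m X φ f
  set S := √(((m : ℝ) ^ (∑ k, d k - d j) + (m : ℝ) ^ d j) * Real.log m / n) with hS
  have hE : ‖matricize B j - matricize b j‖ ≤ (a₁ * √L + a₂ * √(2 ^ p * L ^ 2)) * S := by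
    have h1 := hgood j
    have h5 : ((m ^ d j : ℕ) : ℝ) + (Fintype.card (∀ i : {i // i ≠ j}, Fin (m ^ d i)) : ℕ)
        = (m : ℝ) ^ (∑ k, d k - d j) + (m : ℝ) ^ d j := by
      rw [hcard]; push_cast; ring
    rw [transpose_one, Matrix.one_mul, matricize_sub, h5] at h1
    -- The right factor is orthogonal on both sides, so multiplying by its transpose removes it
    -- without loss.
    have h2 : ‖matricize B j - matricize b j‖ ≤ ‖(matricize B j - matricize b j) * W₂ j‖ := by
      calc ‖matricize B j - matricize b j‖
          = ‖(matricize B j - matricize b j) * W₂ j * (W₂ j)ᵀ‖ := by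
            rw [Matrix.mul_assoc, hW₂', Matrix.mul_one]
        _ ≤ ‖(matricize B j - matricize b j) * W₂ j‖ * ‖(W₂ j)ᵀ‖ := l2_opNorm_mul _ _
        _ ≤ ‖(matricize B j - matricize b j) * W₂ j‖ * 1 := by
            refine mul_le_mul_of_nonneg_left ?_ (norm_nonneg _)
            rw [PointProcessHOSVD.norm_transpose]
            exact norm_le_one_of_transpose_mul_self (hW₂ j)
        _ = _ := mul_one _
    refine (h2.trans h1).trans ?_
    have h3 := deviation_sqrt_le (x := (m : ℝ) ^ (∑ k, d k - d j) + (m : ℝ) ^ d j) hL.le hfs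
      (by positivity) hlog.le hn0.le
    have h4 := fluctuation_le (D := ∑ k, d k) (e := d j) hm2 hn
      (by positivity : (0 : ℝ) ≤ 2 ^ p * L ^ 2) hpow (by have := hmin j; omega)
    rw [← hS] at h3 h4
    calc _ ≤ a₁ * (√L * S) + a₂ * (√(2 ^ p * L ^ 2) * S) := by gcongr
      _ = _ := by ring
  have hsin := norm_sinTheta_mul_le (hU j) (hUhat ω j) (t := σ j (R j - 1)) (t' := σ j (R j))
    (ε := C₀ * (sobNorm α X f / (m : ℝ) ^ α)) (hR j) ((hsvd j).nonneg _)
    (fun V W τ h1 h2 h3 h4 h5 =>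
      (happ f hf m hm2.le j _ _ _ (hsvd j) V W τ h1 h2 h3 h4).1 h5 _)
    (fun V W τ h1 h2 h3 h4 h5 h6 h7 =>
      (happ f hf m hm2.le j _ _ _ (hsvd j) V W τ h1 h2 h3 h4).2 _ h5 _ h6 h7)
    (hgap_pos j) ((le_trans (by
      rw [← mul_assoc]
      exact mul_le_mul_of_nonneg_left (le_max_left _ _) (by positivity)) (hgap j)))
  rw [div_mul_eq_mul_div, le_div_iff₀ (hgap_pos j)]
  linarith
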